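/- Let $d\in\mathbb N$ and let $b_j,f_j,g_j,c_j:\mathbb R\to\mathbb R$ ($1\le j\le d$), with $c_j\in C^1$ and $b_j,f_j,g_j$ piecewise continuous. Let $$H(t)\psi=-\tfrac12\Delta\psi+\sum_{j=1}^d\Big(\tfrac{b_j(t)}2x_j^2\psi-f_j(t)x_j\psi+ig_j(t)\partial_{x_j}\psi-\tfrac{ic_j(t)}2(2x_j\partial_{x_j}\psi+\psi)\Big),$$ and let $U_H(t)$, $t\in\mathbb R$, be its evolution operator on $L^2(\mathbb R^d)$: for every Schwartz function $\varphi$, $\psi(t)=U_H(t)\varphi$ is the Schwartz-class solution of $i\partial_t\psi=H(t)\psi$, $\psi(0)=\varphi$ (continuous in time with values in $L^2$, the equation holding in $L^2$ at every time at which the coefficients are continuous). Suppose that for some $\gamma>0$ and some measurable $w:\mathbb R\to[0,\infty]$ in weak $L^1(\mathbb R)$, i.e. with $\|w\|_{L^1_\omega}=\sup_{a>0}a\,|\{w>a\}|<\infty$, $$\|U_H(t)U_H(s)^*F\|_{L^\infty}\le w(t-s)^{\gamma}\,\|F\|_{L^1}\qquad\text{for all }t,s\in\mathbb R,\ F\in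 L^1\cap L^2(\mathbb R^d).$$ Call $(q,r)\in[2,\infty]^2$ sharp $\gamma$-admissible if $\frac1q+\frac\gamma r=\frac\gamma2$ and $(q,r,\gamma)\ne(2,\infty,1)$; write $p'$ for the exponent conjugate to $p$. For $T\in[0,\infty]$ put $I=(-T,T)$ and $A_T=\|w\,\mathbf 1_{(-2T,2T)}\|_{L^1_\omega}$. Then for all sharp $\gamma$-admissible pairs $(q,r)$ and $(\tilde q,\tilde r)$ there are finite constants $c,\tilde c$ depending only on $d,\gamma,q,r$ and $C$ depending only on $d,\gamma,q,r,\tilde q,\tilde r$ such that, for every $T\in[0,\infty]$: 1. for all $f\in L^2(\mathbb R^d)$: $\ \|U_H(t)f\|_{L^q_t(I;L^r_x)}\le c\,A_T^{1/q}\,\|f\|_{L^2}$; 2. for all $F\in L^{q'}(I;L^{r'}(\mathbb R^d))$ the integral $\int_I U_H(s)^*F(s)\,ds$ exists in $L^2(\mathbb R^d)$ and $\ \big\|\int_I U_H(s)^*F(s)\,ds\big\|_{L^2}\le \tilde c\,A_T^{1/q}\,\|F\|_{L^{q'}(I;L^{r'})}$; 3. for all $F\in L^{\tilde q'}(I;L^{\tilde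 r'}(\mathbb R^d))$ and all $t\in I$ the integral $\int_{s\in I,\,s<t}U_H(s)^*F(s)\,ds$ exists in $L^2(\mathbb R^d)$ and $\ \big\|U_H(t)\int_{s\in I,\,s<t}U_H(s)^*F(s)\,ds\big\|_{L^q_t(I;L^r_x)}\le C\,A_T^{1/q+1/\tilde q}\,\|F\|_{L^{\tilde q'}(I;L^{\tilde r'})}$. Here $v=\int_S U_H(s)^*F(s)\,ds$ is meant weakly: $\langle v,h\rangle=\int_S\langle F(s),U_H(s)h\rangle\,ds$ for all $h\in L^2(\mathbb R^d)$, with absolute convergence (the Bochner integral if $F\in L^1(S;L^2)$). -/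

import Mathlib

open MeasureTheory
open scoped ENNReal NNReal SchwartzMap Laplacian

noncomputable section

namespace Strichartz

/-- The space `ℝᵈ` with its Euclidean norm and Lebesgue measure. -/
abbrev Space (d : ℕ) : Type := EuclideanSpace ℝ (Fin d)

/-- The Hilbert space `L²(ℝᵈ)` of complex-valued functions. -/
abbrev L2 (d : ℕ) : Type := Lp ℂ 2 (volume : Measure (Space d))

/-! ### The quadratic Hamiltonian and its evolution operator -/

/-- Piecewise continuity on `ℝ`: outside a set `J` that meets every bounded interval in finitely
many points the function is continuous, and at the points of `J` it has one-sided limits. -/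
def PiecewiseContinuous (h : ℝ → ℝ) : Prop :=
  ∃ J : Set ℝ, (∀ R : ℝ, (J ∩ Set.Icc (-R) R).Finite) ∧
    (∀ t, t ∉ J → ContinuousAt h t) ∧
    ∀ t ∈ J, (∃ l, Filter.Tendsto h (nhdsWithin t (Set.Iio t)) (nhds l)) ∧
      ∃ l, Filter.Tendsto h (nhdsWithin t (Set.Ioi t)) (nhds l)

/-- The partial derivative `∂ψ/∂x_j` at `x`. -/
def partialDeriv {d : ℕ} (j : Fin d) (ψ : Space d → ℂ) (x : Space d) : ℂ :=
  fderiv ℝ ψ x (EuclideanSpace.single j (1 : ℝ))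

/-- The function `H(t)ψ` for the quadratic Hamiltonian
`H(t)ψ = -½Δψ + ∑_j ( b_j(t)/2 x_j² ψ - f_j(t) x_j ψ + i g_j(t) ∂_jψ - i c_j(t)/2 (2 x_j ∂_jψ + ψ) )`. -/
def hamiltonian {d : ℕ} (b f g c : Fin d → ℝ → ℝ) (t : ℝ) (ψ : Space d → ℂ) (x : Space d) : ℂ :=
  -(1 / 2 : ℂ) * (Δ ψ) x +
    ∑ j : Fin d,
      (((b j t / 2 * x j ^ 2 : ℝ) : ℂ) * ψ x - ((f j t * x j : ℝ) : ℂ) * ψ x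
        + Complex.I * (g j t : ℂ) * partialDeriv j ψ x
        - Complex.I * ((c j t / 2 : ℝ) : ℂ) * (2 * (x j : ℂ) * partialDeriv j ψ x + ψ x))

/-- `U` is the evolution operator `U_H` of `i ∂ψ/∂t = H(t)ψ`, `ψ(0) = φ`: every `U t` is a bounded
linear operator on `L²(ℝᵈ)`, and for a Schwartz function `φ` the curve `ψ t = U t φ` consists of
Schwartz functions, starts at `φ`, is continuous in `L²`, and has the `L²`-derivative
`-i H(t) ψ(t)` at every time at which the coefficients are continuous.
(By density of the Schwartz functions and conservation of the `L²` norm there is at most one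
such `U` when the coefficients are piecewise continuous.) -/
def IsEvolutionOperator {d : ℕ} (b f g c : Fin d → ℝ → ℝ) (U : ℝ → L2 d →L[ℂ] L2 d) : Prop :=
  ∀ φ : 𝓢(Space d, ℂ), ∃ ψ : ℝ → 𝓢(Space d, ℂ),
    ψ 0 = φ ∧
    (∀ t, U t (φ.toLp 2) = (ψ t).toLp 2) ∧
    Continuous (fun t => (ψ t).toLp 2 (volume : Measure (Space d))) ∧
    ∀ t, (∀ j, ContinuousAt (b j) t ∧ ContinuousAt (f j) t ∧ ContinuousAt (g j) t ∧
        ContinuousAt (c j) t) →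
      ∃ D : L2 d, (D =ᵐ[volume] fun x => -Complex.I * hamiltonian b f g c t (ψ t) x) ∧
        HasDerivAt (fun s => (ψ s).toLp 2 (volume : Measure (Space d))) D t

/-! ### Weak `L¹`, mixed norms, admissible pairs -/

/-- The weak `L¹` quasi-norm `sup_{a > 0} a · |{τ : w(τ) > a}|` on `ℝ`. -/
def weakL1Norm (w : ℝ → ℝ≥0∞) : ℝ≥0∞ :=
  ⨆ a : ℝ≥0, (a : ℝ≥0∞) * volume {τ : ℝ | (a : ℝ≥0∞) < w τ}

/-- Membership in weak `L¹(ℝ)`. -/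
def MemWeakL1 (w : ℝ → ℝ≥0∞) : Prop :=
  AEMeasurable w ∧ weakL1Norm w < ⊤

/-- The interval `(-T, T)`, for `T ∈ [0, ∞]`. -/
def symmInterval (T : ℝ≥0∞) : Set ℝ := {t : ℝ | ‖t‖ₑ < T}

/-- The mixed norm `‖F‖_{L^q(I; L^r(ℝᵈ))}`. -/
def mixedNorm {d : ℕ} (q r : ℝ≥0∞) (I : Set ℝ) (F : ℝ → Space d → ℂ) : ℝ≥0∞ :=
  eLpNorm (fun t => eLpNorm (F t) r volume) q (volume.restrict I)

/-- Membership in `L^q(I; L^r(ℝᵈ))`, for (jointly measurable) functions on `I × ℝᵈ`. -/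
def MemMixed {d : ℕ} (q r : ℝ≥0∞) (I : Set ℝ) (F : ℝ → Space d → ℂ) : Prop :=
  AEStronglyMeasurable (Function.uncurry F)
      ((volume.restrict I).prod (volume : Measure (Space d))) ∧
    mixedNorm q r I F < ⊤

/-- `(q, r)` is sharp `σ`-admissible: `q, r ≥ 2`, `(q, r, σ) ≠ (2, ∞, 1)` and
`1/q + σ/r = σ/2`. -/
def SharpAdmissible (σ : ℝ) (q r : ℝ≥0∞) : Prop :=
  2 ≤ q ∧ 2 ≤ r ∧ ¬(q = 2 ∧ r = ⊤ ∧ σ = 1) ∧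
    q⁻¹ + ENNReal.ofReal σ * r⁻¹ = ENNReal.ofReal σ / 2

/-! ### The dispersive estimate and the operator-valued integrals -/

/-- The estimate `‖U(t) U(s)^* φ‖_∞ ≤ w(t - s)^γ ‖φ‖_1`, for all `t, s` and `φ ∈ L¹ ∩ L²`. The
weight may take the value `∞`, for example at `0`, where the estimate is then void. -/
def DispersiveEstimate {d : ℕ} (γ : ℝ) (w : ℝ → ℝ≥0∞) (U : ℝ → L2 d →L[ℂ] L2 d) : Prop :=
  ∀ (t s : ℝ) (φ : L2 d), MemLp φ 1 (volume : Measure (Space d)) →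
    eLpNorm (U t (ContinuousLinearMap.adjoint (U s) φ)) ⊤ (volume : Measure (Space d))
      ≤ w (t - s) ^ γ * eLpNorm φ 1 (volume : Measure (Space d))

/-- `v = ∫_S U(s)^* F(s) ds` in the weak sense: for every `h ∈ L²(ℝᵈ)`,
`⟨v, h⟩ = ∫_S ⟨F(s), U(s) h⟩ ds`, where `⟨·, ·⟩` is the `L²` pairing `∫ \bar{F(s,x)} (U(s)h)(x) dx`
and both integrals converge absolutely. This is the Bochner integral when `F ∈ L¹(S; L²)`;
it makes sense of the integral also when `F(s)` lies in some other `L^p(ℝᵈ)`. Such a `v` is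
unique. -/
structure IsAdjointIntegral {d : ℕ} (U : ℝ → L2 d →L[ℂ] L2 d) (S : Set ℝ)
    (F : ℝ → Space d → ℂ) (v : L2 d) : Prop where
  integrable_pairing : ∀ h : L2 d, ∀ᵐ s ∂(volume.restrict S),
    Integrable (fun x => inner ℂ (F s x) (U s h x)) (volume : Measure (Space d))
  integrable : ∀ h : L2 d,
    IntegrableOn (fun s => ∫ x : Space d, inner ℂ (F s x) (U s h x)) S volume
  inner_eq : ∀ h : L2 d, inner ℂ v h = ∫ s in S, ∫ x : Space d, inner ℂ (F s x) (U s h x)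

/-- The standing situation: real coefficients (`c` continuously differentiable; `b`, `f`, `g`
piecewise continuous), `U` the evolution operator of the corresponding quadratic Hamiltonian, and
the dispersive estimate with a weight in weak `L¹`. -/
structure Setting {d : ℕ} (γ : ℝ) (b f g c : Fin d → ℝ → ℝ) (U : ℝ → L2 d →L[ℂ] L2 d)
    (w : ℝ → ℝ≥0∞) : Prop where
  piecewise_b : ∀ j, PiecewiseContinuous (b j)
  piecewise_f : ∀ j, PiecewiseContinuous (f j)
  piecewise_g : ∀ j, PiecewiseContinuous (g j)
  contDiff_c : ∀ j, ContDiff ℝ 1 (c j)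
  evolution : IsEvolutionOperator b f g c U
  memWeakL1 : MemWeakL1 w
  dispersive : DispersiveEstimate γ w U

end Strichartz

end

/-! The proof is a `TT*` argument. Put ρ = r' and θ = 1/q = γ(1/ρ - 1/2) (`timeExp`), and consider
the form ∬_{t-s∈D} ⟨U(s)^*F(s), U(t)^*G(t)⟩ ds dt (`bform`). The central claim
(`exists_bilinearBound`) bounds it by A^{2θ} times the L^{q'}_t L^ρ_x norms of F and G, uniformly in
the measurable set D. With D = ℝ and F = G this is the square of the dual estimate, whose dual is
the homogeneous one. With D = (0,∞) it is the retarded estimate for equal pairs. Since D is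
arbitrary, no Christ–Kiselev argument is needed and the endpoint q = 2 is included.

Apart from the dispersive bound, the only facts used about U are that it consists of contractions
and is strongly continuous. Both come from conservation of the L² norm: -iH(t) is skew-symmetric on
Schwartz functions (`rePair_generator`), and Schwartz functions are dense.

Away from the endpoint, 0 < θ < 1/2, interpolation at fixed s, t between the L² × L² bound and the
L¹ × L¹ bound (`exists_interpolation`) gives the kernel w(t-s)^{2θ}. As w is in weak L¹, this kernel
is of weak L^{1/(2θ)} type, and the Hardy–Littlewood–Sobolev inequality applies
(`exists_bilinearBound_of_lt`). The case θ = 0 is the trivial energy bound.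

At the endpoint θ = 1/2, where γ > 1, the Keel–Tao scheme is followed, with the level sets {2^j < w
≤ 2^{j+1}} in place of dyadic ranges of t - s. Such a set has measure at most A 2^{-j}. F(s) and
G(t) are split at each time into dyadic layers indexed by k and l. Each piece has three bounds: the
dispersive one, and two that combine a non-endpoint estimate in one function with the energy
estimate in the other. Their exponents are three linear forms in u = γj - ρk and v = γj - ρl, one of
which is always at most -ε(|u| + |v|) (`exists_neg_le_of_linear_forms`). The triple sum therefore
converges geometrically, and square summability of the layers closes the estimate.

For different pairs in the retarded estimate, the diagonal estimate is interpolated with the L^∞_t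
L²_x bound when the left side has the smaller θ; otherwise the form is transposed. All bounds are
proved for bounded functions of bounded support. Truncation then defines the weak integral for
general F, and Fatou's lemma carries the retarded bound over. -/

noncomputable section

namespace Strichartz

section

/-! ### Conservation of the `L²` norm -/

/-- The real part of the `L²` pairing of two Schwartz functions. -/
def rePair {d : ℕ} (φ η : 𝓢(Space d, ℂ)) : ℝ :=
  ∫ x, innerSL ℝ (φ x) (η x) ∂(volume : Measure (Space d))

variable {d : ℕ}

lemma rePair_eq (φ η : 𝓢(Space d, ℂ)) :
    rePair φ η = (inner ℂ (φ.toLp 2 (volume : Measure (Space d))) (η.toLp 2)).re := by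
  have he := SchwartzMap.inner_toL2_toL2_eq φ η (volume : Measure (Space d))
  rw [he]
  have hi : Integrable (fun x => inner ℂ (φ x) (η x)) (volume : Measure (Space d)) := by
    refine (L2.integrable_inner (𝕜 := ℂ) (φ.toLp 2 (volume : Measure (Space d)))
      (η.toLp 2)).congr ?_
    filter_upwards [φ.coeFn_toLp 2, η.coeFn_toLp 2] with x h1 h2
    rw [h1, h2]
  rw [← RCLike.re_eq_complex_re, ← integral_re hi]
  rfl

lemma rePair_comm (φ η : 𝓢(Space d, ℂ)) : rePair φ η = rePair η φ := by
  simp only [rePair, innerSL_apply_apply]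
  congr 1; ext x; exact real_inner_comm _ _

lemma rePair_add (φ η ζ : 𝓢(Space d, ℂ)) :
    rePair φ (η + ζ) = rePair φ η + rePair φ ζ := by
  rw [rePair_eq, rePair_eq, rePair_eq, ← Complex.add_re, ← inner_add_right]
  exact congrArg _ (congrArg _ (map_add (SchwartzMap.toLpCLM ℂ ℂ 2 volume) η ζ))

lemma rePair_smul (a : ℝ) (φ η : 𝓢(Space d, ℂ)) :
    rePair φ ((a : ℂ) • η) = a * rePair φ η := by
  simp only [rePair, innerSL_apply_apply, _root_.smul_apply, ← integral_const_mul]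
  congr 1; ext x
  simp [Complex.inner]; ring

lemma rePair_I_self (φ : 𝓢(Space d, ℂ)) : rePair φ (Complex.I • φ) = 0 := by
  simp only [rePair, innerSL_apply_apply, _root_.smul_apply]
  refine integral_eq_zero_of_ae (Filter.Eventually.of_forall fun x => ?_)
  simp [Complex.inner]; ring

lemma rePair_I_left (φ η : 𝓢(Space d, ℂ)) :
    rePair φ (Complex.I • η) = - rePair (Complex.I • φ) η := by
  simp only [rePair, innerSL_apply_apply, _root_.smul_apply, ← integral_neg]
  congr 1; ext x
  simp [Complex.inner]; ring

lemma rePair_sum {ι : Type*} (s : Finset ι) (φ : 𝓢(Space d, ℂ)) (η : ι → 𝓢(Space d, ℂ)) :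
    rePair φ (∑ i ∈ s, η i) = ∑ i ∈ s, rePair φ (η i) := by
  classical
  induction s using Finset.induction_on with
  | empty => simp [rePair]
  | insert i s hi ih => rw [Finset.sum_insert hi, Finset.sum_insert hi, rePair_add, ih]

/-- Multiplication of a Schwartz function by a coordinate. -/
def mulCoord (j : Fin d) (φ : 𝓢(Space d, ℂ)) : 𝓢(Space d, ℂ) :=
  SchwartzMap.smulLeftCLM ℂ (fun x : Space d => x j) φ

lemma mulCoord_apply (j : Fin d) (φ : 𝓢(Space d, ℂ)) (x : Space d) :
    mulCoord j φ x = (x j : ℂ) * φ x := by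
  have h : Function.HasTemperateGrowth (fun x : Space d => x j) :=
    (EuclideanSpace.proj (𝕜 := ℝ) j : Space d →L[ℝ] ℝ).hasTemperateGrowth
  rw [mulCoord, SchwartzMap.smulLeftCLM_apply_apply h, Complex.real_smul]

/-- The partial derivative of a Schwartz function, as a Schwartz function. -/
def diffCoord (j : Fin d) (φ : 𝓢(Space d, ℂ)) : 𝓢(Space d, ℂ) :=
  LineDeriv.lineDerivOp (EuclideanSpace.single j (1 : ℝ)) φ

lemma diffCoord_apply (j : Fin d) (φ : 𝓢(Space d, ℂ)) (x : Space d) :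
    diffCoord j φ x = partialDeriv j φ x :=
  SchwartzMap.lineDerivOp_apply_eq_fderiv _ _ _

lemma diffCoord_mulCoord (j : Fin d) (φ : 𝓢(Space d, ℂ)) :
    diffCoord j (mulCoord j φ) = φ + mulCoord j (diffCoord j φ) := by
  ext x
  rw [_root_.add_apply, mulCoord_apply, diffCoord_apply, diffCoord_apply, partialDeriv,
    partialDeriv]
  have h1 : HasFDerivAt (fun x : Space d => ((x j : ℝ) : ℂ))
      (Complex.ofRealCLM.comp (EuclideanSpace.proj (𝕜 := ℝ) j : Space d →L[ℝ] ℝ)) x :=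
    (Complex.ofRealCLM.comp (EuclideanSpace.proj (𝕜 := ℝ) j : Space d →L[ℝ] ℝ)).hasFDerivAt
  have h2 := h1.mul (φ.hasFDerivAt x)
  have h3 : (mulCoord j φ : Space d → ℂ) = fun x => ((x j : ℝ) : ℂ) * φ x := by
    ext y; exact mulCoord_apply j φ y
  rw [h3, show (fun x : Space d => ((x j : ℝ) : ℂ) * φ x)
    = (fun x : Space d => ((x j : ℝ) : ℂ)) * (φ : Space d → ℂ) from rfl, h2.fderiv]
  simp
  ring

lemma rePair_diffCoord (j : Fin d) (φ η : 𝓢(Space d, ℂ)) :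
    rePair φ (diffCoord j η) = - rePair (diffCoord j φ) η :=
  SchwartzMap.integral_bilinear_lineDerivOp_right_eq_neg_left φ η (innerSL ℝ) _

/-- Two integrations by parts make Δ symmetric for the real pairing, and moving I across the pairing
changes the sign. The quantity is therefore its own negative. -/
lemma rePair_laplacian (φ : 𝓢(Space d, ℂ)) : rePair φ (Complex.I • Δ φ) = 0 := by
  have h1 : rePair (Complex.I • φ) (Δ φ) = rePair (Δ (Complex.I • φ)) φ :=
    SchwartzMap.integral_bilinear_laplacian_right_eq_left (Complex.I • φ) φ (innerSL ℝ)
  have h2 : Δ (Complex.I • φ) = Complex.I • Δ φ := by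
    rw [← SchwartzMap.laplacianCLM_eq ℂ, ← SchwartzMap.laplacianCLM_eq ℂ, map_smul]
  rw [h2, rePair_comm (Complex.I • Δ φ)] at h1
  have h3 := rePair_I_left φ (Δ φ)
  linarith

/-- `-i H(t) φ` as a Schwartz function. -/
def generator (b f g c : Fin d → ℝ) (φ : 𝓢(Space d, ℂ)) : 𝓢(Space d, ℂ) :=
  ((1 / 2 : ℝ) : ℂ) • Complex.I • Δ φ + ∑ j : Fin d,
    (((-(b j / 2) : ℝ) : ℂ) • Complex.I • mulCoord j (mulCoord j φ)
      + ((f j : ℝ) : ℂ) • Complex.I • mulCoord j φ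
      + ((g j : ℝ) : ℂ) • diffCoord j φ
      + ((-c j : ℝ) : ℂ) • (mulCoord j (diffCoord j φ) + ((1 / 2 : ℝ) : ℂ) • φ))

lemma generator_apply (b f g c : Fin d → ℝ → ℝ) (t : ℝ) (φ : 𝓢(Space d, ℂ)) (x : Space d) :
    generator (fun j => b j t) (fun j => f j t) (fun j => g j t) (fun j => c j t) φ x
      = -Complex.I * hamiltonian b f g c t φ x := by
  simp only [generator, hamiltonian, _root_.add_apply, _root_.smul_apply,
    _root_.sum_apply, mulCoord_apply, diffCoord_apply, SchwartzMap.laplacian_apply,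
    smul_eq_mul, mul_add, Finset.mul_sum]
  congr 1
  · push_cast; ring
  · refine Finset.sum_congr rfl fun j _ => ?_
    push_cast
    linear_combination ((g j t : ℂ) * partialDeriv j φ x
      - (c j t : ℂ) * (x j * partialDeriv j φ x + 1/2 * φ x)) * Complex.I_mul_I

/-- Each summand of -iH(t) is skew for the real pairing. For I times a real multiplication this is
pointwise, and for the derivatives it is integration by parts. In the dilation term the summand φ/2
exactly compensates the commutator of ∂_j and x_j. -/
lemma rePair_generator (b f g c : Fin d → ℝ) (φ : 𝓢(Space d, ℂ)) :
    rePair φ (generator b f g c φ) = 0 := by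
  have hm : ∀ j (η ζ : 𝓢(Space d, ℂ)), rePair η (mulCoord j ζ) = rePair (mulCoord j η) ζ := by
    intro j η ζ
    simp only [rePair, mulCoord_apply, innerSL_apply_apply]
    congr 1; ext x
    simp [Complex.inner]; ring
  have hI : ∀ j (η : 𝓢(Space d, ℂ)), Complex.I • mulCoord j η = mulCoord j (Complex.I • η) := by
    intro j η; ext x; simp [mulCoord_apply]; ring
  rw [generator, rePair_add, rePair_smul, rePair_laplacian, rePair_sum, mul_zero, zero_add]
  refine Finset.sum_eq_zero fun j _ => ?_
  rw [rePair_add, rePair_add, rePair_add, rePair_smul, rePair_smul, rePair_smul, rePair_smul]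
  have h1 : rePair φ (Complex.I • mulCoord j (mulCoord j φ)) = 0 := by
    rw [hI, hI, hm, ← hI, rePair_I_self]
  have h2 : rePair φ (Complex.I • mulCoord j φ) = 0 := by
    have h := rePair_I_left (mulCoord j φ) φ
    rw [rePair_comm (Complex.I • mulCoord j φ), ← hm, ← hI] at h
    linarith
  have h3 : rePair φ (diffCoord j φ) = 0 := by
    have := rePair_diffCoord j φ φ
    rw [rePair_comm (diffCoord j φ)] at this
    linarith
  have h4 : rePair φ (mulCoord j (diffCoord j φ) + ((1 / 2 : ℝ) : ℂ) • φ) = 0 := by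
    rw [rePair_add, rePair_smul, hm]
    have := rePair_diffCoord j (mulCoord j φ) φ
    rw [diffCoord_mulCoord, rePair_comm _ φ, rePair_add, hm] at this
    linarith
  rw [h1, h2, h3, h4]; ring

lemma PiecewiseContinuous.exists_countable {h : ℝ → ℝ} (hh : PiecewiseContinuous h) :
    ∃ J : Set ℝ, J.Countable ∧ ∀ t, t ∉ J → ContinuousAt h t := by
  obtain ⟨J, h1, h2, -⟩ := hh
  refine ⟨J, ?_, h2⟩
  have : J = ⋃ n : ℕ, J ∩ Set.Icc (-(n : ℝ)) n := by
    ext t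
    simp only [Set.mem_iUnion, Set.mem_inter_iff, Set.mem_Icc, exists_and_left, iff_self_and]
    intro _
    obtain ⟨n, hn⟩ := exists_nat_ge |t|
    exact ⟨n, abs_le.1 hn⟩
  rw [this]
  exact Set.countable_iUnion fun n => (h1 n).countable

variable {γ : ℝ} {b f g c : Fin d → ℝ → ℝ} {U : ℝ → L2 d →L[ℂ] L2 d} {w : ℝ → ℝ≥0∞}

lemma Setting.countable_discontinuities (h : Setting γ b f g c U w) :
    ∃ J : Set ℝ, J.Countable ∧ ∀ t, t ∉ J → ∀ j, ContinuousAt (b j) t ∧ ContinuousAt (f j) t ∧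
      ContinuousAt (g j) t ∧ ContinuousAt (c j) t := by
  choose Jb hb hb' using fun j => (h.piecewise_b j).exists_countable
  choose Jf hf hf' using fun j => (h.piecewise_f j).exists_countable
  choose Jg hg hg' using fun j => (h.piecewise_g j).exists_countable
  refine ⟨⋃ j, (Jb j ∪ Jf j ∪ Jg j), Set.countable_iUnion fun j => ((hb j).union (hf j)).union (hg j),
    fun t ht j => ?_⟩
  simp only [Set.mem_iUnion, Set.mem_union, not_exists, not_or] at ht
  exact ⟨hb' j t (ht j).1.1, hf' j t (ht j).1.2, hg' j t (ht j).2,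
    (h.contDiff_c j).continuous.continuousAt⟩

/-- The derivative of ‖ψ‖² is 2 Re ⟨ψ, D⟩ = 0. A countable exceptional set is harmless because ψ is
continuous everywhere: the fundamental theorem of calculus holds with derivatives existing off a
countable set. -/
lemma norm_eq_of_hasDerivAt_orthogonal {ψ : ℝ → L2 d} (hψ : Continuous ψ) {J : Set ℝ}
    (hJ : J.Countable)
    (h : ∀ t, t ∉ J → ∃ D : L2 d, HasDerivAt ψ D t ∧ (inner ℂ (ψ t) D).re = 0) (t : ℝ) :
    ‖ψ t‖ = ‖ψ 0‖ := by
  have h1 : ∀ s ∈ Set.Ioo (min 0 t) (max 0 t) \ J,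
      HasDerivAt (fun s => inner ℂ (ψ s) (ψ s)) ((fun _ => (0 : ℂ)) s) s := by
    rintro s ⟨-, hs⟩
    obtain ⟨D, hD, h0⟩ := h s hs
    convert! hD.inner ℂ hD using 1
    rw [← inner_conj_symm D (ψ s), Complex.add_conj, h0]
    simp
  have h2 := integral_eq_of_hasDerivAt_off_countable (fun s => inner ℂ (ψ s) (ψ s))
    (fun _ => (0 : ℂ)) hJ (by fun_prop) h1 (by simp)
  simp only [intervalIntegral.integral_zero] at h2
  have h3 : inner ℂ (ψ t) (ψ t) = inner ℂ (ψ 0) (ψ 0) := by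
    exact (sub_eq_zero.1 h2.symm)
  rw [inner_self_eq_norm_sq_to_K, inner_self_eq_norm_sq_to_K] at h3
  have h4 : ‖ψ t‖ ^ 2 = ‖ψ 0‖ ^ 2 := by exact_mod_cast h3
  exact (sq_eq_sq₀ (norm_nonneg _) (norm_nonneg _)).1 h4

lemma Setting.norm_schwartz (h : Setting γ b f g c U w) (t : ℝ) (φ : 𝓢(Space d, ℂ)) :
    ‖U t (φ.toLp 2)‖ = ‖φ.toLp 2 (volume : Measure (Space d))‖ := by
  obtain ⟨ψ, h0, hU, hc, hd⟩ := h.evolution φ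
  obtain ⟨J, hJ, hJ'⟩ := h.countable_discontinuities
  have := norm_eq_of_hasDerivAt_orthogonal hc hJ (fun s hs => ?_) t
  · rw [hU, this, h0]
  · obtain ⟨D, hD, hD'⟩ := hd s (hJ' s hs)
    refine ⟨D, hD', ?_⟩
    have hDe : D = (generator (fun j => b j s) (fun j => f j s) (fun j => g j s)
        (fun j => c j s) (ψ s)).toLp 2 := by
      refine Lp.ext ?_
      filter_upwards [hD, SchwartzMap.coeFn_toLp (generator (fun j => b j s) (fun j => f j s)
        (fun j => g j s) (fun j => c j s) (ψ s)) 2 (volume : Measure (Space d))] with x h1 h2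
      rw [h1, h2, generator_apply]
    rw [hDe, ← rePair_eq, rePair_generator]

lemma denseRange_schwartz_toLp :
    DenseRange (fun φ : 𝓢(Space d, ℂ) => φ.toLp 2 (volume : Measure (Space d))) :=
  SchwartzMap.denseRange_toLpCLM (F := ℂ) (by simp)

/-- The evolution operators are isometric. -/
lemma Setting.norm_apply (h : Setting γ b f g c U w) (t : ℝ) (φ : L2 d) : ‖U t φ‖ = ‖φ‖ :=
  denseRange_schwartz_toLp.induction_on (p := fun φ => ‖U t φ‖ = ‖φ‖) φ
    (isClosed_eq (by fun_prop) (by fun_prop)) (h.norm_schwartz t)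

/-- The evolution is strongly continuous. -/
lemma Setting.continuous_apply (h : Setting γ b f g c U w) (φ : L2 d) :
    Continuous fun t => U t φ := by
  -- Since every U t is isometric, approximating φ by a Schwartz function approximates the whole
  -- orbit uniformly in t.
  refine continuous_of_uniform_approx_of_continuous fun u hu => ?_
  obtain ⟨ε, hε, hεu⟩ := Metric.mem_uniformity_dist.1 hu
  obtain ⟨η, hη⟩ := denseRange_schwartz_toLp.exists_dist_lt φ hε
  refine ⟨fun t => U t (η.toLp 2), ?_, fun t => hεu ?_⟩
  · obtain ⟨ψ, -, hU, hc, -⟩ := h.evolution η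
    simpa only [hU] using hc
  · rw [dist_eq_norm, ← map_sub, h.norm_apply, ← dist_eq_norm]
    exact hη

end

section

/-! ### Geometric sums -/

lemma two_rpow_add (x y : ℝ) : (2 : ℝ≥0∞) ^ (x + y) = 2 ^ x * 2 ^ y :=
  ENNReal.rpow_add _ _ (by norm_num) (by norm_num)

lemma two_rpow_ne_zero (x : ℝ) : (2 : ℝ≥0∞) ^ x ≠ 0 :=
  (ENNReal.rpow_pos (by norm_num) (by norm_num)).ne'

lemma two_rpow_ne_top (x : ℝ) : (2 : ℝ≥0∞) ^ x ≠ ⊤ :=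
  ENNReal.rpow_ne_top_of_ne_zero (by norm_num) (by norm_num)

lemma two_rpow_le {x y : ℝ} (h : x ≤ y) : (2 : ℝ≥0∞) ^ x ≤ 2 ^ y :=
  ENNReal.rpow_le_rpow_of_exponent_le (by norm_num) h

lemma tsum_nat_two_rpow_ne_top {δ : ℝ} (hδ : 0 < δ) :
    ∑' n : ℕ, (2 : ℝ≥0∞) ^ (-δ * n) ≠ ⊤ := by
  have h : ∀ n : ℕ, (2 : ℝ≥0∞) ^ (-δ * n) = ((2 : ℝ≥0∞) ^ (-δ)) ^ n := fun n => by
    rw [ENNReal.rpow_mul, ENNReal.rpow_natCast]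
  simp_rw [h]
  rw [ENNReal.tsum_geometric]
  refine ENNReal.inv_ne_top.2 (tsub_pos_of_lt ?_).ne'
  exact ENNReal.rpow_lt_one_of_one_lt_of_neg (by norm_num) (by linarith)

/-- Two-sided geometric sums centred at an arbitrary real number are uniformly bounded. -/
lemma exists_tsum_two_rpow_le {δ : ℝ} (hδ : 0 < δ) :
    ∃ C : ℝ≥0, ∀ a : ℝ, ∑' n : ℤ, (2 : ℝ≥0∞) ^ (-δ * |n - a|) ≤ C := by
  set S := ∑' n : ℕ, (2 : ℝ≥0∞) ^ (-δ * n) with hS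
  have hS' : S ≠ ⊤ := tsum_nat_two_rpow_ne_top hδ
  refine ⟨(2 ^ δ * (S + S)).toNNReal, fun a => ?_⟩
  -- Shifting the index by ⌊a⌋ moves the centre into [0, 1). Replacing it by 0 changes each distance
  -- by at most 1, which costs the factor 2 ^ δ.
  rw [ENNReal.coe_toNNReal (ENNReal.mul_ne_top (two_rpow_ne_top _)
    (ENNReal.add_ne_top.2 ⟨hS', hS'⟩)), ← (Equiv.addRight ⌊a⌋).tsum_eq]
  have h1 : ∀ n : ℤ, (2 : ℝ≥0∞) ^ (-δ * |((Equiv.addRight ⌊a⌋ n : ℤ) : ℝ) - a|)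
      ≤ 2 ^ δ * 2 ^ (-δ * |(n : ℝ)|) := fun n => by
    rw [← two_rpow_add]
    refine two_rpow_le ?_
    have h2 : |(n : ℝ)| ≤ |((Equiv.addRight ⌊a⌋ n : ℤ) : ℝ) - a| + 1 := by
      have h3 : (n : ℝ) = (((Equiv.addRight ⌊a⌋ n : ℤ) : ℝ) - a) + (a - ⌊a⌋) := by
        rw [Equiv.coe_addRight]; push_cast; ring
      have h4 : |a - ⌊a⌋| ≤ 1 := by
        rw [abs_le]
        constructor <;> linarith [Int.floor_le a, Int.lt_floor_add_one a]
      calc |(n : ℝ)| = |(((Equiv.addRight ⌊a⌋ n : ℤ) : ℝ) - a) + (a - ⌊a⌋)| := by rw [← h3]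
        _ ≤ _ := (abs_add_le _ _).trans (by linarith)
    nlinarith
  refine (ENNReal.tsum_le_tsum h1).trans ?_
  rw [ENNReal.tsum_mul_left]
  refine mul_le_mul_right ?_ _
  rw [tsum_of_nat_of_neg_add_one ENNReal.summable ENNReal.summable]
  refine add_le_add (le_of_eq ?_) ?_
  · simp [hS]
  · refine ENNReal.tsum_le_tsum fun n => two_rpow_le ?_
    have : |((-((n : ℤ) + 1) : ℤ) : ℝ)| = n + 1 := by
      push_cast
      rw [abs_neg, abs_of_nonneg (by positivity)]
    rw [this]
    nlinarith

lemma exists_tsum_two_rpow_mul_le {δ β : ℝ} (hδ : 0 < δ) (hβ : 0 < β) :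
    ∃ C : ℝ≥0, ∀ a : ℝ, ∑' n : ℤ, (2 : ℝ≥0∞) ^ (-δ * |β * n - a|) ≤ C := by
  obtain ⟨C, hC⟩ := exists_tsum_two_rpow_le (mul_pos hδ hβ)
  refine ⟨C, fun a => le_trans (le_of_eq ?_) (hC (a / β))⟩
  congr 1; ext n; congr 1
  rw [show β * n - a = β * (n - a / β) by field_simp, abs_mul, abs_of_pos hβ]
  ring

/-- A geometric sum that grows at `-∞` and decays at `+∞` is controlled by its largest term. -/
lemma exists_tsum_min_le {x y : ℝ} (hx : 0 < x) (hy : 0 < y) :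
    ∃ C : ℝ≥0, ∀ W : ℝ≥0∞, W ≠ 0 → W ≠ ⊤ →
      ∑' n : ℤ, min ((2 : ℝ≥0∞) ^ (n * y)) (W * 2 ^ (-n * x)) ≤ C * W ^ (y / (x + y)) := by
  obtain ⟨C, hC⟩ := exists_tsum_two_rpow_le (lt_min hx hy)
  refine ⟨C, fun W h0 h1 => ?_⟩
  have hxy : 0 < x + y := by positivity
  obtain ⟨v, hv⟩ : ∃ v : ℝ, W = 2 ^ v := by
    lift W to ℝ≥0 using h1
    have hW : 0 < (W : ℝ) := by
      have : W ≠ 0 := by simpa using h0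
      exact_mod_cast pos_iff_ne_zero.2 this
    refine ⟨Real.logb 2 W, ?_⟩
    rw [show (2 : ℝ≥0∞) = ((2 : ℝ≥0) : ℝ≥0∞) by norm_num, ← ENNReal.coe_rpow_of_ne_zero (by norm_num)]
    congr 1
    ext
    rw [NNReal.coe_rpow]
    exact (Real.rpow_logb (by norm_num) (by norm_num) hW).symm
  rw [hv, ← ENNReal.rpow_mul]
  -- The two expressions in the minimum cross at n = v / (x + y), where both equal W ^ (y / (x +
  -- y)). On either side the smaller one decays at rate at least min x y.
  calc _ ≤ ∑' n : ℤ, 2 ^ (v * (y / (x + y))) * (2 : ℝ≥0∞) ^ (-(min x y) * |n - v / (x + y)|) := by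
        refine ENNReal.tsum_le_tsum fun n => ?_
        rw [← two_rpow_add, ← two_rpow_add]
        have he : v = (v / (x + y)) * (x + y) := by field_simp
        have he' : v * (y / (x + y)) = (v / (x + y)) * y := by ring
        rw [he']
        set s := v / (x + y)
        rcases le_total (n : ℝ) s with h | h
        · refine (min_le_left _ _).trans (two_rpow_le ?_)
          rw [abs_of_nonpos (by linarith)]
          nlinarith [min_le_right x y]
        · refine (min_le_right _ _).trans (two_rpow_le ?_)
          rw [abs_of_nonneg (by linarith)]
          nlinarith [min_le_left x y]
    _ ≤ _ := by
        rw [ENNReal.tsum_mul_left, mul_comm]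
        exact mul_le_mul_left (hC _) _

/-! ### Weak `L¹` -/

/-- The weak `L¹` bound `a |{w > a}| ≤ A`. -/
def WeakBound (w : ℝ → ℝ≥0∞) (A : ℝ≥0) : Prop :=
  ∀ a : ℝ≥0, (a : ℝ≥0∞) * volume {τ : ℝ | (a : ℝ≥0∞) < w τ} ≤ A

lemma WeakBound.measure_le {w : ℝ → ℝ≥0∞} {A : ℝ≥0} (h : WeakBound w A) {a : ℝ≥0∞}
    (h0 : a ≠ 0) (h1 : a ≠ ⊤) : volume {τ : ℝ | a < w τ} ≤ A * a⁻¹ := by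
  lift a to ℝ≥0 using h1
  rw [← div_eq_mul_inv, ENNReal.le_div_iff_mul_le (Or.inl h0) (Or.inl (by simp)), mul_comm]
  exact h a

lemma WeakBound.ae_lt_top {w : ℝ → ℝ≥0∞} {A : ℝ≥0} (h : WeakBound w A) :
    ∀ᵐ τ, w τ < ⊤ := by
  rw [ae_iff]
  have h1 : ∀ n : ℕ, volume {τ | ¬ w τ < ⊤} ≤ A * ((n : ℝ≥0∞) + 1)⁻¹ := fun n => by
    refine (measure_mono fun τ hτ => ?_).trans (h.measure_le (a := n + 1) (by simp) (by simp))
    simp only [Set.mem_ofPred_eq, not_lt, top_le_iff] at hτ ⊢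
    rw [hτ]
    exact_mod_cast ENNReal.natCast_lt_top (n + 1)
  have h2 : Filter.Tendsto (fun n : ℕ => (A : ℝ≥0∞) * ((n : ℝ≥0∞) + 1)⁻¹) Filter.atTop (nhds 0) := by
    have h3 := (Filter.tendsto_add_atTop_iff_nat 1).2 ENNReal.tendsto_inv_nat_nhds_zero
    have := ENNReal.Tendsto.const_mul h3 (Or.inr (ENNReal.coe_ne_top (r := A)))
    simpa using this
  exact le_antisymm (ge_of_tendsto' h2 h1) zero_le

/-- Weak `L¹` functions are, to a power `α < 1`, integrable over sets of finite measure. -/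
lemma exists_setLIntegral_rpow_le {α : ℝ} (h0 : 0 < α) (h1 : α < 1) :
    ∃ C : ℝ≥0, ∀ (w : ℝ → ℝ≥0∞) (A : ℝ≥0), Measurable w → 0 < A → WeakBound w A →
      ∀ B : Set ℝ, ∫⁻ τ in B, w τ ^ α ≤ C * (A : ℝ≥0∞) ^ α * volume B ^ (1 - α) := by
  set S := ∑' n : ℕ, (2 : ℝ≥0∞) ^ (-(1 - α) * n) with hS
  have hS' : S ≠ ⊤ := tsum_nat_two_rpow_ne_top (by linarith)
  have hC : 1 + 2 ^ α * S ≠ ⊤ :=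
    ENNReal.add_ne_top.2 ⟨by simp, ENNReal.mul_ne_top (two_rpow_ne_top _) hS'⟩
  refine ⟨(1 + 2 ^ α * S).toNNReal, fun w A hw hA hwA B => ?_⟩
  rw [ENNReal.coe_toNNReal hC]
  have hA0 : (A : ℝ≥0∞) ≠ 0 := by simpa using hA.ne'
  rcases eq_or_ne (volume B) 0 with hB | hB
  · rw [Measure.restrict_eq_zero.2 hB]; simp
  rcases eq_or_ne (volume B) ⊤ with hB' | hB'
  · rw [hB', ENNReal.top_rpow_of_pos (by linarith), ENNReal.mul_top]
    · exact le_top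
    · refine mul_ne_zero (by simp) ?_
      exact (ENNReal.rpow_pos (pos_iff_ne_zero.2 hA0) (by simp)).ne'
  -- The height l is where the weak bound A / l for the superlevel set equals the trivial bound |B|.
  -- Below l the integrand is at most l ^ α. Above l the dyadic pieces sum geometrically because α <
  -- 1. Both contributions are multiples of l ^ α |B| = A ^ α |B| ^ (1 - α).
  set l : ℝ≥0∞ := A / volume B with hl
  have hl0 : l ≠ 0 := ENNReal.div_ne_zero.2 ⟨hA0, hB'⟩
  have hlt : l ≠ ⊤ := ENNReal.div_ne_top (by simp) hB
  have hlB : l * volume B = A := ENNReal.div_mul_cancel hB hB'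
  have hpt : ∀ᵐ τ, w τ ^ α ≤ l ^ α + ∑' n : ℕ,
      Set.indicator {τ | 2 ^ (n : ℝ) * l < w τ} (fun _ => (2 ^ ((n : ℝ) + 1) * l) ^ α) τ := by
    filter_upwards [hwA.ae_lt_top] with τ hτ
    rcases le_or_gt (w τ) l with h | h
    · exact (ENNReal.rpow_le_rpow h h0.le).trans le_self_add
    · have hex : ∃ n : ℕ, w τ ≤ 2 ^ (n : ℝ) * l := by
        have : w τ / l < ⊤ := ENNReal.div_lt_top hτ.ne hl0
        obtain ⟨n, hn⟩ := ENNReal.exists_nat_gt this.ne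
        refine ⟨n, ?_⟩
        rw [← ENNReal.div_le_iff hl0 hlt, ENNReal.rpow_natCast]
        refine hn.le.trans ?_
        exact_mod_cast Nat.lt_two_pow_self.le
      classical
      set m := Nat.find hex with hm
      have hm1 := Nat.find_spec hex
      have hmpos : m ≠ 0 := by
        intro h0'
        rw [← hm, h0'] at hm1
        simp at hm1
        exact absurd hm1 (not_le.2 h)
      obtain ⟨k, hk⟩ := Nat.exists_eq_succ_of_ne_zero hmpos
      have hk1 : 2 ^ (k : ℝ) * l < w τ := not_le.1 (Nat.find_min hex (by omega))
      refine le_trans ?_ (le_add_left (ENNReal.le_tsum k))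
      rw [Set.indicator_of_mem (by exact hk1)]
      refine ENNReal.rpow_le_rpow ?_ h0.le
      rw [← hm, hk] at hm1
      exact_mod_cast hm1
  have hmeas : ∀ n : ℕ, MeasurableSet {τ | 2 ^ (n : ℝ) * l < w τ} := fun n =>
    measurableSet_lt measurable_const hw
  calc ∫⁻ τ in B, w τ ^ α ≤ ∫⁻ τ in B, (l ^ α + ∑' n : ℕ,
        Set.indicator {τ | 2 ^ (n : ℝ) * l < w τ} (fun _ => (2 ^ ((n : ℝ) + 1) * l) ^ α) τ) :=
        lintegral_mono_ae (ae_restrict_of_ae hpt)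
    _ = l ^ α * volume B + ∑' n : ℕ, ∫⁻ τ in B,
        Set.indicator {τ | 2 ^ (n : ℝ) * l < w τ} (fun _ => (2 ^ ((n : ℝ) + 1) * l) ^ α) τ := by
        rw [lintegral_add_left measurable_const, setLIntegral_const, lintegral_tsum]
        exact fun n => (measurable_const.indicator (hmeas n)).aemeasurable
    _ ≤ l ^ α * volume B + ∑' n : ℕ, (l ^ α * volume B) * (2 ^ α * 2 ^ (-(1 - α) * n)) := by
        gcongr with n
        refine (setLIntegral_le_lintegral _ _).trans ?_
        rw [lintegral_indicator (hmeas n), setLIntegral_const]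
        have h2 : (2 : ℝ≥0∞) ^ (n : ℝ) * l ≠ 0 := mul_ne_zero (two_rpow_ne_zero _) hl0
        have h3 : (2 : ℝ≥0∞) ^ (n : ℝ) * l ≠ ⊤ := ENNReal.mul_ne_top (two_rpow_ne_top _) hlt
        refine (mul_le_mul_right (hwA.measure_le h2 h3) _).trans (le_of_eq ?_)
        rw [← hlB, ENNReal.mul_inv (Or.inl (two_rpow_ne_zero _)) (Or.inl (two_rpow_ne_top _)),
          ENNReal.mul_rpow_of_nonneg _ _ h0.le, ← ENNReal.rpow_mul, ← ENNReal.rpow_neg,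
          show ((n : ℝ) + 1) * α = α + (n * α) by ring,
          show -(1 - α) * (n : ℝ) = n * α + -n by ring, two_rpow_add, two_rpow_add]
        calc _ = l ^ α * volume B * (2 ^ α * (2 ^ (n * α) * 2 ^ (-(n : ℝ)))) * (l * l⁻¹) := by ring
          _ = _ := by rw [ENNReal.mul_inv_cancel hl0 hlt, mul_one]
    _ = (1 + 2 ^ α * S) * (l ^ α * volume B) := by
        rw [ENNReal.tsum_mul_left, ENNReal.tsum_mul_left]; ring
    _ = _ := by
        rw [mul_assoc]
        congr 1
        rw [hl, ENNReal.div_rpow_of_nonneg _ _ h0.le, ENNReal.rpow_sub _ _ hB hB', ENNReal.rpow_one,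
          div_eq_mul_inv, div_eq_mul_inv]
        ring

/-! ### Decomposition of a function into dyadic layers -/

section Layers

variable {X : Type*} [MeasurableSpace X] {μ : Measure X}

/-- The `L^p` norm of a nonnegative function. -/
def lnorm (p : ℝ) (φ : X → ℝ≥0∞) (μ : Measure X) : ℝ≥0∞ := (∫⁻ x, φ x ^ p ∂μ) ^ (1 / p)

/-- The set where `φ` is of size `2 ^ k` relative to its `L^p` norm. -/
def layer (p : ℝ) (φ : X → ℝ≥0∞) (μ : Measure X) (k : ℤ) : Set X :=
  {x | 2 ^ (k : ℝ) * lnorm p φ μ ≤ φ x ∧ φ x < 2 ^ ((k : ℝ) + 1) * lnorm p φ μ}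

/-- The proportion of `∫ φ ^ p` that is carried by a layer. -/
def layerMass (p : ℝ) (φ : X → ℝ≥0∞) (μ : Measure X) (k : ℤ) : ℝ≥0∞ :=
  (∫⁻ x in layer p φ μ k, φ x ^ p ∂μ) / lnorm p φ μ ^ p

lemma lnorm_rpow {p : ℝ} (hp : 0 < p) (φ : X → ℝ≥0∞) :
    lnorm p φ μ ^ p = ∫⁻ x, φ x ^ p ∂μ := by
  rw [lnorm, ← ENNReal.rpow_mul, one_div_mul_cancel hp.ne', ENNReal.rpow_one]

lemma measurableSet_layer {p : ℝ} {φ : X → ℝ≥0∞} (hφ : Measurable φ) (k : ℤ) :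
    MeasurableSet (layer p φ μ k) :=
  (measurableSet_le measurable_const hφ).inter (measurableSet_lt hφ measurable_const)

lemma disjoint_layer (p : ℝ) (φ : X → ℝ≥0∞) :
    Pairwise (Function.onFun Disjoint (layer p φ μ)) := by
  have key : ∀ k l : ℤ, k < l → Disjoint (layer p φ μ k) (layer p φ μ l) := by
    intro k l hkl
    refine Set.disjoint_left.2 fun x hx hx' => ?_
    refine absurd (hx.2.trans_le ((mul_le_mul_left (two_rpow_le ?_) _).trans hx'.1)) (lt_irrefl _)
    exact_mod_cast hkl
  intro k l hkl
  rcases lt_or_gt_of_ne hkl with h | h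
  · exact key k l h
  · exact (key l k h).symm

lemma tsum_layerMass_le {p : ℝ} (hp : 0 < p) {φ : X → ℝ≥0∞} (hφ : Measurable φ) :
    ∑' k, layerMass p φ μ k ≤ 1 := by
  simp only [layerMass, div_eq_mul_inv, ENNReal.tsum_mul_right]
  rw [← lintegral_iUnion (measurableSet_layer hφ) (disjoint_layer p φ), ← div_eq_mul_inv,
    lnorm_rpow hp]
  exact (ENNReal.div_le_div_right (setLIntegral_le_lintegral _ _) _).trans ENNReal.div_self_le_one

lemma layerMass_le_one {p : ℝ} (hp : 0 < p) {φ : X → ℝ≥0∞} (hφ : Measurable φ) (k : ℤ) :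
    layerMass p φ μ k ≤ 1 :=
  (ENNReal.le_tsum k).trans (tsum_layerMass_le hp hφ)

lemma layer_eq_empty {p : ℝ} {φ : X → ℝ≥0∞} (h : lnorm p φ μ = 0) (k : ℤ) :
    layer p φ μ k = ∅ := by
  ext x; simp [layer, h]

lemma setLIntegral_layer {p : ℝ} (hp : 0 < p) {φ : X → ℝ≥0∞} (h : lnorm p φ μ ≠ ⊤) (k : ℤ) :
    ∫⁻ x in layer p φ μ k, φ x ^ p ∂μ = lnorm p φ μ ^ p * layerMass p φ μ k := by
  rcases eq_or_ne (lnorm p φ μ) 0 with h0 | h0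
  · rw [layer_eq_empty h0, h0, ENNReal.zero_rpow_of_pos hp]; simp
  · rw [layerMass, ENNReal.mul_div_cancel]
    · exact (ENNReal.rpow_pos (pos_iff_ne_zero.2 h0) h).ne'
    · exact ENNReal.rpow_ne_top_of_nonneg hp.le h

/-- This is Chebyshev's inequality on the layer, with the mass kept as a factor; the sums over
layers rely on the masses being summable. -/
lemma measure_layer_le {p : ℝ} (hp : 0 < p) {φ : X → ℝ≥0∞} (hφ : Measurable φ)
    (h : lnorm p φ μ ≠ ⊤) (k : ℤ) :
    μ (layer p φ μ k) ≤ 2 ^ (-k * p) * layerMass p φ μ k := by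
  rcases eq_or_ne (lnorm p φ μ) 0 with h0 | h0
  · simp [layer_eq_empty h0]
  have hN0 : lnorm p φ μ ^ p ≠ 0 := (ENNReal.rpow_pos (pos_iff_ne_zero.2 h0) h).ne'
  have hNt : lnorm p φ μ ^ p ≠ ⊤ := ENNReal.rpow_ne_top_of_nonneg hp.le h
  have h1 : (2 ^ (k : ℝ) * lnorm p φ μ) ^ p * μ (layer p φ μ k)
      ≤ lnorm p φ μ ^ p * layerMass p φ μ k := by
    rw [← setLIntegral_layer hp h, ← setLIntegral_const]
    exact setLIntegral_mono_ae (by fun_prop)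
      (Filter.Eventually.of_forall fun x hx => ENNReal.rpow_le_rpow hx.1 hp.le)
  rw [ENNReal.mul_rpow_of_nonneg _ _ hp.le, mul_comm (_ ^ p) (_ ^ p), mul_assoc,
    ENNReal.mul_le_mul_iff_right hN0 hNt, ← ENNReal.rpow_mul] at h1
  calc μ (layer p φ μ k) = 2 ^ (-k * p) * (2 ^ (k * p) * μ (layer p φ μ k)) := by
        rw [← mul_assoc, ← two_rpow_add]; simp
    _ ≤ _ := mul_le_mul_right h1 _

/-- The `L^m` norm of a layer, `1 ≤ m ≤ 2`. -/
lemma lnorm_layer_le {p m : ℝ} (hp : 1 ≤ p) (hm : 1 ≤ m) (hm2 : m ≤ 2)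
    {φ : X → ℝ≥0∞} (hφ : Measurable φ) (h : lnorm p φ μ ≠ ⊤) (k : ℤ) :
    lnorm m ((layer p φ μ k).indicator φ) μ
      ≤ 2 * 2 ^ (k * (1 - p / m)) * (lnorm p φ μ * layerMass p φ μ k ^ (1 / 2 : ℝ)) := by
  have hp0 : 0 < p := by linarith
  have hm0 : 0 < m := by linarith
  have hind : lnorm m ((layer p φ μ k).indicator φ) μ
      = (∫⁻ x in layer p φ μ k, φ x ^ m ∂μ) ^ (1 / m) := by
    rw [lnorm, ← lintegral_indicator (measurableSet_layer hφ k)]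
    congr 2; ext x
    by_cases hx : x ∈ layer p φ μ k
    · simp [hx]
    · simp [hx, ENNReal.zero_rpow_of_pos hm0]
  rw [hind]
  rcases eq_or_ne (lnorm p φ μ) 0 with h0 | h0
  · simp [layer_eq_empty h0, ENNReal.zero_rpow_of_pos (inv_pos.2 hm0)]
  set N := lnorm p φ μ with hN
  have hb0 : (2 : ℝ≥0∞) ^ (k : ℝ) * N ≠ 0 := mul_ne_zero (two_rpow_ne_zero _) h0
  have hbt : (2 : ℝ≥0∞) ^ (k : ℝ) * N ≠ ⊤ := ENNReal.mul_ne_top (two_rpow_ne_top _) h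
  -- On a layer φ is within a factor 2 of 2 ^ k N, so φ ^ (m - p) may be replaced by a constant. For
  -- m ≥ p the upper end of the layer is used, and 2 ^ (m - p) ≤ 2 since m ≤ 2 and p ≥ 1. For m ≤ p
  -- the lower end is used.
  have hpt : ∀ x ∈ layer p φ μ k, φ x ^ m ≤ 2 * (2 ^ (k : ℝ) * N) ^ (m - p) * φ x ^ p := by
    intro x hx
    have hx0 : φ x ≠ 0 := (lt_of_lt_of_le (pos_iff_ne_zero.2 hb0) hx.1).ne'
    have hxt : φ x ≠ ⊤ := (lt_top_iff_ne_top.1 (hx.2.trans_le le_top))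
    have he : φ x ^ m = φ x ^ (m - p) * φ x ^ p := by
      rw [← ENNReal.rpow_add _ _ hx0 hxt]; congr 1; ring
    rw [he]
    refine mul_le_mul_left ?_ _
    rcases le_total p m with hpm | hpm
    · have h2 : φ x ≤ 2 * (2 ^ (k : ℝ) * N) := by
        refine hx.2.le.trans (le_of_eq ?_)
        rw [two_rpow_add, ENNReal.rpow_one]; ring
      refine (ENNReal.rpow_le_rpow h2 (by linarith)).trans ?_
      rw [ENNReal.mul_rpow_of_nonneg _ _ (by linarith)]
      refine mul_le_mul_left ?_ _
      calc (2 : ℝ≥0∞) ^ (m - p) ≤ 2 ^ (1 : ℝ) := two_rpow_le (by linarith)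
        _ = 2 := by simp
    · have h2 : φ x ^ (m - p) ≤ (2 ^ (k : ℝ) * N) ^ (m - p) := by
        rw [← neg_sub p m, ENNReal.rpow_neg, ENNReal.rpow_neg]
        exact ENNReal.inv_le_inv.2 (ENNReal.rpow_le_rpow hx.1 (by linarith))
      refine h2.trans (le_mul_of_one_le_left zero_le (by norm_num))
  have hint : ∫⁻ x in layer p φ μ k, φ x ^ m ∂μ
      ≤ 2 * (2 ^ (k * (m - p)) * (N ^ m * layerMass p φ μ k)) := by
    calc _ ≤ ∫⁻ x in layer p φ μ k, 2 * (2 ^ (k : ℝ) * N) ^ (m - p) * φ x ^ p ∂μ :=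
          setLIntegral_mono_ae (by fun_prop) (Filter.Eventually.of_forall hpt)
      _ = 2 * (2 ^ (k : ℝ) * N) ^ (m - p) * (N ^ p * layerMass p φ μ k) := by
          rw [lintegral_const_mul _ (by fun_prop), setLIntegral_layer hp0 h]
      _ = _ := by
          rw [ENNReal.mul_rpow_of_ne_zero (two_rpow_ne_zero _) h0, ← ENNReal.rpow_mul,
            ENNReal.rpow_sub _ _ h0 h, div_eq_mul_inv]
          have hc : (N ^ p)⁻¹ * N ^ p = 1 := ENNReal.inv_mul_cancel
            (ENNReal.rpow_pos (pos_iff_ne_zero.2 h0) h).ne' (ENNReal.rpow_ne_top_of_nonneg hp0.le h)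
          calc _ = 2 * (2 ^ (k * (m - p)) * (N ^ m * layerMass p φ μ k)) * ((N ^ p)⁻¹ * N ^ p) := by
                ring
            _ = _ := by rw [hc, mul_one]
  refine (ENNReal.rpow_le_rpow hint (by positivity)).trans ?_
  have hm1 : 0 ≤ 1 / m := by positivity
  rw [ENNReal.mul_rpow_of_nonneg _ _ hm1, ENNReal.mul_rpow_of_nonneg _ _ hm1,
    ENNReal.mul_rpow_of_nonneg _ _ hm1, ← ENNReal.rpow_mul, ← ENNReal.rpow_mul,
    mul_one_div_cancel hm0.ne', ENNReal.rpow_one, ← mul_assoc,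
    show (k : ℝ) * (m - p) * (1 / m) = k * (1 - p / m) by field_simp]
  gcongr ?_ * _ * (_ * ?_)
  · calc (2 : ℝ≥0∞) ^ (1 / m) ≤ 2 ^ (1 : ℝ) := two_rpow_le (by rw [div_le_one hm0]; exact hm)
      _ = 2 := by simp
  -- The mass is at most 1 and 1 / m ≥ 1 / 2. Weakening the exponent to 1 / 2 makes the bound
  -- uniform in m, so that a pair of layers can later be summed with the same weights in L¹ and in
  -- L².
  · refine ENNReal.rpow_le_rpow_of_exponent_ge (layerMass_le_one hp0 hφ k) ?_
    exact one_div_le_one_div_of_le hm0 hm2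

end Layers

end

section

/-! ### Bilinear estimates for convolution kernels -/

lemma exists_mem_layer {X : Type*} [MeasurableSpace X] {μ : Measure X} {p : ℝ} {φ : X → ℝ≥0∞}
    (h0 : lnorm p φ μ ≠ 0) (h1 : lnorm p φ μ ≠ ⊤) {x : X} (hx0 : φ x ≠ 0) (hx1 : φ x ≠ ⊤) :
    ∃ k, x ∈ layer p φ μ k := by
  obtain ⟨k, hk1, hk2⟩ := ENNReal.exists_mem_Ico_zpow (x := φ x / lnorm p φ μ) (y := 2)
    (ENNReal.div_ne_zero.2 ⟨hx0, h1⟩) (ENNReal.div_ne_top hx1 h0) (by norm_num) (by norm_num)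
  refine ⟨k, ?_, ?_⟩
  · rwa [ENNReal.rpow_intCast, ← ENNReal.le_div_iff_mul_le (Or.inl h0) (Or.inl h1)]
  · rw [← ENNReal.div_lt_iff (Or.inl h0) (Or.inl h1)]
    have : ((k : ℝ) + 1) = ((k + 1 : ℤ) : ℝ) := by push_cast; ring
    rwa [this, ENNReal.rpow_intCast]

/-- Up to a factor 2, a function with finite norm is a step function on its dyadic layers. The
exceptional null set is contained in the set where φ is infinite, or where φ ≠ 0 although its norm
vanishes. -/
lemma le_tsum_layer {X : Type*} [MeasurableSpace X] {μ : Measure X} {p : ℝ} (hp : 0 < p)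
    {φ : X → ℝ≥0∞} (hφ : Measurable φ) (h1 : lnorm p φ μ ≠ ⊤) :
    ∀ᵐ x ∂μ, φ x ≤ ∑' k, (layer p φ μ k).indicator
      (fun _ => 2 ^ ((k : ℝ) + 1) * lnorm p φ μ) x := by
  have hint : ∫⁻ x, φ x ^ p ∂μ ≠ ⊤ := by
    rw [← lnorm_rpow hp]; exact ENNReal.rpow_ne_top_of_nonneg hp.le h1
  rcases eq_or_ne (lnorm p φ μ) 0 with h0 | h0
  · have h2 : ∫⁻ x, φ x ^ p ∂μ = 0 := by
      rw [← lnorm_rpow hp, h0, ENNReal.zero_rpow_of_pos hp]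
    rw [lintegral_eq_zero_iff (by fun_prop)] at h2
    filter_upwards [h2] with x hx
    have : φ x = 0 := by
      simpa [ENNReal.rpow_eq_zero_iff, hp, hp.le, not_lt.2 hp.le] using hx
    rw [this]; exact zero_le
  · filter_upwards [ae_lt_top (by fun_prop) hint] with x hx
    have hxt : φ x ≠ ⊤ := by
      intro h; rw [h, ENNReal.top_rpow_of_pos hp] at hx; exact lt_irrefl _ hx
    rcases eq_or_ne (φ x) 0 with hx0 | hx0
    · rw [hx0]; exact zero_le
    obtain ⟨k, hk⟩ := exists_mem_layer h0 h1 hx0 hxt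
    refine le_trans ?_ (ENNReal.le_tsum k)
    rw [Set.indicator_of_mem hk]
    exact hk.2.le

/-- This is Schur's test in the form needed after a product of two weights has been bounded by a
sum: row sums absorb c, column sums absorb d. -/
lemma tsum_tsum_mul_add_le {ι κ : Type*} {ρ : ι → κ → ℝ≥0∞} {C : ℝ≥0∞}
    (h1 : ∀ k, ∑' l, ρ k l ≤ C) (h2 : ∀ l, ∑' k, ρ k l ≤ C) {c : ι → ℝ≥0∞} {d : κ → ℝ≥0∞}
    (hc : ∑' k, c k ≤ 1) (hd : ∑' l, d l ≤ 1) :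
    ∑' k, ∑' l, ρ k l * (c k + d l) ≤ 2 * C := by
  simp only [mul_add]
  simp_rw [ENNReal.tsum_add]
  rw [two_mul]
  refine add_le_add ?_ ?_
  · simp_rw [ENNReal.tsum_mul_right]
    calc _ ≤ ∑' k, C * c k := ENNReal.tsum_le_tsum fun k => mul_le_mul_left (h1 k) _
      _ = C * ∑' k, c k := ENNReal.tsum_mul_left
      _ ≤ C * 1 := mul_le_mul_right hc _
      _ = C := mul_one _
  · rw [ENNReal.tsum_comm]
    simp_rw [ENNReal.tsum_mul_right]
    calc _ ≤ ∑' k, C * d k := ENNReal.tsum_le_tsum fun k => mul_le_mul_left (h2 k) _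
      _ = C * ∑' k, d k := ENNReal.tsum_mul_left
      _ ≤ C * 1 := mul_le_mul_right hd _
      _ = C := mul_one _

/-- The two orders of integration, with translation and reflection invariance, put the fractional
power on either set. In the Hardy–Littlewood–Sobolev sum it is put on the layer of lower index. -/
lemma setLIntegral_kernel_le {K : ℝ → ℝ≥0∞} (hK : Measurable K) {κ : ℝ≥0∞} {β : ℝ}
    (h : ∀ B : Set ℝ, ∫⁻ τ in B, K τ ≤ κ * volume B ^ β) {S R : Set ℝ} (hS : MeasurableSet S)
    (hR : MeasurableSet R) :
    ∫⁻ s in S, ∫⁻ t in R, K (t - s) ≤ κ * (volume S * volume R ^ β) ∧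
    ∫⁻ s in S, ∫⁻ t in R, K (t - s) ≤ κ * (volume R * volume S ^ β) := by
  constructor
  · calc _ ≤ ∫⁻ s in S, κ * volume R ^ β := by
          refine lintegral_mono fun s => ?_
          have h1 : ∫⁻ t in R, K (t - s) = ∫⁻ t in (fun t => t + s) ⁻¹' R, K t := by
            have hR' : MeasurableSet ((fun t : ℝ => t + s) ⁻¹' R) := hR.preimage (by fun_prop)
            rw [← lintegral_indicator hR, ← lintegral_indicator hR',
              ← lintegral_sub_right_eq_self (((fun t : ℝ => t + s) ⁻¹' R).indicator K) s]
            congr 1; ext t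
            by_cases ht : t ∈ R
            · rw [Set.indicator_of_mem ht, Set.indicator_of_mem]
              rwa [Set.mem_preimage, sub_add_cancel]
            · rw [Set.indicator_of_notMem ht, Set.indicator_of_notMem]
              rwa [Set.mem_preimage, sub_add_cancel]
          have h2 := h ((fun t => t + s) ⁻¹' R)
          rwa [measure_preimage_add_right, ← h1] at h2
      _ = _ := by rw [setLIntegral_const]; ring
  · rw [lintegral_lintegral_swap (by fun_prop)]
    calc _ ≤ ∫⁻ t in R, κ * volume S ^ β := by
          refine lintegral_mono fun t => ?_
          have hmp := Measure.measurePreserving_sub_left (volume : Measure ℝ) t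
          have h1 : ∫⁻ s in S, K (t - s) = ∫⁻ s in (fun s => t - s) ⁻¹' S, K s := by
            have hS' : MeasurableSet ((fun s : ℝ => t - s) ⁻¹' S) := hS.preimage (by fun_prop)
            rw [← lintegral_indicator hS, ← lintegral_indicator hS',
              ← lintegral_sub_left_eq_self (((fun s : ℝ => t - s) ⁻¹' S).indicator K) t]
            congr 1; ext s
            by_cases hs : s ∈ S
            · rw [Set.indicator_of_mem hs, Set.indicator_of_mem]
              rwa [Set.mem_preimage, sub_sub_cancel]
            · rw [Set.indicator_of_notMem hs, Set.indicator_of_notMem]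
              rwa [Set.mem_preimage, sub_sub_cancel]
          have h2 := h ((fun s => t - s) ⁻¹' S)
          rwa [hmp.measure_preimage hS.nullMeasurableSet, ← h1] at h2
      _ = _ := by rw [setLIntegral_const]; ring

/-- The Hardy–Littlewood–Sobolev inequality for a kernel of weak Lebesgue class. -/
lemma exists_hardyLittlewoodSobolev {α : ℝ} (h0 : 0 < α) (h1 : α < 1) :
    ∃ C : ℝ≥0, ∀ (K : ℝ → ℝ≥0∞) (κ : ℝ≥0∞), Measurable K →
      (∀ B : Set ℝ, ∫⁻ τ in B, K τ ≤ κ * volume B ^ (1 - α)) →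
      ∀ f g : ℝ → ℝ≥0∞, Measurable f → Measurable g →
        lnorm (1 / (1 - α / 2)) f volume ≠ ⊤ → lnorm (1 / (1 - α / 2)) g volume ≠ ⊤ →
        ∫⁻ s, ∫⁻ t, f s * g t * K (t - s)
          ≤ C * κ * (lnorm (1 / (1 - α / 2)) f volume * lnorm (1 / (1 - α / 2)) g volume) := by
  set p : ℝ := 1 / (1 - α / 2) with hp
  have hp1 : 1 < p := by rw [hp, lt_div_iff₀ (by linarith)]; linarith
  -- This scaling relation is what makes the bound for a pair of layers depend on the indices only
  -- through their difference.
  have hpα : p * (1 - α) = 2 - p := by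
    have : p * (1 - α / 2) = 1 := one_div_mul_cancel (by linarith)
    linarith
  have hp0 : 0 < p := by linarith
  obtain ⟨C, hC⟩ := exists_tsum_two_rpow_le (sub_pos.2 hp1)
  refine ⟨8 * C, fun K κ hK hKκ f g hf hg hNf hNg => ?_⟩
  set N := lnorm p f volume
  set M := lnorm p g volume
  set c := layerMass p f volume
  set d := layerMass p g volume
  have hterm : ∀ k l : ℤ, (2 ^ ((k : ℝ) + 1) * N) * ((2 ^ ((l : ℝ) + 1) * M) *
      ∫⁻ s in layer p f volume k, ∫⁻ t in layer p g volume l, K (t - s))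
      ≤ 4 * κ * (N * M) * (2 ^ (-(p - 1) * |(l : ℝ) - k|) * (c k + d l)) := by
    intro k l
    obtain ⟨hJ1, hJ2⟩ := setLIntegral_kernel_le hK hKκ
      (measurableSet_layer (p := p) (μ := volume) hf k) (measurableSet_layer (p := p) (μ := volume) hg l)
    have hm := measure_layer_le hp0 hf hNf k
    have hn := measure_layer_le hp0 hg hNg l
    have hc1 := layerMass_le_one (μ := volume) hp0 hf k
    have hd1 := layerMass_le_one (μ := volume) hp0 hg l
    -- The powers of 2 combine to 2 - (p - 1)(j - i). Only the mass of the layer of higher index is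
    -- retained; the other one is bounded by 1.
    have key : ∀ (i j : ℤ) (x y a b : ℝ≥0∞), x ≤ 2 ^ (-(i : ℝ) * p) * a → a ≤ 1 →
        y ≤ 2 ^ (-(j : ℝ) * p) * b →
        (2 : ℝ≥0∞) ^ ((i : ℝ) + 1) * 2 ^ ((j : ℝ) + 1) * (y * x ^ (1 - α))
          ≤ 4 * (2 ^ (-(p - 1) * ((j : ℝ) - i)) * b) := by
      intro i j x y a b hx ha hy
      have hx' : x ^ (1 - α) ≤ 2 ^ (-(i : ℝ) * (2 - p)) := by
        refine (ENNReal.rpow_le_rpow (hx.trans (mul_le_of_le_one_right zero_le ha))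
          (by linarith)).trans (le_of_eq ?_)
        rw [← ENNReal.rpow_mul, ← hpα]; ring_nf
      calc _ ≤ (2 : ℝ≥0∞) ^ ((i : ℝ) + 1) * 2 ^ ((j : ℝ) + 1) *
            ((2 ^ (-(j : ℝ) * p) * b) * 2 ^ (-(i : ℝ) * (2 - p))) := by gcongr
        _ = (2 : ℝ≥0∞) ^ ((i : ℝ) + 1) * 2 ^ ((j : ℝ) + 1) * 2 ^ (-(j : ℝ) * p)
            * 2 ^ (-(i : ℝ) * (2 - p)) * b := by ring
        _ = 2 ^ (2 : ℝ) * (2 ^ (-(p - 1) * ((j : ℝ) - i)) * b) := by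
            rw [← two_rpow_add, ← two_rpow_add, ← two_rpow_add, ← mul_assoc, ← two_rpow_add]
            congr 2; ring
        _ = _ := by congr 1; norm_num
    rcases le_total (k : ℝ) l with hkl | hkl
    · rw [abs_of_nonneg (by linarith)]
      calc _ ≤ (2 ^ ((k : ℝ) + 1) * N) * ((2 ^ ((l : ℝ) + 1) * M) *
              (κ * (volume (layer p g volume l) * volume (layer p f volume k) ^ (1 - α)))) := by
            gcongr
        _ = κ * (N * M) * ((2 : ℝ≥0∞) ^ ((k : ℝ) + 1) * 2 ^ ((l : ℝ) + 1) *
              (volume (layer p g volume l) * volume (layer p f volume k) ^ (1 - α))) := by ring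
        _ ≤ κ * (N * M) * (4 * (2 ^ (-(p - 1) * ((l : ℝ) - k)) * d l)) := by
            exact mul_le_mul_right (key k l _ _ _ _ hm hc1 hn) _
        _ ≤ κ * (N * M) * (4 * (2 ^ (-(p - 1) * ((l : ℝ) - k)) * (c k + d l))) := by
            gcongr _ * (_ * (_ * ?_)); exact le_add_self
        _ = _ := by ring
    · rw [abs_of_nonpos (by linarith)]
      calc _ ≤ (2 ^ ((k : ℝ) + 1) * N) * ((2 ^ ((l : ℝ) + 1) * M) *
              (κ * (volume (layer p f volume k) * volume (layer p g volume l) ^ (1 - α)))) := by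
            gcongr
        _ = κ * (N * M) * ((2 : ℝ≥0∞) ^ ((l : ℝ) + 1) * 2 ^ ((k : ℝ) + 1) *
              (volume (layer p f volume k) * volume (layer p g volume l) ^ (1 - α))) := by ring
        _ ≤ κ * (N * M) * (4 * (2 ^ (-(p - 1) * ((k : ℝ) - l)) * c k)) := by
            exact mul_le_mul_right (key l k _ _ _ _ hn hd1 hm) _
        _ ≤ κ * (N * M) * (4 * (2 ^ (-(p - 1) * (-((l : ℝ) - k))) * (c k + d l))) := by
            rw [neg_sub (l : ℝ)]; gcongr _ * (_ * (_ * ?_)); exact le_self_add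
        _ = _ := by ring
  have hmf : ∀ k : ℤ, Measurable ((layer p f volume k).indicator
      (fun _ => (2 : ℝ≥0∞) ^ ((k : ℝ) + 1) * N)) := fun k =>
    measurable_const.indicator (measurableSet_layer hf k)
  have hmg : ∀ k : ℤ, Measurable ((layer p g volume k).indicator
      (fun _ => (2 : ℝ≥0∞) ^ ((k : ℝ) + 1) * M)) := fun k =>
    measurable_const.indicator (measurableSet_layer hg k)
  have hcK : ∀ s : ℝ, Measurable fun t => K (t - s) := fun s => by fun_prop
  have hinner : ∀ (s : ℝ) (l : ℤ), ∫⁻ t, (layer p g volume l).indicator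
      (fun _ => (2 : ℝ≥0∞) ^ ((l : ℝ) + 1) * M) t * K (t - s)
      = (2 ^ ((l : ℝ) + 1) * M) * ∫⁻ t in layer p g volume l, K (t - s) := by
    intro s l
    rw [← lintegral_const_mul _ (hcK s), ← lintegral_indicator (measurableSet_layer hg l)]
    congr 1; ext t
    by_cases ht : t ∈ layer p g volume l <;> simp [ht]
  have hmI : ∀ l : ℤ, Measurable fun s => ∫⁻ t in layer p g volume l, K (t - s) := fun l => by
    have : Measurable (Function.uncurry fun s t : ℝ => K (t - s)) := by
      unfold Function.uncurry; fun_prop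
    exact this.lintegral_prod_right'
  calc ∫⁻ s, ∫⁻ t, f s * g t * K (t - s)
      = ∫⁻ s, f s * ∫⁻ t, g t * K (t - s) := by
        congr 1; ext s
        simp_rw [mul_assoc]
        exact lintegral_const_mul _ (hg.mul (hcK s))
    _ ≤ ∫⁻ s, f s * ∑' l : ℤ, (2 ^ ((l : ℝ) + 1) * M) * ∫⁻ t in layer p g volume l, K (t - s) := by
        refine lintegral_mono fun s => mul_le_mul_right ?_ _
        calc _ ≤ ∫⁻ t, ∑' l : ℤ, (layer p g volume l).indicator
              (fun _ => (2 : ℝ≥0∞) ^ ((l : ℝ) + 1) * M) t * K (t - s) := by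
              refine lintegral_mono_ae ?_
              filter_upwards [le_tsum_layer hp0 hg hNg] with t ht
              rw [ENNReal.tsum_mul_right]
              exact mul_le_mul_left ht _
          _ = _ := by
              have hm : ∀ l : ℤ, Measurable fun t => (layer p g volume l).indicator
                  (fun _ => (2 : ℝ≥0∞) ^ ((l : ℝ) + 1) * M) t * K (t - s) :=
                fun l => (hmg l).mul (hcK s)
              rw [lintegral_tsum fun l => (hm l).aemeasurable]
              simp_rw [hinner]
    _ ≤ ∫⁻ s, ∑' k : ℤ, ∑' l : ℤ, (layer p f volume k).indicator (fun _ => (2 : ℝ≥0∞) ^ ((k : ℝ) + 1) * N) s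
          * ((2 ^ ((l : ℝ) + 1) * M) * ∫⁻ t in layer p g volume l, K (t - s)) := by
        refine lintegral_mono_ae ?_
        filter_upwards [le_tsum_layer hp0 hf hNf] with s hs
        simp_rw [ENNReal.tsum_mul_left, ENNReal.tsum_mul_right]
        exact mul_le_mul_left hs _
    _ = ∑' k : ℤ, ∑' l : ℤ, (2 ^ ((k : ℝ) + 1) * N) * ((2 ^ ((l : ℝ) + 1) * M) *
          ∫⁻ s in layer p f volume k, ∫⁻ t in layer p g volume l, K (t - s)) := by
        have hm : ∀ k l : ℤ, Measurable fun s => (layer p f volume k).indicator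
            (fun _ => (2 : ℝ≥0∞) ^ ((k : ℝ) + 1) * N) s
            * ((2 ^ ((l : ℝ) + 1) * M) * ∫⁻ t in layer p g volume l, K (t - s)) :=
          fun k l => (hmf k).mul ((hmI l).const_mul _)
        rw [lintegral_tsum fun k => (Measurable.tsum (hm k)).aemeasurable]
        congr 1; ext k
        rw [lintegral_tsum fun l => (hm k l).aemeasurable]
        congr 1; ext l
        rw [← lintegral_const_mul _ (hmI l), ← lintegral_const_mul _ ((hmI l).const_mul _),
          ← lintegral_indicator (measurableSet_layer hf k)]
        congr 1; ext s
        by_cases hs : s ∈ layer p f volume k <;> simp [hs]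
    _ ≤ ∑' k : ℤ, ∑' l : ℤ, 4 * κ * (N * M) * (2 ^ (-(p - 1) * |(l : ℝ) - k|) * (c k + d l)) :=
        ENNReal.tsum_le_tsum fun k => ENNReal.tsum_le_tsum fun l => hterm k l
    _ = 4 * κ * (N * M) * ∑' k : ℤ, ∑' l : ℤ, (2 ^ (-(p - 1) * |(l : ℝ) - k|) * (c k + d l)) := by
        simp_rw [ENNReal.tsum_mul_left]
    _ ≤ 4 * κ * (N * M) * (2 * C) := by
        gcongr
        refine tsum_tsum_mul_add_le (fun k : ℤ => hC k) (fun l => ?_) (tsum_layerMass_le hp0 hf)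
          (tsum_layerMass_le hp0 hg)
        simp_rw [abs_sub_comm (l : ℝ)]
        exact hC l
    _ = _ := by push_cast; ring

/-- Hölder's inequality against a constant function. -/
lemma lintegral_rpow_le_measure_mul {X : Type*} [MeasurableSpace X] {μ : Measure X} {ρ : ℝ}
    (hρ : 1 < ρ) {f : X → ℝ≥0∞} (hf : AEMeasurable f μ) :
    (∫⁻ x, f x ∂μ) ^ ρ ≤ μ Set.univ ^ (ρ - 1) * ∫⁻ x, f x ^ ρ ∂μ := by
  have hc : ρ.HolderConjugate (ρ / (ρ - 1)) := Real.HolderConjugate.conjExponent hρ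
  have h := ENNReal.lintegral_mul_le_Lp_mul_Lq μ hc hf (aemeasurable_const (b := (1 : ℝ≥0∞)))
  simp only [Pi.mul_apply, mul_one, ENNReal.one_rpow, lintegral_const, one_mul] at h
  have h2 := ENNReal.rpow_le_rpow h (by linarith : 0 ≤ ρ)
  refine h2.trans (le_of_eq ?_)
  have hρ0 : ρ ≠ 0 := by linarith
  have hρ1 : ρ - 1 ≠ 0 := by linarith
  rw [ENNReal.mul_rpow_of_nonneg _ _ (by linarith), ← ENNReal.rpow_mul, ← ENNReal.rpow_mul,
    one_div_mul_cancel hρ0, ENNReal.rpow_one, mul_comm]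
  congr 2
  field_simp

/-- Young's inequality for the convolution with an indicator function. -/
lemma lintegral_convolution_indicator_rpow_le {ρ : ℝ} (hρ : 1 < ρ) {E : Set ℝ}
    (hE : MeasurableSet E) {f : ℝ → ℝ≥0∞} (hf : Measurable f) :
    ∫⁻ t, (∫⁻ s, E.indicator 1 (t - s) * f s) ^ ρ ≤ volume E ^ ρ * ∫⁻ s, f s ^ ρ := by
  have hE' : ∀ t : ℝ, MeasurableSet ((fun s => t - s) ⁻¹' E) := fun t =>
    hE.preimage (by fun_prop)
  have hv : ∀ t : ℝ, volume ((fun s => t - s) ⁻¹' E) = volume E := fun t =>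
    (Measure.measurePreserving_sub_left (volume : Measure ℝ) t).measure_preimage hE.nullMeasurableSet
  have hset : ∀ (t : ℝ) (h : ℝ → ℝ≥0∞), ∫⁻ s, E.indicator 1 (t - s) * h s
      = ∫⁻ s in (fun s => t - s) ⁻¹' E, h s := by
    intro t h
    rw [← lintegral_indicator (hE' t)]
    congr 1; ext s
    by_cases hs : t - s ∈ E <;> simp [Set.indicator, hs]
  have hm1 : Measurable (E.indicator (1 : ℝ → ℝ≥0∞)) := measurable_one.indicator hE
  calc _ ≤ ∫⁻ t, volume E ^ (ρ - 1) * ∫⁻ s, E.indicator 1 (t - s) * f s ^ ρ := by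
        refine lintegral_mono fun t => ?_
        simp only [hset]
        have := lintegral_rpow_le_measure_mul (μ := volume.restrict ((fun s => t - s) ⁻¹' E)) hρ
          hf.aemeasurable
        rwa [Measure.restrict_apply_univ, hv] at this
    _ = volume E ^ (ρ - 1) * ∫⁻ t, ∫⁻ s, E.indicator 1 (t - s) * f s ^ ρ := by
        rw [lintegral_const_mul]
        have : Measurable (Function.uncurry fun t s : ℝ => E.indicator 1 (t - s) * f s ^ ρ) := by
          unfold Function.uncurry; fun_prop
        exact this.lintegral_prod_right'
    _ = volume E ^ (ρ - 1) * ∫⁻ s, volume E * f s ^ ρ := by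
        rw [lintegral_lintegral_swap (by unfold Function.uncurry; fun_prop)]
        congr 2; ext s
        rw [lintegral_mul_const _ (by fun_prop), lintegral_sub_right_eq_self, lintegral_indicator_one hE]
    _ = _ := by
        rw [lintegral_const_mul _ (by fun_prop), ← mul_assoc]
        congr 1
        conv_lhs => rw [← ENNReal.rpow_one (volume E)]
        rw [← ENNReal.rpow_mul, ← ENNReal.rpow_add_of_nonneg _ _ (by linarith) (by linarith)]
        congr 1; ring

end

section

/-! ### Weak and strong measurability in a separable Hilbert space -/

section Weak

variable {H α : Type*} [NormedAddCommGroup H] [InnerProductSpace ℂ H] [SecondCountableTopology H]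
  [MeasurableSpace α]

/-- Pettis's theorem: distances to a point are determined by countably many inner products, and open
sets are countable unions of balls around a dense sequence. It supplies every measurability
statement about L²-valued curves defined only through pairings. -/
lemma stronglyMeasurable_of_inner {f : α → H}
    (hf : ∀ h : H, Measurable fun t => inner ℂ h (f t)) : StronglyMeasurable f := by
  have h1 : ∀ x : H, Measurable fun t => ‖f t - x‖ := by
    intro x
    refine measurable_of_Ioi fun a => ?_
    rcases lt_or_ge a 0 with ha | ha
    · convert MeasurableSet.univ using 1
      ext t; simpa using ha.trans_le (norm_nonneg _)
    have : (fun t => ‖f t - x‖) ⁻¹' Set.Ioi a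
        = ⋃ n : ℕ, {t | a * ‖TopologicalSpace.denseSeq H n‖
            < ‖inner ℂ (TopologicalSpace.denseSeq H n) (f t) -
              inner ℂ (TopologicalSpace.denseSeq H n) x‖} := by
      ext t
      simp only [Set.mem_preimage, Set.mem_Ioi, Set.mem_iUnion, Set.mem_ofPred_eq,
        ← inner_sub_right]
      constructor
      · intro h
        -- The vector f t - x itself satisfies this condition on h, and the condition is open, so
        -- some element of the dense sequence satisfies it. No normalisation of the sequence is
        -- needed.
        have hopen : IsOpen {h : H | a * ‖h‖ < ‖inner ℂ h (f t - x)‖} :=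
          isOpen_lt (by fun_prop) (by fun_prop)
        have hne : {h : H | a * ‖h‖ < ‖inner ℂ h (f t - x)‖}.Nonempty := by
          refine ⟨f t - x, ?_⟩
          simp only [Set.mem_ofPred_eq]
          rw [← inner_self_re_eq_norm, inner_self_eq_norm_mul_norm]
          exact mul_lt_mul_of_pos_right h (ha.trans_lt h)
        exact (TopologicalSpace.denseRange_denseSeq H).exists_mem_open hopen hne
      · rintro ⟨n, hn⟩
        have := hn.trans_le (norm_inner_le_norm _ _)
        rw [mul_comm] at this
        exact lt_of_mul_lt_mul_left this (norm_nonneg _)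
    rw [this]
    refine MeasurableSet.iUnion fun n => measurableSet_lt measurable_const ?_
    exact ((hf _).sub_const _).norm
  borelize H
  refine Measurable.stronglyMeasurable (measurable_of_isOpen fun O hO => ?_)
  have : f ⁻¹' O = ⋃ n : ℕ, ⋃ q : ℚ, ⋃ (_ : Metric.ball (TopologicalSpace.denseSeq H n) q ⊆ O),
      {t | ‖f t - TopologicalSpace.denseSeq H n‖ < q} := by
    ext t
    simp only [Set.mem_preimage, Set.mem_iUnion, Set.mem_ofPred_eq, exists_prop]
    constructor
    · intro ht
      obtain ⟨ε, hε, hb⟩ := Metric.isOpen_iff.1 hO _ ht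
      obtain ⟨q, hq0, hq⟩ := exists_rat_btwn (half_pos hε)
      obtain ⟨n, hn⟩ := (TopologicalSpace.denseRange_denseSeq H).exists_dist_lt (f t) hq0
      refine ⟨n, q, fun y hy => hb ?_, by rwa [← dist_eq_norm]⟩
      rw [Metric.mem_ball] at hy ⊢
      rw [dist_comm] at hn
      linarith [dist_triangle y (TopologicalSpace.denseSeq H n) (f t)]
    · rintro ⟨n, q, hs, hn⟩
      exact hs (by rwa [Metric.mem_ball, dist_eq_norm])
  rw [this]
  refine MeasurableSet.iUnion fun n => MeasurableSet.iUnion fun q => MeasurableSet.iUnion fun _ => ?_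
  exact measurableSet_lt (h1 _) measurable_const

end Weak

variable {d : ℕ}

instance : SecondCountableTopology (L2 d) := by
  have : Fact ((2 : ℝ≥0∞) ≠ ⊤) := ⟨by simp⟩
  infer_instance

/-! ### Test functions -/

/-- Bounded measurable functions of bounded support on `ℝᵈ`. -/
structure Test (φ : Space d → ℂ) : Prop where
  measurable : Measurable φ
  bounded : ∃ M : ℝ, ∀ x, ‖φ x‖ ≤ M
  support : ∃ R : ℝ, ∀ x, φ x ≠ 0 → ‖x‖ ≤ R

lemma Test.memLp {φ : Space d → ℂ} (h : Test φ) (p : ℝ≥0∞) : MemLp φ p volume := by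
  obtain ⟨M, hM⟩ := h.bounded
  obtain ⟨R, hR⟩ := h.support
  have h1 : MemLp ((Metric.closedBall (0 : Space d) R).indicator φ) p volume := by
    rw [memLp_indicator_iff_restrict Metric.isClosed_closedBall.measurableSet]
    have : IsFiniteMeasure ((volume : Measure (Space d)).restrict (Metric.closedBall 0 R)) :=
      ⟨by rw [Measure.restrict_apply_univ]; exact measure_closedBall_lt_top⟩
    exact MemLp.of_bound h.measurable.aestronglyMeasurable M (Filter.Eventually.of_forall hM)
  convert h1 using 1
  ext x
  by_cases hx : φ x = 0
  · simp [Set.indicator, hx]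
  · rw [Set.indicator_of_mem]
    simpa using hR x hx

lemma Test.add {φ ψ : Space d → ℂ} (h : Test φ) (h' : Test ψ) : Test (φ + ψ) := by
  obtain ⟨M, hM⟩ := h.bounded
  obtain ⟨R, hR⟩ := h.support
  obtain ⟨M', hM'⟩ := h'.bounded
  obtain ⟨R', hR'⟩ := h'.support
  refine ⟨h.measurable.add h'.measurable, ⟨M + M', fun x =>
    (norm_add_le _ _).trans (add_le_add (hM x) (hM' x))⟩, ⟨max R R', fun x hx => ?_⟩⟩
  by_cases h1 : φ x = 0
  · exact (hR' x (by intro h2; exact hx (by simp [h1, h2]))).trans (le_max_right _ _)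
  · exact (hR x h1).trans (le_max_left _ _)

lemma test_zero : Test (0 : Space d → ℂ) :=
  ⟨measurable_zero, ⟨0, by simp⟩, ⟨0, by simp⟩⟩

lemma Test.sum {ι : Type*} {s : Finset ι} {φ : ι → Space d → ℂ} (h : ∀ i, Test (φ i)) :
    Test (∑ i ∈ s, φ i) := by
  classical
  induction s using Finset.induction_on with
  | empty => simpa using test_zero
  | insert i s hi ih => rw [Finset.sum_insert hi]; exact (h i).add ih

lemma Test.indicator {φ : Space d → ℂ} (h : Test φ) {S : Set (Space d)} (hS : MeasurableSet S) :
    Test (S.indicator φ) := by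
  obtain ⟨M, hM⟩ := h.bounded
  obtain ⟨R, hR⟩ := h.support
  refine ⟨h.measurable.indicator hS, ⟨M, fun x => (norm_indicator_le_norm_self _ _).trans (hM x)⟩,
    ⟨R, fun x hx => hR x ?_⟩⟩
  exact fun h0 => hx (by by_cases hx : x ∈ S <;> simp [hx, h0])

/-- The class in `L²` of a square integrable function. -/
def toL2 (φ : Space d → ℂ) : L2 d := by
  classical exact if h : MemLp φ 2 volume then h.toLp φ else 0

lemma toL2_of_memLp {φ : Space d → ℂ} (h : MemLp φ 2 volume) : toL2 φ = h.toLp φ := dif_pos h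

lemma Test.coeFn_toL2 {φ : Space d → ℂ} (h : Test φ) : toL2 φ =ᵐ[volume] φ := by
  rw [toL2_of_memLp (h.memLp 2)]; exact MemLp.coeFn_toLp _

lemma Test.toL2_add {φ ψ : Space d → ℂ} (h : Test φ) (h' : Test ψ) :
    toL2 (φ + ψ) = toL2 φ + toL2 ψ := by
  rw [toL2_of_memLp (h.memLp 2), toL2_of_memLp (h'.memLp 2), toL2_of_memLp ((h.add h').memLp 2)]
  rfl

lemma toL2_zero : toL2 (0 : Space d → ℂ) = 0 := by
  rw [toL2_of_memLp (test_zero.memLp 2)]; exact MemLp.toLp_zero _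

lemma toL2_sum {ι : Type*} {s : Finset ι} {φ : ι → Space d → ℂ} (h : ∀ i, Test (φ i)) :
    toL2 (∑ i ∈ s, φ i) = ∑ i ∈ s, toL2 (φ i) := by
  classical
  induction s using Finset.induction_on with
  | empty => simpa using toL2_zero
  | insert i s hi ih => rw [Finset.sum_insert hi, Finset.sum_insert hi, (h i).toL2_add (Test.sum h), ih]

/-- The `L^ρ` norm of a complex function on `ℝᵈ`, for finite `ρ`. -/
def snorm (ρ : ℝ) (φ : Space d → ℂ) : ℝ≥0∞ := lnorm ρ (fun x => ‖φ x‖ₑ) volume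

lemma snorm_eq_eLpNorm {ρ : ℝ} (hρ : 0 < ρ) (φ : Space d → ℂ) :
    snorm ρ φ = eLpNorm φ (ENNReal.ofReal ρ) volume := by
  rw [eLpNorm_eq_lintegral_rpow_enorm_toReal (by simpa using hρ) (by simp),
    ENNReal.toReal_ofReal hρ.le]
  rfl

lemma snorm_one (φ : Space d → ℂ) : snorm 1 φ = eLpNorm φ 1 volume := by
  rw [snorm_eq_eLpNorm one_pos, ENNReal.ofReal_one]

lemma snorm_two (φ : Space d → ℂ) : snorm 2 φ = eLpNorm φ 2 volume := by
  rw [snorm_eq_eLpNorm two_pos]; simp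

lemma Test.snorm_ne_top {φ : Space d → ℂ} (h : Test φ) {ρ : ℝ} (hρ : 0 < ρ) : snorm ρ φ ≠ ⊤ := by
  rw [snorm_eq_eLpNorm hρ]; exact (h.memLp _).eLpNorm_ne_top

lemma Test.enorm_toL2 {φ : Space d → ℂ} (h : Test φ) : ‖toL2 φ‖ₑ = snorm 2 φ := by
  rw [toL2_of_memLp (h.memLp 2), Lp.enorm_toLp, snorm_two]

/-! ### Layers of test functions -/

/-- The part of a complex function that lives on a dyadic layer. -/
def cutLayer (ρ : ℝ) (φ : Space d → ℂ) (k : ℤ) : Space d → ℂ :=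
  (layer ρ (fun x => ‖φ x‖ₑ) volume k).indicator φ

lemma Test.cutLayer {φ : Space d → ℂ} (h : Test φ) (ρ : ℝ) (k : ℤ) : Test (cutLayer ρ φ k) :=
  h.indicator (measurableSet_layer h.measurable.enorm k)

lemma Test.snorm_cutLayer_le {φ : Space d → ℂ} (h : Test φ) {ρ m : ℝ} (hρ : 1 ≤ ρ) (hm : 1 ≤ m)
    (hm2 : m ≤ 2) (k : ℤ) :
    snorm m (Strichartz.cutLayer ρ φ k) ≤ 2 * 2 ^ (k * (1 - ρ / m)) *
      (snorm ρ φ * layerMass ρ (fun x => ‖φ x‖ₑ) volume k ^ (1 / 2 : ℝ)) := by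
  have := lnorm_layer_le (μ := volume) hρ hm hm2 h.measurable.enorm
    (h.snorm_ne_top (by linarith)) k
  refine le_trans (le_of_eq ?_) this
  rw [snorm, Strichartz.cutLayer]
  congr 1; ext x
  rw [enorm_indicator_eq_indicator_enorm]

lemma sum_cutLayer_eq_or {ρ : ℝ} (φ : Space d → ℂ) (s : Finset ℤ) (x : Space d) :
    (∑ k ∈ s, cutLayer ρ φ k) x = 0 ∨ (∑ k ∈ s, cutLayer ρ φ k) x = φ x := by
  rw [Finset.sum_apply]
  by_cases h : ∃ k ∈ s, x ∈ layer ρ (fun x => ‖φ x‖ₑ) volume k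
  · obtain ⟨k, hk, hx⟩ := h
    right
    rw [Finset.sum_eq_single_of_mem k hk, cutLayer, Set.indicator_of_mem hx]
    intro l _ hl
    rw [cutLayer, Set.indicator_of_notMem]
    exact fun h => Set.disjoint_left.1 (disjoint_layer ρ (fun x => ‖φ x‖ₑ) hl) h hx
  · push Not at h
    left
    exact Finset.sum_eq_zero fun k hk => Set.indicator_of_notMem (h k hk) _

lemma sum_cutLayer_of_mem {ρ : ℝ} {φ : Space d → ℂ} {s : Finset ℤ} {k : ℤ} (hk : k ∈ s) {x : Space d}
    (hx : x ∈ layer ρ (fun x => ‖φ x‖ₑ) volume k) : (∑ k ∈ s, cutLayer ρ φ k) x = φ x := by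
  rw [Finset.sum_apply, Finset.sum_eq_single_of_mem k hk, cutLayer, Set.indicator_of_mem hx]
  intro l _ hl
  rw [cutLayer, Set.indicator_of_notMem]
  exact fun h => Set.disjoint_left.1 (disjoint_layer ρ (fun x => ‖φ x‖ₑ) hl) h hx

/-- The symmetric partial sums of the layers. -/
def partialLayers (ρ : ℝ) (φ : Space d → ℂ) (n : ℕ) : Space d → ℂ :=
  ∑ k ∈ Finset.Icc (-(n : ℤ)) n, cutLayer ρ φ k

lemma Test.partialLayers {φ : Space d → ℂ} (h : Test φ) (ρ : ℝ) (n : ℕ) :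
    Test (partialLayers ρ φ n) := Test.sum fun k => h.cutLayer ρ k

lemma norm_partialLayers_le (ρ : ℝ) (φ : Space d → ℂ) (n : ℕ) (x : Space d) :
    ‖partialLayers ρ φ n x‖ ≤ ‖φ x‖ := by
  rcases sum_cutLayer_eq_or (ρ := ρ) φ (Finset.Icc (-(n : ℤ)) n) x with h | h
  · rw [Strichartz.partialLayers, h]; simp
  · rw [Strichartz.partialLayers, h]

/-- The layers are cut relative to the L^ρ norm, but convergence is needed in L², where the
operators are continuous. It follows by dominated convergence with majorant (2|φ|)², since a partial
sum is φ restricted to a set. -/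
lemma Test.tendsto_toL2_partialLayers {φ : Space d → ℂ} (h : Test φ) {ρ : ℝ} (hρ : 0 < ρ) :
    Filter.Tendsto (fun n => toL2 (Strichartz.partialLayers ρ φ n)) Filter.atTop (nhds (toL2 φ)) := by
  have hlim : ∀ᵐ x ∂(volume : Measure (Space d)), Filter.Tendsto
      (fun n => Strichartz.partialLayers ρ φ n x) Filter.atTop (nhds (φ x)) := by
    rcases eq_or_ne (snorm ρ φ) 0 with h0 | h0
    · rw [snorm_eq_eLpNorm hρ, eLpNorm_eq_zero_iff h.measurable.aestronglyMeasurable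
        (by simpa using hρ)] at h0
      filter_upwards [h0] with x hx
      have : ∀ n, Strichartz.partialLayers ρ φ n x = 0 := fun n => by
        have := norm_partialLayers_le ρ φ n x
        rw [hx] at this
        simpa using this
      rw [hx]; simp [this]
    · refine Filter.Eventually.of_forall fun x => ?_
      by_cases hx : φ x = 0
      · have : ∀ n, Strichartz.partialLayers ρ φ n x = 0 := fun n => by
          have := norm_partialLayers_le ρ φ n x
          rw [hx] at this
          simpa using this
        rw [hx]; simp [this]
      obtain ⟨k, hk⟩ := exists_mem_layer (φ := fun x => ‖φ x‖ₑ) h0 (h.snorm_ne_top hρ) (x := x)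
        (by simpa using hx) (by simp)
      refine tendsto_const_nhds.congr' ?_
      filter_upwards [Filter.eventually_ge_atTop k.natAbs] with n hn
      refine (sum_cutLayer_of_mem ?_ hk).symm
      rw [Finset.mem_Icc]; omega
  rw [toL2_of_memLp (h.memLp 2)]
  have hb : ∀ n, toL2 (Strichartz.partialLayers ρ φ n) = ((h.partialLayers ρ n).memLp 2).toLp _ :=
    fun n => toL2_of_memLp _
  simp_rw [hb]
  rw [Lp.tendsto_Lp_iff_tendsto_eLpNorm'']
  have hm : ∀ n, Measurable (Strichartz.partialLayers ρ φ n) := fun n => (h.partialLayers ρ n).measurable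
  simp_rw [← snorm_two, snorm, lnorm]
  have h0 : (0 : ℝ≥0∞) = 0 ^ (1 / 2 : ℝ) := by simp
  rw [h0]
  refine ((ENNReal.continuous_rpow_const).tendsto 0).comp ?_
  have hz : (0 : ℝ≥0∞) = ∫⁻ x : Space d, 0 := by simp
  rw [hz]
  have := h.measurable
  refine tendsto_lintegral_of_dominated_convergence (fun x => (2 * ‖φ x‖ₑ) ^ (2 : ℝ)) (fun n => ?_)
    (fun n => Filter.Eventually.of_forall fun x => ?_) ?_ ?_
  · have := hm n
    fun_prop
  · refine ENNReal.rpow_le_rpow ?_ (by norm_num)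
    rw [two_mul]
    refine (enorm_sub_le).trans (add_le_add ?_ le_rfl)
    exact enorm_le_iff_norm_le.2 (norm_partialLayers_le ρ φ n x)
  · have h2 := h.snorm_ne_top two_pos
    simp_rw [ENNReal.mul_rpow_of_nonneg _ _ (by norm_num : (0 : ℝ) ≤ 2)]
    rw [lintegral_const_mul _ (by fun_prop)]
    refine ENNReal.mul_ne_top (by simp) ?_
    rw [← lnorm_rpow two_pos]
    exact ENNReal.rpow_ne_top_of_nonneg (by norm_num) h2
  · filter_upwards [hlim] with x hx
    have h1 : Filter.Tendsto (fun n => ‖Strichartz.partialLayers ρ φ n x - φ x‖ₑ) Filter.atTop (nhds 0) := by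
      have := (hx.sub_const (φ x)).enorm
      simpa using this
    have h2 := ((ENNReal.continuous_rpow_const (y := 2)).tendsto 0).comp h1
    simpa [Function.comp_def] using h2

/-! ### Interpolation between `L¹` and `L²` -/

/-- Continuity of the power lets a constant W be assumed strictly positive in estimates where W = 0
would be degenerate. -/
lemma le_mul_rpow_of_forall_pos {L W C N : ℝ≥0∞} {θ : ℝ} (hC : C ≠ ⊤) (hN : N ≠ ⊤)
    (h : ∀ ε : ℝ≥0, 0 < ε → L ≤ C * (W + ε) ^ θ * N) : L ≤ C * W ^ θ * N := by
  have h3 : Filter.Tendsto (fun n : ℕ => ((((n : ℝ≥0) + 1)⁻¹ : ℝ≥0) : ℝ≥0∞)) Filter.atTop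
      (nhds 0) := by
    have h5 := (Filter.tendsto_add_atTop_iff_nat 1).2 ENNReal.tendsto_inv_nat_nhds_zero
    refine h5.congr fun n => ?_
    rw [ENNReal.coe_inv (by positivity)]
    push_cast; rfl
  have h4 := h3.const_add W
  rw [add_zero] at h4
  have hlim := ENNReal.Tendsto.mul_const (b := N) (ENNReal.Tendsto.const_mul (a := C)
    (((ENNReal.continuous_rpow_const (y := θ)).tendsto W).comp h4) (Or.inr hC)) (Or.inr hN)
  exact ge_of_tendsto' hlim fun n => h _ (by positivity)

lemma enorm_inner_le {H : Type*} [NormedAddCommGroup H] [InnerProductSpace ℂ H] (x y : H) :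
    ‖inner ℂ x y‖ₑ ≤ ‖x‖ₑ * ‖y‖ₑ := by
  rw [enorm_eq_nnnorm, enorm_eq_nnnorm, enorm_eq_nnnorm]
  exact_mod_cast nnnorm_inner_le_nnnorm x y

/-- A bilinear form that is bounded on `L² × L²` and on `L¹ × L¹` is bounded on `L^ρ × L^ρ`. -/
lemma exists_interpolation {ρ : ℝ} (h1 : 1 ≤ ρ) (h2 : ρ < 2) :
    ∃ C : ℝ≥0, ∀ (d : ℕ) (S T : L2 d →L[ℂ] L2 d) (W : ℝ≥0∞), (∀ f, ‖S f‖ ≤ ‖f‖) → (∀ f, ‖T f‖ ≤ ‖f‖) →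
      (∀ f g : Space d → ℂ, Test f → Test g →
        ‖inner ℂ (S (toL2 f)) (T (toL2 g))‖ₑ ≤ W * (snorm 1 f * snorm 1 g)) →
      ∀ f g : Space d → ℂ, Test f → Test g →
        ‖inner ℂ (S (toL2 f)) (T (toL2 g))‖ₑ ≤ C * W ^ (2 / ρ - 1) * (snorm ρ f * snorm ρ g) := by
  have hθ : 0 < 2 / ρ - 1 := by
    rw [sub_pos, lt_div_iff₀ (by linarith)]; linarith
  rcases eq_or_lt_of_le h1 with rfl | h1'
  · refine ⟨1, fun d S T W _ _ hW f g hf hg => ?_⟩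
    have := hW f g hf hg
    norm_num
    exact this
  have hρ0 : 0 < ρ := by linarith
  -- On layers k and l the L² bound grows like 2 ^ ((k + l)(1 - ρ / 2)), and the L¹ bound decays
  -- like W 2 ^ (-(k + l)(ρ - 1)). Their crossing gives the exponent y / (x + y) = 2 / ρ - 1.
  obtain ⟨C, hC⟩ := exists_tsum_min_le (x := ρ - 1) (y := 1 - ρ / 2) (by linarith) (by linarith)
  refine ⟨8 * C, fun d S T W hS hT hW f g hf hg => ?_⟩
  set N := snorm ρ f with hN
  set M := snorm ρ g with hM
  have hexp : (1 - ρ / 2) / (ρ - 1 + (1 - ρ / 2)) = 2 / ρ - 1 := by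
    rw [show ρ - 1 + (1 - ρ / 2) = ρ / 2 by ring]; field_simp
  have hL2 : ∀ f g : Space d → ℂ, Test f → Test g →
      ‖inner ℂ (S (toL2 f)) (T (toL2 g))‖ₑ ≤ snorm 2 f * snorm 2 g := by
    intro f g hf hg
    rw [← hf.enorm_toL2, ← hg.enorm_toL2]
    exact (enorm_inner_le _ _).trans (mul_le_mul' (enorm_le_iff_norm_le.2 (hS _))
      (enorm_le_iff_norm_le.2 (hT _)))
  -- For W = ∞ the right side is infinite unless f or g vanishes almost everywhere, in which case
  -- the L² bound gives 0. The constant C cannot be 0, because at W = 1 the sum it bounds has the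
  -- term 1.
  rcases eq_or_ne W ⊤ with hWt | hWt
  · rw [hWt, ENNReal.top_rpow_of_pos hθ]
    rcases eq_or_ne (N * M) 0 with h0 | h0
    · have hz : ∀ φ : Space d → ℂ, Test φ → snorm ρ φ = 0 → snorm 2 φ = 0 := by
        intro φ hφ h
        rw [snorm_eq_eLpNorm hρ0, eLpNorm_eq_zero_iff hφ.measurable.aestronglyMeasurable
          (by simpa using hρ0)] at h
        rw [snorm_two, eLpNorm_congr_ae h]; simp
      refine (hL2 f g hf hg).trans ?_
      rcases mul_eq_zero.1 h0 with h | h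
      · rw [hz f hf h]; simp
      · rw [hz g hg h]; simp
    · rcases eq_or_ne C 0 with hC0 | hC0
      · exfalso
        have := hC 1 (by simp) (by simp)
        rw [hC0] at this
        simp only [ENNReal.coe_zero, zero_mul, nonpos_iff_eq_zero, ENNReal.tsum_eq_zero] at this
        have := this 0
        simp at this
      · rw [ENNReal.mul_top (by simpa using hC0), ENNReal.top_mul h0]
        exact le_top
  have hW0 : ∀ ε : ℝ≥0, 0 < ε → ‖inner ℂ (S (toL2 f)) (T (toL2 g))‖ₑ
      ≤ (8 * C : ℝ≥0) * (W + ε) ^ (2 / ρ - 1) * (N * M) := by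
    intro ε hε
    set W' := W + ε with hW'
    have hWn : W' ≠ 0 := by
      have : (ε : ℝ≥0∞) ≠ 0 := by simpa using hε.ne'
      exact fun h => this (add_eq_zero.1 h).2
    have hWn' : W' ≠ ⊤ := ENNReal.add_ne_top.2 ⟨hWt, by simp⟩
    set c := layerMass ρ (fun x => ‖f x‖ₑ) (volume : Measure (Space d))
    set e := layerMass ρ (fun x => ‖g x‖ₑ) (volume : Measure (Space d))
    have hterm : ∀ k l : ℤ,
        ‖inner ℂ (S (toL2 (cutLayer ρ f k))) (T (toL2 (cutLayer ρ g l)))‖ₑ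
        ≤ 4 * (N * M) * (min ((2 : ℝ≥0∞) ^ (((k + l : ℤ) : ℝ) * (1 - ρ / 2)))
          (W' * 2 ^ (-((k + l : ℤ) : ℝ) * (ρ - 1))) * (c k + e l)) := by
      intro k l
      have hfk := hf.cutLayer ρ k
      have hgl := hg.cutLayer ρ l
      have hce : c k ^ (1 / 2 : ℝ) * e l ^ (1 / 2 : ℝ) ≤ c k + e l := by
        rw [← ENNReal.mul_rpow_of_nonneg _ _ (by norm_num)]
        calc (c k * e l) ^ (1 / 2 : ℝ) ≤ ((c k + e l) * (c k + e l)) ^ (1 / 2 : ℝ) :=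
              ENNReal.rpow_le_rpow (mul_le_mul' le_self_add le_add_self) (by norm_num)
          _ = c k + e l := by
              rw [← sq, ← ENNReal.rpow_natCast, ← ENNReal.rpow_mul]; norm_num
      have hm : ∀ m : ℝ, 1 ≤ m → m ≤ 2 → snorm m (cutLayer ρ f k) * snorm m (cutLayer ρ g l)
          ≤ 4 * (N * M) * (2 ^ (((k + l : ℤ) : ℝ) * (1 - ρ / m)) * (c k + e l)) := by
        intro m hm1 hm2
        calc _ ≤ (2 * 2 ^ (k * (1 - ρ / m)) * (N * c k ^ (1 / 2 : ℝ))) *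
              (2 * 2 ^ (l * (1 - ρ / m)) * (M * e l ^ (1 / 2 : ℝ))) :=
              mul_le_mul' (hf.snorm_cutLayer_le h1 hm1 hm2 k) (hg.snorm_cutLayer_le h1 hm1 hm2 l)
          _ = 4 * (N * M) * ((2 ^ (k * (1 - ρ / m)) * 2 ^ (l * (1 - ρ / m))) *
              (c k ^ (1 / 2 : ℝ) * e l ^ (1 / 2 : ℝ))) := by ring
          _ ≤ _ := by
              rw [← two_rpow_add]
              refine mul_le_mul_right (mul_le_mul' (le_of_eq ?_) hce) _
              push_cast; ring_nf
      rw [min_mul_of_nonneg _ _ zero_le, mul_min_of_nonneg _ _ zero_le]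
      refine le_min ((hL2 _ _ hfk hgl).trans (hm 2 (by norm_num) le_rfl)) ?_
      calc _ ≤ W * (snorm 1 (cutLayer ρ f k) * snorm 1 (cutLayer ρ g l)) := hW _ _ hfk hgl
        _ ≤ W' * (4 * (N * M) * (2 ^ (((k + l : ℤ) : ℝ) * (1 - ρ / 1)) * (c k + e l))) :=
            mul_le_mul' le_self_add (hm 1 le_rfl (by norm_num))
        _ = _ := by
            rw [show ((k + l : ℤ) : ℝ) * (1 - ρ / 1) = -((k + l : ℤ) : ℝ) * (ρ - 1) by ring]
            ring
    have hlim : Filter.Tendsto (fun n => ‖inner ℂ (S (toL2 (partialLayers ρ f n)))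
        (T (toL2 (partialLayers ρ g n)))‖ₑ) Filter.atTop
        (nhds ‖inner ℂ (S (toL2 f)) (T (toL2 g))‖ₑ) :=
      (((S.continuous.tendsto _).comp (hf.tendsto_toL2_partialLayers hρ0)).inner
        ((T.continuous.tendsto _).comp (hg.tendsto_toL2_partialLayers hρ0))).enorm
    refine le_of_tendsto' hlim fun n => ?_
    rw [partialLayers, partialLayers, toL2_sum fun k => hf.cutLayer ρ k,
      toL2_sum fun k => hg.cutLayer ρ k, map_sum, map_sum, sum_inner]
    simp_rw [inner_sum]
    set ρ' : ℤ → ℤ → ℝ≥0∞ := fun k l => min ((2 : ℝ≥0∞) ^ (((k + l : ℤ) : ℝ) * (1 - ρ / 2)))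
          (W' * 2 ^ (-((k + l : ℤ) : ℝ) * (ρ - 1))) with hρ'
    -- The weight depends on k + l only, so every row, and by symmetry every column, is a shift of
    -- one and the same sum.
    have hsum : ∀ k, ∑' l, ρ' k l ≤ C * W' ^ (2 / ρ - 1) := by
      intro k
      rw [← hexp]
      refine le_trans (le_of_eq ?_) (hC W' hWn hWn')
      exact (Equiv.addLeft k).tsum_eq (fun n : ℤ => min ((2 : ℝ≥0∞) ^ ((n : ℝ) * (1 - ρ / 2)))
          (W' * 2 ^ (-(n : ℝ) * (ρ - 1))))
    have hsym : ∀ k l, ρ' k l = ρ' l k := fun k l => by simp only [hρ', add_comm]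
    calc _ ≤ ∑ k ∈ Finset.Icc (-(n : ℤ)) n, ∑ l ∈ Finset.Icc (-(n : ℤ)) n,
          ‖inner ℂ (S (toL2 (cutLayer ρ f k))) (T (toL2 (cutLayer ρ g l)))‖ₑ :=
          (enorm_sum_le _ _).trans (Finset.sum_le_sum fun k _ => enorm_sum_le _ _)
      _ ≤ ∑' k, ∑' l, 4 * (N * M) * (ρ' k l * (c k + e l)) := by
          refine le_trans (Finset.sum_le_sum fun k _ => ?_) (ENNReal.sum_le_tsum _)
          exact (Finset.sum_le_sum fun l _ => hterm k l).trans (ENNReal.sum_le_tsum _)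
      _ = 4 * (N * M) * ∑' k, ∑' l, ρ' k l * (c k + e l) := by
          simp_rw [ENNReal.tsum_mul_left]
      _ ≤ 4 * (N * M) * (2 * (C * W' ^ (2 / ρ - 1))) := by
          refine mul_le_mul_right (tsum_tsum_mul_add_le hsum (fun l => ?_)
            (tsum_layerMass_le hρ0 hf.measurable.enorm)
            (tsum_layerMass_le hρ0 hg.measurable.enorm)) _
          simp_rw [fun k => hsym k l]
          exact hsum l
      _ = _ := by push_cast; ring
  exact le_mul_rpow_of_forall_pos ENNReal.coe_ne_top (ENNReal.mul_ne_top (hf.snorm_ne_top hρ0)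
    (hg.snorm_ne_top hρ0)) hW0

end

section

variable {d : ℕ}

/-! ### Test functions on space-time -/

/-- Bounded jointly measurable functions of bounded support on `ℝ × ℝᵈ`. -/
structure Nice (F : ℝ → Space d → ℂ) : Prop where
  measurable : Measurable (Function.uncurry F)
  bounded : ∃ M : ℝ, ∀ t x, ‖F t x‖ ≤ M
  support : ∃ R : ℝ, ∀ t x, F t x ≠ 0 → |t| ≤ R ∧ ‖x‖ ≤ R

lemma Nice.test {F : ℝ → Space d → ℂ} (h : Nice F) (t : ℝ) : Test (F t) := by
  obtain ⟨M, hM⟩ := h.bounded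
  obtain ⟨R, hR⟩ := h.support
  exact ⟨h.measurable.comp measurable_prodMk_left, ⟨M, hM t⟩, ⟨R, fun x hx => (hR t x hx).2⟩⟩

lemma measurable_snorm_of_measurable {F : ℝ → Space d → ℂ} (h : Measurable (Function.uncurry F))
    (ρ : ℝ) : Measurable fun t => snorm ρ (F t) := by
  have : Measurable (fun z : ℝ × Space d => ‖Function.uncurry F z‖ₑ ^ ρ) := by fun_prop
  exact (this.lintegral_prod_right').pow_const _

lemma Nice.measurable_snorm {F : ℝ → Space d → ℂ} (h : Nice F) (ρ : ℝ) :
    Measurable fun t => snorm ρ (F t) := measurable_snorm_of_measurable h.measurable ρ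

lemma Nice.of_norm_le {F G : ℝ → Space d → ℂ} (h : Nice F) (hG : Measurable (Function.uncurry G))
    (hle : ∀ t x, ‖G t x‖ ≤ ‖F t x‖) : Nice G := by
  obtain ⟨M, hM⟩ := h.bounded
  obtain ⟨R, hR⟩ := h.support
  refine ⟨hG, ⟨M, fun t x => (hle t x).trans (hM t x)⟩, ⟨R, fun t x hx => hR t x fun h0 => hx ?_⟩⟩
  have := hle t x
  rw [h0] at this
  simpa using this

lemma Nice.cutLayer {F : ℝ → Space d → ℂ} (h : Nice F) (ρ : ℝ) (k : ℤ) :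
    Nice fun t => cutLayer ρ (F t) k := by
  refine h.of_norm_le ?_ fun t x => norm_indicator_le_norm_self _ _
  have h1 : MeasurableSet {z : ℝ × Space d | z.2 ∈ layer ρ (fun x => ‖F z.1 x‖ₑ) volume k} := by
    have hm := h.measurable_snorm ρ
    have hF : Measurable fun z : ℝ × Space d => ‖F z.1 z.2‖ₑ := h.measurable.enorm
    have hs : Measurable fun z : ℝ × Space d => snorm ρ (F z.1) := hm.comp measurable_fst
    exact (measurableSet_le (hs.const_mul _) hF).inter (measurableSet_lt hF (hs.const_mul _))
  exact h.measurable.indicator h1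

lemma Nice.indicator {F : ℝ → Space d → ℂ} (h : Nice F) {S : Set ℝ} (hS : MeasurableSet S) :
    Nice (S.indicator F) := by
  have he : ∀ t x, S.indicator F t x = (Prod.fst ⁻¹' S).indicator (Function.uncurry F) (t, x) := by
    intro t x
    by_cases ht : t ∈ S <;> simp [Set.indicator, ht]
  refine h.of_norm_le ?_ fun t x => ?_
  · have : Function.uncurry (S.indicator F) = (Prod.fst ⁻¹' S).indicator (Function.uncurry F) := by
      ext ⟨t, x⟩; exact he t x
    rw [this]
    exact h.measurable.indicator (hS.preimage measurable_fst)
  · rw [he]; exact norm_indicator_le_norm_self _ _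

lemma Nice.exists_snorm_le {F : ℝ → Space d → ℂ} (h : Nice F) {ρ : ℝ} (hρ : 0 < ρ) :
    ∃ (K : ℝ≥0) (R : ℝ), ∀ t, snorm ρ (F t) ≤ (Set.Icc (-R) R).indicator (fun _ => (K : ℝ≥0∞)) t := by
  obtain ⟨M, hM⟩ := h.bounded
  obtain ⟨R, hR⟩ := h.support
  set K : ℝ≥0∞ := (ENNReal.ofReal M ^ ρ * volume (Metric.closedBall (0 : Space d) R)) ^ (1 / ρ) with hK
  have hKt : K ≠ ⊤ := ENNReal.rpow_ne_top_of_nonneg (by positivity)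
    (ENNReal.mul_ne_top (ENNReal.rpow_ne_top_of_nonneg hρ.le (by simp)) measure_closedBall_lt_top.ne)
  refine ⟨K.toNNReal, R, fun t => ?_⟩
  by_cases ht : t ∈ Set.Icc (-R) R
  · rw [Set.indicator_of_mem ht, ENNReal.coe_toNNReal hKt]
    refine ENNReal.rpow_le_rpow ?_ (by positivity)
    rw [← setLIntegral_const, ← lintegral_indicator Metric.isClosed_closedBall.measurableSet]
    refine lintegral_mono fun x => ?_
    by_cases hx : F t x = 0
    · simp [hx, ENNReal.zero_rpow_of_pos hρ]
    · rw [Set.indicator_of_mem (by simpa using (hR t x hx).2)]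
      refine ENNReal.rpow_le_rpow ?_ hρ.le
      exact (ofReal_norm (F t x)).symm.le.trans (ENNReal.ofReal_le_ofReal (hM t x))
  · rw [Set.indicator_of_notMem ht]
    have : ∀ x, F t x = 0 := fun x => by
      by_contra hx
      exact ht (abs_le.1 (hR t x hx).1)
    simp [snorm, lnorm, this, ENNReal.zero_rpow_of_pos hρ, hρ]

/-- The mixed norm `L^p_t L^ρ_x` over the whole of space-time, for finite exponents. -/
def mnorm (p ρ : ℝ) (F : ℝ → Space d → ℂ) : ℝ≥0∞ := lnorm p (fun t => snorm ρ (F t)) volume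

lemma Nice.mnorm_ne_top {F : ℝ → Space d → ℂ} (h : Nice F) {p ρ : ℝ} (hp : 0 < p) (hρ : 0 < ρ) :
    mnorm p ρ F ≠ ⊤ := by
  obtain ⟨K, R, hK⟩ := h.exists_snorm_le hρ
  refine ENNReal.rpow_ne_top_of_nonneg (by positivity) (ne_top_of_le_ne_top ?_
    (lintegral_mono fun t => ENNReal.rpow_le_rpow (hK t) hp.le))
  have : ∀ t, (Set.Icc (-R) R).indicator (fun _ => (K : ℝ≥0∞)) t ^ p
      = (Set.Icc (-R) R).indicator (fun _ => (K : ℝ≥0∞) ^ p) t := by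
    intro t
    by_cases ht : t ∈ Set.Icc (-R) R
    · rw [Set.indicator_of_mem ht, Set.indicator_of_mem ht]
    · rw [Set.indicator_of_notMem ht, Set.indicator_of_notMem ht, ENNReal.zero_rpow_of_pos hp]
  simp_rw [this]
  rw [lintegral_indicator measurableSet_Icc, setLIntegral_const]
  exact ENNReal.mul_ne_top (ENNReal.rpow_ne_top_of_nonneg hp.le (by simp)) (by simp)

/-- Pairings with a fixed vector are measurable by Fubini, and Pettis's theorem does the rest. -/
lemma stronglyMeasurable_toL2 {F : ℝ → Space d → ℂ} (h : Measurable (Function.uncurry F))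
    (h2 : ∀ t, MemLp (F t) 2 volume) : StronglyMeasurable fun t => toL2 (F t) := by
  refine stronglyMeasurable_of_inner fun v => ?_
  have : ∀ t, inner ℂ v (toL2 (F t)) = ∫ x, inner ℂ (v x) (F t x) := by
    intro t
    rw [L2.inner_def]
    refine integral_congr_ae ?_
    rw [toL2_of_memLp (h2 t)]
    filter_upwards [MemLp.coeFn_toLp (h2 t)] with x hx
    rw [hx]
  simp_rw [this]
  have hm : StronglyMeasurable (fun z : ℝ × Space d => inner ℂ (v z.2) (F z.1 z.2)) :=
    ((Lp.stronglyMeasurable v).comp_measurable measurable_snd).inner h.stronglyMeasurable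
  exact (hm.integral_prod_right').measurable

/-! ### Dispersive families of operators -/

/-- A strongly continuous family of contractions. -/
structure Contractive (U : ℝ → L2 d →L[ℂ] L2 d) : Prop where
  norm_apply_le : ∀ t φ, ‖U t φ‖ ≤ ‖φ‖
  continuous_apply : ∀ φ, Continuous fun t => U t φ

/-- A strongly continuous family of contractions that satisfies a dispersive estimate with a
weight in weak `L¹` for times in `I`. -/
structure Dispersive (γ : ℝ) (I : Set ℝ) (w : ℝ → ℝ≥0∞) (A : ℝ≥0) (U : ℝ → L2 d →L[ℂ] L2 d) : Prop
    extends Contractive U where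
  measurable_weight : Measurable w
  pos : 0 < A
  weak : WeakBound w A
  dispersive : ∀ s ∈ I, ∀ t ∈ I, ∀ f g : Space d → ℂ, Test f → Test g →
    ‖inner ℂ (ContinuousLinearMap.adjoint (U s) (toL2 f))
      (ContinuousLinearMap.adjoint (U t) (toL2 g))‖ₑ ≤ w (t - s) ^ γ * (snorm 1 f * snorm 1 g)

/-- The function `t ↦ U(t)^* F(t)`. -/
def evo (U : ℝ → L2 d →L[ℂ] L2 d) (F : ℝ → Space d → ℂ) (t : ℝ) : L2 d :=
  ContinuousLinearMap.adjoint (U t) (toL2 (F t))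

/-- The form `⟨U(s)^* F(s), U(t)^* G(t)⟩`, restricted to `t - s ∈ D`. -/
def kernel (U : ℝ → L2 d →L[ℂ] L2 d) (D : Set ℝ) (F G : ℝ → Space d → ℂ) (z : ℝ × ℝ) : ℂ :=
  D.indicator (fun _ => inner ℂ (evo U F z.1) (evo U G z.2)) (z.2 - z.1)

/-- The bilinear form `∫∫_{t - s ∈ D} ⟨U(s)^* F(s), U(t)^* G(t)⟩ ds dt`. -/
def bform (U : ℝ → L2 d →L[ℂ] L2 d) (D : Set ℝ) (F G : ℝ → Space d → ℂ) : ℂ :=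
  ∫ z : ℝ × ℝ, kernel U D F G z

variable {γ : ℝ} {I : Set ℝ} {w : ℝ → ℝ≥0∞} {A : ℝ≥0} {U : ℝ → L2 d →L[ℂ] L2 d}
  {F G : ℝ → Space d → ℂ} {D : Set ℝ}

lemma Contractive.norm_adjoint_le (h : Contractive U) (t : ℝ) (φ : L2 d) :
    ‖ContinuousLinearMap.adjoint (U t) φ‖ ≤ ‖φ‖ := by
  have h1 : ‖ContinuousLinearMap.adjoint (U t)‖ ≤ 1 := by
    rw [LinearIsometryEquiv.norm_map]
    exact ContinuousLinearMap.opNorm_le_bound _ zero_le_one fun φ => by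
      rw [one_mul]; exact h.norm_apply_le t φ
  exact (ContinuousLinearMap.le_of_opNorm_le _ h1 φ).trans (by rw [one_mul])

lemma evo_eq_zero {t : ℝ} (h : F t = 0) : evo U F t = 0 := by
  rw [evo, h, toL2_zero, map_zero]

lemma Contractive.enorm_evo_le (h : Contractive U) (hF : Nice F) (t : ℝ) :
    ‖evo U F t‖ₑ ≤ snorm 2 (F t) := by
  rw [← (hF.test t).enorm_toL2]
  exact enorm_le_iff_norm_le.2 (h.norm_adjoint_le t _)

/-- Strong continuity is known for U but not for its adjoints. Moving U t to the other side of the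
inner product gives weak measurability, which suffices. -/
lemma Contractive.stronglyMeasurable_adjoint (h : Contractive U) {u : ℝ → L2 d}
    (hu : StronglyMeasurable u) :
    StronglyMeasurable fun t => ContinuousLinearMap.adjoint (U t) (u t) := by
  refine stronglyMeasurable_of_inner fun v => ?_
  simp_rw [ContinuousLinearMap.adjoint_inner_right]
  exact ((h.continuous_apply v).stronglyMeasurable.inner hu).measurable

lemma Contractive.stronglyMeasurable_evo (h : Contractive U) (hF : Nice F) :
    StronglyMeasurable (evo U F) :=
  h.stronglyMeasurable_adjoint (stronglyMeasurable_toL2 hF.measurable fun t => (hF.test t).memLp 2)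

lemma Contractive.integrable_evo (h : Contractive U) (hF : Nice F) :
    Integrable (evo U F) := by
  refine ⟨(h.stronglyMeasurable_evo hF).aestronglyMeasurable, ?_⟩
  refine lt_of_le_of_lt (lintegral_mono fun t => h.enorm_evo_le hF t) ?_
  have := hF.mnorm_ne_top one_pos two_pos
  simpa [mnorm, lnorm, lt_top_iff_ne_top] using this

lemma Contractive.stronglyMeasurable_kernel (h : Contractive U) (hD : MeasurableSet D)
    (hF : Nice F) (hG : Nice G) : StronglyMeasurable (kernel U D F G) := by
  have h1 : StronglyMeasurable fun z : ℝ × ℝ => inner ℂ (evo U F z.1) (evo U G z.2) :=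
    ((h.stronglyMeasurable_evo hF).comp_measurable measurable_fst).inner
      ((h.stronglyMeasurable_evo hG).comp_measurable measurable_snd)
  have h2 : MeasurableSet {z : ℝ × ℝ | z.2 - z.1 ∈ D} :=
    hD.preimage (measurable_snd.sub measurable_fst)
  exact h1.indicator h2

lemma enorm_kernel_le (z : ℝ × ℝ) :
    ‖kernel U D F G z‖ₑ ≤ ‖evo U F z.1‖ₑ * ‖evo U G z.2‖ₑ := by
  rw [kernel, enorm_indicator_eq_indicator_enorm]
  exact (Set.indicator_le_self _ _ _).trans (enorm_inner_le _ _)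

lemma norm_kernel_le (z : ℝ × ℝ) :
    ‖kernel U D F G z‖ ≤ ‖evo U F z.1‖ * ‖evo U G z.2‖ := by
  rw [kernel, norm_indicator_eq_indicator_norm]
  exact (Set.indicator_le_self' (fun _ _ => norm_nonneg _) _).trans (norm_inner_le_norm _ _)

lemma Contractive.integrable_kernel (h : Contractive U) (hD : MeasurableSet D)
    (hF : Nice F) (hG : Nice G) : Integrable (kernel U D F G) := by
  have h1 := (h.integrable_evo hF).norm.mul_prod (h.integrable_evo hG).norm
  refine h1.mono' (h.stronglyMeasurable_kernel hD hF hG).aestronglyMeasurable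
    (Filter.Eventually.of_forall norm_kernel_le)

lemma Contractive.enorm_bform_le (h : Contractive U) (hD : MeasurableSet D)
    (hF : Nice F) (hG : Nice G) :
    ‖bform U D F G‖ₑ ≤ ∫⁻ s, ∫⁻ t, ‖kernel U D F G (s, t)‖ₑ := by
  refine (enorm_integral_le_lintegral_enorm _).trans (le_of_eq ?_)
  rw [Measure.volume_eq_prod, lintegral_prod _
    (h.stronglyMeasurable_kernel hD hF hG).enorm.aemeasurable]

/-- The reciprocal of the time exponent that belongs to the (dual) space exponent `ρ`. -/
def timeExp (γ ρ : ℝ) : ℝ := γ * (1 / ρ - 1 / 2)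

/-- The bilinear `L^p_t L^ρ_x` estimate for the form `bform`, `1 / p = 1 - timeExp γ ρ`. -/
def BilinearBound (γ ρ : ℝ) (C : ℝ≥0) : Prop :=
  ∀ (d : ℕ) (I : Set ℝ) (w : ℝ → ℝ≥0∞) (A : ℝ≥0) (U : ℝ → L2 d →L[ℂ] L2 d), Dispersive γ I w A U →
    ∀ D : Set ℝ, MeasurableSet D → ∀ F G : ℝ → Space d → ℂ, Nice F → Nice G →
      (∀ t, t ∉ I → F t = 0) → (∀ t, t ∉ I → G t = 0) →
      ‖bform U D F G‖ₑ ≤ C * (A : ℝ≥0∞) ^ (2 * timeExp γ ρ) *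
        (mnorm (1 / (1 - timeExp γ ρ)) ρ F * mnorm (1 / (1 - timeExp γ ρ)) ρ G)

/-- The case θ = 0: Cauchy–Schwarz and contractivity bound the kernel by a product, so both time
integrals are L¹ norms. -/
lemma bilinearBound_two (γ : ℝ) : BilinearBound γ 2 1 := by
  intro d I w A U h D hD F G hF hG _ _
  have hθ : timeExp γ 2 = 0 := by simp [timeExp]
  simp only [hθ, mul_zero, ENNReal.rpow_zero, sub_zero, div_one, ENNReal.coe_one, one_mul]
  refine (h.enorm_bform_le hD hF hG).trans ?_
  calc _ ≤ ∫⁻ s, ∫⁻ t, snorm 2 (F s) * snorm 2 (G t) := by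
        refine lintegral_mono fun s => lintegral_mono fun t => (enorm_kernel_le _).trans ?_
        exact mul_le_mul' (h.enorm_evo_le hF s) (h.enorm_evo_le hG t)
    _ = _ := by
        simp_rw [lintegral_const_mul _ (hG.measurable_snorm 2)]
        rw [lintegral_mul_const _ (hF.measurable_snorm 2)]
        simp [mnorm, lnorm]

/-- Interpolation for each fixed pair of times bounds the kernel by a multiple of w(t - s) ^ α with
α = 2θ. For α < 1 the powers of a weak L¹ weight satisfy the hypothesis of the
Hardy–Littlewood–Sobolev inequality. Absolute values are taken throughout, so the restriction to D
costs nothing. -/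
lemma exists_bilinearBound_of_lt {γ ρ : ℝ} (hγ : 0 < γ) (h1 : 1 ≤ ρ) (h2 : ρ < 2)
    (hθ : timeExp γ ρ < 1 / 2) : ∃ C, BilinearBound γ ρ C := by
  set α : ℝ := 2 * timeExp γ ρ with hα
  have hα' : α = γ * (2 / ρ - 1) := by rw [hα, timeExp]; ring
  have hα0 : 0 < α := by
    rw [hα']
    refine mul_pos hγ ?_
    rw [sub_pos, lt_div_iff₀ (by linarith)]; linarith
  have hα1 : α < 1 := by linarith
  obtain ⟨C₁, hC₁⟩ := exists_interpolation h1 h2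
  obtain ⟨C₂, hC₂⟩ := exists_hardyLittlewoodSobolev hα0 hα1
  obtain ⟨C₃, hC₃⟩ := exists_setLIntegral_rpow_le hα0 hα1
  refine ⟨C₁ * (C₂ * C₃), fun d I w A U h D hD F G hF hG hFI hGI => ?_⟩
  have hαp : 1 - timeExp γ ρ = 1 - α / 2 := by rw [hα]; ring
  rw [hαp]
  have hp : 0 < 1 / (1 - α / 2) := one_div_pos.2 (by linarith)
  refine (h.enorm_bform_le hD hF hG).trans ?_
  have hK := hC₂ (fun τ => w τ ^ α) (C₃ * (A : ℝ≥0∞) ^ α) (h.measurable_weight.pow_const _)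
    (fun B => hC₃ w A h.measurable_weight h.pos h.weak B) _ _ (hF.measurable_snorm ρ)
    (hG.measurable_snorm ρ) (hF.mnorm_ne_top hp (by linarith)) (hG.mnorm_ne_top hp (by linarith))
  have hm1 : ∀ s, Measurable fun t => snorm ρ (F s) * snorm ρ (G t) * w (t - s) ^ α := fun s => by
    have := hG.measurable_snorm ρ
    have := h.measurable_weight
    fun_prop
  have hm2 : Measurable fun s => ∫⁻ t, snorm ρ (F s) * snorm ρ (G t) * w (t - s) ^ α := by
    have h1 := hF.measurable_snorm ρ
    have h2 := hG.measurable_snorm ρ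
    have h3 := h.measurable_weight
    have : Measurable fun z : ℝ × ℝ => snorm ρ (F z.1) * snorm ρ (G z.2) * w (z.2 - z.1) ^ α :=
      ((h1.comp measurable_fst).mul (h2.comp measurable_snd)).mul
        ((h3.comp (measurable_snd.sub measurable_fst)).pow_const _)
    exact this.lintegral_prod_right'
  calc _ ≤ ∫⁻ s, ∫⁻ t, C₁ * (snorm ρ (F s) * snorm ρ (G t) * w (t - s) ^ α) := by
        refine lintegral_mono fun s => lintegral_mono fun t => ?_
        by_cases hs : s ∈ I
        swap
        · refine (enorm_kernel_le _).trans ?_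
          rw [evo_eq_zero (hFI s hs)]; simp
        by_cases ht : t ∈ I
        swap
        · refine (enorm_kernel_le _).trans ?_
          rw [evo_eq_zero (hGI t ht)]; simp
        rw [kernel, enorm_indicator_eq_indicator_enorm]
        refine (Set.indicator_le_self _ _ _).trans ?_
        have := hC₁ d (ContinuousLinearMap.adjoint (U s)) (ContinuousLinearMap.adjoint (U t))
          (w (t - s) ^ γ) (h.norm_adjoint_le s) (h.norm_adjoint_le t)
          (fun f g hf hg => h.dispersive s hs t ht f g hf hg) (F s) (G t) (hF.test s) (hG.test t)
        refine this.trans (le_of_eq ?_)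
        rw [← ENNReal.rpow_mul, ← hα']
        ring
    _ = C₁ * ∫⁻ s, ∫⁻ t, snorm ρ (F s) * snorm ρ (G t) * w (t - s) ^ α := by
        rw [← lintegral_const_mul _ hm2]
        congr 1; ext s
        exact lintegral_const_mul _ (hm1 s)
    _ ≤ _ := by
        refine (mul_le_mul_right hK _).trans (le_of_eq ?_)
        rw [mnorm, mnorm]
        push_cast; ring

/-! ### The dual estimate for test functions -/

lemma integral_evo_indicator {S : Set ℝ} (hS : MeasurableSet S) :
    ∫ t, evo U (S.indicator F) t = ∫ t in S, evo U F t := by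
  rw [← integral_indicator hS]
  congr 1; ext1 t
  by_cases ht : t ∈ S
  · simp [evo, ht]
  · rw [Set.indicator_of_notMem ht, evo_eq_zero (Set.indicator_of_notMem ht F)]

/-- The `TT*` identity: without restriction on t - s the form factorises, which turns bilinear
bounds into bounds for the integral itself. -/
lemma Contractive.bform_univ (h : Contractive U) (hF : Nice F) (hG : Nice G) :
    bform U Set.univ F G = inner ℂ (∫ t, evo U F t) (∫ t, evo U G t) := by
  have hi := h.integrable_kernel MeasurableSet.univ hF hG
  rw [bform]
  rw [Measure.volume_eq_prod] at hi ⊢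
  rw [integral_prod _ hi]
  calc ∫ s, ∫ t, kernel U Set.univ F G (s, t)
      = ∫ s, inner ℂ (evo U F s) (∫ t, evo U G t) := by
        congr 1; ext s
        rw [← integral_inner (h.integrable_evo hG)]
        simp only [kernel, Set.indicator_univ]
    _ = _ := by
        rw [← inner_conj_symm, ← integral_inner (h.integrable_evo hF), ← integral_conj]
        simp only [inner_conj_symm]

/-- Duality: the bilinear estimate implies the estimate for `∫ U(t)^* F(t) dt`. -/
lemma BilinearBound.dual {γ ρ : ℝ} {C : ℝ≥0} (hB : BilinearBound γ ρ C) {d : ℕ} {I : Set ℝ}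
    {w : ℝ → ℝ≥0∞} {A : ℝ≥0} {U : ℝ → L2 d →L[ℂ] L2 d} (h : Dispersive γ I w A U)
    {F : ℝ → Space d → ℂ} (hF : Nice F) (hFI : ∀ t, t ∉ I → F t = 0) :
    ‖∫ t, evo U F t‖ₑ ≤ C ^ (1 / 2 : ℝ) * (A : ℝ≥0∞) ^ timeExp γ ρ *
      mnorm (1 / (1 - timeExp γ ρ)) ρ F := by
  have h1 := hB d I w A U h Set.univ MeasurableSet.univ F F hF hF hFI hFI
  rw [h.bform_univ hF hF] at h1
  have h2 : ‖inner ℂ (∫ t, evo U F t) (∫ t, evo U F t)‖ₑ = ‖∫ t, evo U F t‖ₑ ^ (2 : ℝ) := by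
    rw [inner_self_eq_norm_sq_to_K, ← ofReal_norm, ← ofReal_norm,
      ENNReal.ofReal_rpow_of_nonneg (norm_nonneg _) (by norm_num)]
    simp
  rw [h2] at h1
  have h3 := ENNReal.rpow_le_rpow h1 (by norm_num : (0 : ℝ) ≤ 1 / 2)
  rw [← ENNReal.rpow_mul, ENNReal.mul_rpow_of_nonneg _ _ (by norm_num),
    ENNReal.mul_rpow_of_nonneg _ _ (by norm_num), ← ENNReal.rpow_mul, ← sq, ← ENNReal.rpow_natCast,
    ← ENNReal.rpow_mul, show 2 * timeExp γ ρ * (1 / 2) = timeExp γ ρ by ring] at h3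
  norm_num at h3 ⊢
  exact h3

end

section

/-! ### The endpoint bilinear estimate -/

/-- Three linear forms whose positive hull is the plane: one of them is very negative. -/
lemma exists_neg_le_of_linear_forms {y z : ℝ} (hy : 0 < y) (hz : 0 < z) :
    ∃ ε > 0, ∀ u v : ℝ, z * u + z * v ≤ -ε * (|u| + |v|) ∨
      -(y / 2) * u - y * v ≤ -ε * (|u| + |v|) ∨ -y * u - y / 2 * v ≤ -ε * (|u| + |v|) := by
  -- The value solves ε (y / z + 1) = y / 4, the balance required below when u + v is negative but
  -- the first form is not negative enough.
  refine ⟨y * z / (4 * (y + z)), by positivity, fun u v => ?_⟩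
  set ε := y * z / (4 * (y + z)) with hε
  have hε0 : 0 < ε := by positivity
  have hεe : ε * (4 * (y + z)) = y * z := by rw [hε]; field_simp
  have hεy : ε ≤ y / 4 := by
    rw [hε, div_le_div_iff₀ (by positivity) (by norm_num)]; nlinarith
  set m := |u| + |v| with hm
  by_cases h1 : z * u + z * v ≤ -ε * m
  · exact Or.inl h1
  push Not at h1
  have h3 : ∀ D, u - v ≤ D → v - u ≤ D → m ≤ |u + v| + D := by
    intro D hD1 hD2
    rcases abs_cases u with ⟨hu, hu'⟩ | ⟨hu, hu'⟩ <;> rcases abs_cases v with ⟨hv, hv'⟩ | ⟨hv, hv'⟩ <;>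
      rcases abs_cases (u + v) with ⟨hs, hs'⟩ | ⟨hs, hs'⟩ <;> linarith
  right
  -- With S = u + v and δ = u - v the last two forms are -(3y/4) S ± (y/4) δ, so the smaller one is
  -- the left side here. Also |u| + |v| ≤ |S| + |δ|. If S ≥ 0 the bound is direct; if S < 0, failure
  -- of the first alternative makes |S| small compared with |u| + |v|.
  have key : -(3 * y / 4) * (u + v) - y / 4 * |u - v| ≤ -ε * m := by
    have hmD := h3 |u - v| (le_abs_self _) (by rw [abs_sub_comm]; exact le_abs_self _)
    have hm0 : 0 ≤ m := by positivity
    rcases le_or_gt 0 (u + v) with hS | hS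
    · rw [abs_of_nonneg hS] at hmD
      nlinarith [abs_nonneg (u - v)]
    · rw [abs_of_neg hS] at hmD
      have h4 : -z * (u + v) ≤ ε * m := by linarith
      have h5 : y / 4 * m ≤ y / 4 * (-(u + v) + |u - v|) := mul_le_mul_of_nonneg_left hmD (by positivity)
      have h6 : z * (-(3 * y / 4) * (u + v) - y / 4 * |u - v|) ≤ z * (-ε * m) := by
        have h7 : y * (-z * (u + v)) ≤ y * (ε * m) := mul_le_mul_of_nonneg_left h4 hy.le
        have h8 : z * (y / 4 * m) ≤ z * (y / 4 * (-(u + v) + |u - v|)) :=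
          mul_le_mul_of_nonneg_left h5 hz.le
        have h9 : ε * (4 * (y + z)) * m = y * z * m := by rw [hεe]
        nlinarith
      exact le_of_mul_le_mul_left h6 hz
  rcases le_total 0 (u - v) with h | h
  · right
    rw [abs_of_nonneg h] at key
    linarith
  · left
    rw [abs_of_nonpos h] at key
    linarith

variable {d : ℕ} {γ : ℝ} {I : Set ℝ} {w : ℝ → ℝ≥0∞} {A : ℝ≥0} {U : ℝ → L2 d →L[ℂ] L2 d}
  {F G : ℝ → Space d → ℂ} {D : Set ℝ}

lemma lintegral_mul_le_lnorm_two {α : Type*} [MeasurableSpace α] {μ : Measure α} {f g : α → ℝ≥0∞}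
    (hf : Measurable f) (hg : Measurable g) :
    ∫⁻ t, f t * g t ∂μ ≤ lnorm 2 f μ * lnorm 2 g μ :=
  ENNReal.lintegral_mul_le_Lp_mul_Lq μ Real.HolderConjugate.two_two hf.aemeasurable hg.aemeasurable

/-- On D the weight is at most lam, so the kernel is a convolution with the indicator of D. Young's
inequality and Cauchy–Schwarz in time give the factor |D|. -/
lemma Dispersive.enorm_bform_le_of_weight_le (h : Dispersive γ I w A U) (hγ : 0 < γ)
    (hD : MeasurableSet D) (hF : Nice F) (hG : Nice G) (hFI : ∀ t, t ∉ I → F t = 0)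
    (hGI : ∀ t, t ∉ I → G t = 0) {lam : ℝ≥0∞} (hw : ∀ τ ∈ D, w τ ≤ lam) :
    ‖bform U D F G‖ₑ ≤ lam ^ γ * volume D * (mnorm 2 1 F * mnorm 2 1 G) := by
  have hf := hF.measurable_snorm 1
  have hg := hG.measurable_snorm 1
  have hDm : Measurable (D.indicator (1 : ℝ → ℝ≥0∞)) := measurable_one.indicator hD
  refine (h.enorm_bform_le hD hF hG).trans ?_
  have hpt : ∀ s t, ‖kernel U D F G (s, t)‖ₑ
      ≤ lam ^ γ * (snorm 1 (G t) * (D.indicator 1 (t - s) * snorm 1 (F s))) := by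
    intro s t
    by_cases hs : s ∈ I
    swap
    · refine (enorm_kernel_le _).trans ?_
      rw [evo_eq_zero (hFI s hs)]; simp
    by_cases ht : t ∈ I
    swap
    · refine (enorm_kernel_le _).trans ?_
      rw [evo_eq_zero (hGI t ht)]; simp
    by_cases hd : t - s ∈ D
    · rw [kernel, Set.indicator_of_mem hd, Set.indicator_of_mem hd]
      refine (h.dispersive s hs t ht _ _ (hF.test s) (hG.test t)).trans ?_
      refine (mul_le_mul_left (ENNReal.rpow_le_rpow (hw _ hd) hγ.le) _).trans (le_of_eq ?_)
      simp only [Pi.one_apply]; ring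
    · rw [kernel, Set.indicator_of_notMem hd]; simp
  have hm : Measurable (Function.uncurry fun s t => lam ^ γ * (snorm 1 (G t) *
      (D.indicator 1 (t - s) * snorm 1 (F s)))) :=
    ((hg.comp measurable_snd).mul ((hDm.comp (measurable_snd.sub measurable_fst)).mul
      (hf.comp measurable_fst))).const_mul _
  have hm' : ∀ t, Measurable fun s => D.indicator (1 : ℝ → ℝ≥0∞) (t - s) * snorm 1 (F s) :=
    fun t => by fun_prop
  have hm'' : Measurable fun t => ∫⁻ s, D.indicator (1 : ℝ → ℝ≥0∞) (t - s) * snorm 1 (F s) := by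
    have : Measurable fun z : ℝ × ℝ => D.indicator (1 : ℝ → ℝ≥0∞) (z.1 - z.2) * snorm 1 (F z.2) :=
      (hDm.comp (measurable_fst.sub measurable_snd)).mul (hf.comp measurable_snd)
    exact this.lintegral_prod_right'
  calc _ ≤ ∫⁻ s, ∫⁻ t, lam ^ γ * (snorm 1 (G t) * (D.indicator 1 (t - s) * snorm 1 (F s))) :=
        lintegral_mono fun s => lintegral_mono fun t => hpt s t
    _ = ∫⁻ t, lam ^ γ * (snorm 1 (G t) * ∫⁻ s, D.indicator 1 (t - s) * snorm 1 (F s)) := by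
        rw [lintegral_lintegral_swap hm.aemeasurable]
        congr 1; ext t
        rw [lintegral_const_mul _ ((hm' t).const_mul _), lintegral_const_mul _ (hm' t)]
    _ = lam ^ γ * ∫⁻ t, snorm 1 (G t) * ∫⁻ s, D.indicator 1 (t - s) * snorm 1 (F s) :=
        lintegral_const_mul _ (hg.mul hm'')
    _ ≤ lam ^ γ * (mnorm 2 1 G * (volume D * mnorm 2 1 F)) := by
        refine mul_le_mul_right ((lintegral_mul_le_lnorm_two hg hm'').trans
          (mul_le_mul_right ?_ _)) _
        refine (ENNReal.rpow_le_rpow (lintegral_convolution_indicator_rpow_le (by norm_num) hD hf)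
          (by norm_num)).trans (le_of_eq ?_)
        rw [ENNReal.mul_rpow_of_nonneg _ _ (by norm_num), ← ENNReal.rpow_mul, mnorm, lnorm]
        norm_num
    _ = _ := by ring

/-- Fubini exhibits the form as G tested against the integral of F over the times s with t - s ∈ D.
Bounds for that inner integral, or for the form, can thus be traded for each other. -/
lemma Contractive.bform_eq_integral (h : Contractive U) (hD : MeasurableSet D)
    (hF : Nice F) (hG : Nice G) :
    bform U D F G = ∫ t, inner ℂ (∫ s in (fun s => t - s) ⁻¹' D, evo U F s) (evo U G t) := by
  have hi := h.integrable_kernel hD hF hG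
  rw [bform]
  rw [Measure.volume_eq_prod] at hi ⊢
  rw [integral_prod_symm _ hi]
  congr 1; ext t
  rw [← inner_conj_symm, ← integral_inner (h.integrable_evo hF).integrableOn, ← integral_conj,
    ← integral_indicator (hD.preimage (by fun_prop))]
  congr 1; ext s
  by_cases hs : t - s ∈ D
  · rw [kernel, Set.indicator_of_mem hs, Set.indicator_of_mem (by exact hs), inner_conj_symm]
  · rw [kernel, Set.indicator_of_notMem hs, Set.indicator_of_notMem (by exact hs)]

lemma kernel_swap (z : ℝ × ℝ) :
    kernel U D F G z.swap = (starRingEnd ℂ) (kernel U (Neg.neg ⁻¹' D) G F z) := by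
  rw [kernel, kernel]
  by_cases h : z.1 - z.2 ∈ D
  · rw [Set.indicator_of_mem (by exact h), Set.indicator_of_mem (by
      rw [Set.mem_preimage, neg_sub]; exact h), inner_conj_symm]
    rfl
  · rw [Set.indicator_of_notMem (by exact h), Set.indicator_of_notMem (by
      rw [Set.mem_preimage, neg_sub]; exact h), map_zero]

/-- Transposition reflects D, and the class of measurable sets is stable under this; estimates
proved with F in the distinguished role therefore hold for G too. -/
lemma bform_swap : bform U D F G = (starRingEnd ℂ) (bform U (Neg.neg ⁻¹' D) G F) := by
  rw [bform, bform, ← integral_conj]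
  simp_rw [← kernel_swap]
  rw [Measure.volume_eq_prod]
  exact (integral_prod_swap (μ := (volume : Measure ℝ)) (ν := (volume : Measure ℝ))
    (kernel U D F G)).symm

lemma enorm_bform_swap : ‖bform U D F G‖ₑ = ‖bform U (Neg.neg ⁻¹' D) G F‖ₑ := by
  rw [bform_swap, ← ofReal_norm, ← ofReal_norm, RCLike.norm_conj]

/-- The form is controlled by a non-endpoint estimate in one variable and the energy estimate in
the other one. -/
lemma BilinearBound.enorm_bform_le_mixed {σ : ℝ} {C : ℝ≥0} (hB : BilinearBound γ σ C)
    (hσ : 0 < σ) (hσ' : timeExp γ σ = 1 / 4) (h : Dispersive γ I w A U)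
    (hD : MeasurableSet D) (hF : Nice F) (hG : Nice G) (hFI : ∀ t, t ∉ I → F t = 0) :
    ‖bform U D F G‖ₑ ≤ C ^ (1 / 2 : ℝ) * (A : ℝ≥0∞) ^ (1 / 4 : ℝ) * volume D ^ (3 / 4 : ℝ) *
      (mnorm 2 σ F * mnorm 2 2 G) := by
  have hf := hF.measurable_snorm σ
  have hg := hG.measurable_snorm 2
  have hDm : Measurable (D.indicator (1 : ℝ → ℝ≥0∞)) := measurable_one.indicator hD
  -- At θ = 1/4 the dual time exponent is 4/3, which is less than 2. The gap is what makes Young's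
  -- inequality with the indicator of D available below.
  have hp : (1 / (1 - timeExp γ σ)) = 4 / 3 := by rw [hσ']; norm_num
  set J : ℝ → ℝ≥0∞ := fun t => ∫⁻ s, D.indicator 1 (t - s) * snorm σ (F s) ^ (4 / 3 : ℝ) with hJ
  have hJm : Measurable J := by
    have : Measurable fun z : ℝ × ℝ => D.indicator (1 : ℝ → ℝ≥0∞) (z.1 - z.2) *
        snorm σ (F z.2) ^ (4 / 3 : ℝ) :=
      (hDm.comp (measurable_fst.sub measurable_snd)).mul ((hf.pow_const _).comp measurable_snd)
    exact this.lintegral_prod_right'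
  have hdual : ∀ t, ‖∫ s in (fun s => t - s) ⁻¹' D, evo U F s‖ₑ
      ≤ C ^ (1 / 2 : ℝ) * (A : ℝ≥0∞) ^ (1 / 4 : ℝ) * J t ^ (3 / 4 : ℝ) := by
    intro t
    have hS : MeasurableSet ((fun s => t - s) ⁻¹' D) := hD.preimage (by fun_prop)
    have := hB.dual h (hF.indicator hS) (fun s hs => by
      by_cases h' : s ∈ (fun s => t - s) ⁻¹' D
      · rw [Set.indicator_of_mem h', hFI s hs]
      · rw [Set.indicator_of_notMem h'])
    rw [integral_evo_indicator hS, hσ'] at this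
    refine this.trans (le_of_eq ?_)
    rw [← hσ', hp, mnorm, lnorm, hJ]
    congr 1
    rw [show (1 : ℝ) / (4 / 3) = 3 / 4 by norm_num]
    congr 2; ext s
    by_cases hs : t - s ∈ D
    · rw [Set.indicator_of_mem (by exact hs), Set.indicator_of_mem hs]; simp
    · rw [Set.indicator_of_notMem (by exact hs), Set.indicator_of_notMem hs]
      simp [snorm, lnorm, hσ, ENNReal.zero_rpow_of_pos]
  rw [h.bform_eq_integral hD hF hG]
  refine (enorm_integral_le_lintegral_enorm _).trans ?_
  calc _ ≤ ∫⁻ t, C ^ (1 / 2 : ℝ) * (A : ℝ≥0∞) ^ (1 / 4 : ℝ) * (J t ^ (3 / 4 : ℝ) * snorm 2 (G t)) := by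
        refine lintegral_mono fun t => (enorm_inner_le _ _).trans ?_
        rw [← mul_assoc]
        exact mul_le_mul' (hdual t) (h.enorm_evo_le hG t)
    _ = C ^ (1 / 2 : ℝ) * (A : ℝ≥0∞) ^ (1 / 4 : ℝ) * ∫⁻ t, J t ^ (3 / 4 : ℝ) * snorm 2 (G t) :=
        lintegral_const_mul _ ((hJm.pow_const _).mul hg)
    _ ≤ C ^ (1 / 2 : ℝ) * (A : ℝ≥0∞) ^ (1 / 4 : ℝ) *
          ((volume D ^ (3 / 4 : ℝ) * mnorm 2 σ F) * mnorm 2 2 G) := by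
        refine mul_le_mul_right ((lintegral_mul_le_lnorm_two (hJm.pow_const _) hg).trans
          (mul_le_mul_left ?_ _)) _
        have he : ∀ s, (snorm σ (F s) ^ (4 / 3 : ℝ)) ^ (3 / 2 : ℝ) = snorm σ (F s) ^ (2 : ℝ) := fun s => by
          rw [← ENNReal.rpow_mul]; norm_num
        -- The L² norm of J ^ (3/4) is a power of the L^{3/2} norm of J, and J is the convolution of
        -- the indicator of D with the 4/3 power of the L^σ norm. Young in L^{3/2} returns the L²
        -- norm in time and the factor |D| ^ (3/4).
        have hY : ∫⁻ t, J t ^ (3 / 2 : ℝ) ≤ volume D ^ (3 / 2 : ℝ) * ∫⁻ s, snorm σ (F s) ^ (2 : ℝ) := by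
          rw [← lintegral_congr he]
          exact lintegral_convolution_indicator_rpow_le (by norm_num) hD (hf.pow_const (4 / 3))
        rw [lnorm]
        have he2 : ∀ t, (J t ^ (3 / 4 : ℝ)) ^ (2 : ℝ) = J t ^ (3 / 2 : ℝ) := fun t => by
          rw [← ENNReal.rpow_mul]; norm_num
        rw [show (∫⁻ t, (J t ^ (3 / 4 : ℝ)) ^ (2 : ℝ)) = ∫⁻ t, J t ^ (3 / 2 : ℝ) from
          lintegral_congr he2]
        refine (ENNReal.rpow_le_rpow hY (by norm_num)).trans (le_of_eq ?_)
        rw [ENNReal.mul_rpow_of_nonneg _ _ (by norm_num), ← ENNReal.rpow_mul, mnorm, lnorm]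
        norm_num
    _ = _ := by ring

/-! #### Passing to layers -/

lemma Nice.tendsto_evo_partialLayers (hF : Nice F) {ρ : ℝ} (hρ : 0 < ρ) (t : ℝ) :
    Filter.Tendsto (fun n => evo U (fun t => partialLayers ρ (F t) n) t) Filter.atTop
      (nhds (evo U F t)) :=
  ((ContinuousLinearMap.adjoint (U t)).continuous.tendsto _).comp
    ((hF.test t).tendsto_toL2_partialLayers hρ)

lemma evo_partialLayers (hF : Nice F) (ρ : ℝ) (n : ℕ) (t : ℝ) :
    evo U (fun t => partialLayers ρ (F t) n) t
      = ∑ k ∈ Finset.Icc (-(n : ℤ)) n, evo U (fun t => cutLayer ρ (F t) k) t := by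
  simp only [evo, partialLayers]
  rw [toL2_sum fun k => (hF.test t).cutLayer ρ k, map_sum]

lemma Nice.integrable_toL2 (hF : Nice F) : Integrable fun t => toL2 (F t) := by
  refine ⟨(stronglyMeasurable_toL2 hF.measurable
    fun t => (hF.test t).memLp 2).aestronglyMeasurable, ?_⟩
  have h := hF.mnorm_ne_top one_pos two_pos
  refine lt_of_le_of_lt (lintegral_mono fun t => ((hF.test t).enorm_toL2).le) ?_
  simpa [mnorm, lnorm, lt_top_iff_ne_top] using h

/-- The form is dominated by the sum of its values on the layers. -/
lemma Dispersive.enorm_bform_le_tsum (h : Dispersive γ I w A U) (hD : MeasurableSet D)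
    (hF : Nice F) (hG : Nice G) {ρ : ℝ} (hρ : 0 < ρ) :
    ‖bform U D F G‖ₑ ≤ ∑' k, ∑' l,
      ‖bform U D (fun t => cutLayer ρ (F t) k) (fun t => cutLayer ρ (G t) l)‖ₑ := by
  set Fn : ℕ → ℝ → Space d → ℂ := fun n t => partialLayers ρ (F t) n
  set Gn : ℕ → ℝ → Space d → ℂ := fun n t => partialLayers ρ (G t) n
  have hk : ∀ n z, kernel U D (Fn n) (Gn n) z = ∑ k ∈ Finset.Icc (-(n : ℤ)) n,
      ∑ l ∈ Finset.Icc (-(n : ℤ)) n,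
        kernel U D (fun t => cutLayer ρ (F t) k) (fun t => cutLayer ρ (G t) l) z := by
    intro n z
    simp only [kernel]
    by_cases hz : z.2 - z.1 ∈ D
    · simp only [Set.indicator_of_mem hz]
      rw [evo_partialLayers hF, evo_partialLayers hG, sum_inner]
      simp_rw [inner_sum]
    · simp only [Set.indicator_of_notMem hz, Finset.sum_const_zero]
  have hkl : ∀ k l, Integrable
      (kernel U D (fun t => cutLayer ρ (F t) k) (fun t => cutLayer ρ (G t) l)) :=
    fun k l => h.integrable_kernel hD (hF.cutLayer ρ k) (hG.cutLayer ρ l)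
  have hb : ∀ n, bform U D (Fn n) (Gn n) = ∑ k ∈ Finset.Icc (-(n : ℤ)) n,
      ∑ l ∈ Finset.Icc (-(n : ℤ)) n,
        bform U D (fun t => cutLayer ρ (F t) k) (fun t => cutLayer ρ (G t) l) := by
    intro n
    rw [bform, integral_congr_ae (Filter.Eventually.of_forall (hk n))]
    rw [integral_finsetSum _ fun k _ => integrable_finsetSum _ fun l _ => hkl k l]
    refine Finset.sum_congr rfl fun k _ => ?_
    rw [integral_finsetSum _ fun l _ => hkl k l]
    rfl
  have hnorm : ∀ (F : ℝ → Space d → ℂ), Nice F → ∀ n t,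
      ‖evo U (fun t => partialLayers ρ (F t) n) t‖ ≤ ‖toL2 (F t)‖ := by
    intro F hF n t
    refine (h.norm_adjoint_le t _).trans (enorm_le_iff_norm_le.1 ?_)
    rw [((hF.test t).partialLayers ρ n).enorm_toL2, (hF.test t).enorm_toL2, snorm_two, snorm_two]
    exact eLpNorm_mono fun x => norm_partialLayers_le ρ (F t) n x
  have hlim : Filter.Tendsto (fun n => bform U D (Fn n) (Gn n)) Filter.atTop
      (nhds (bform U D F G)) := by
    refine tendsto_integral_of_dominated_convergence
      (fun z : ℝ × ℝ => ‖toL2 (F z.1)‖ * ‖toL2 (G z.2)‖) (fun n => ?_) ?_ (fun n => ?_) ?_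
    · rw [funext (hk n)]
      exact (integrable_finsetSum _ fun k _ =>
        integrable_finsetSum _ fun l _ => hkl k l).aestronglyMeasurable
    · exact hF.integrable_toL2.norm.mul_prod hG.integrable_toL2.norm
    · refine Filter.Eventually.of_forall fun z => (norm_kernel_le z).trans ?_
      exact mul_le_mul (hnorm F hF n _) (hnorm G hG n _) (norm_nonneg _) (norm_nonneg _)
    · refine Filter.Eventually.of_forall fun z => ?_
      simp only [kernel]
      by_cases hz : z.2 - z.1 ∈ D
      · simp only [Set.indicator_of_mem hz]
        exact (hF.tendsto_evo_partialLayers hρ _).inner (hG.tendsto_evo_partialLayers hρ _)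
      · simp only [Set.indicator_of_notMem hz]
        exact tendsto_const_nhds
  refine le_of_tendsto' hlim.enorm fun n => ?_
  rw [hb n]
  refine ((enorm_sum_le _ _).trans (Finset.sum_le_sum fun k _ => enorm_sum_le _ _)).trans ?_
  refine le_trans (Finset.sum_le_sum fun k _ => ?_) (ENNReal.sum_le_tsum _)
  exact ENNReal.sum_le_tsum _

/-- The `L²` norm in time of the mass of a layer. -/
def layerNorm (ρ : ℝ) (F : ℝ → Space d → ℂ) (k : ℤ) : ℝ≥0∞ :=
  lnorm 2 (fun t => snorm ρ (F t) * layerMass ρ (fun x => ‖F t x‖ₑ) volume k ^ (1 / 2 : ℝ)) volume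

lemma Nice.measurable_layerMass (hF : Nice F) {ρ : ℝ} (hρ : 0 < ρ) (k : ℤ) :
    Measurable fun t => layerMass ρ (fun x => ‖F t x‖ₑ) volume k := by
  have he : ∀ t, layerMass ρ (fun x => ‖F t x‖ₑ) volume k
      = snorm ρ (Strichartz.cutLayer ρ (F t) k) ^ ρ / snorm ρ (F t) ^ ρ := by
    intro t
    have h1 : snorm ρ (Strichartz.cutLayer ρ (F t) k) ^ ρ
        = ∫⁻ x, ‖Strichartz.cutLayer ρ (F t) k x‖ₑ ^ ρ := lnorm_rpow hρ _
    rw [layerMass, h1,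
      ← lintegral_indicator (measurableSet_layer (hF.test t).measurable.enorm k)]
    congr 1
    refine lintegral_congr fun x => ?_
    rw [Strichartz.cutLayer]
    by_cases hx : x ∈ layer ρ (fun x => ‖F t x‖ₑ) volume k
    · simp only [Set.indicator_of_mem hx]
    · simp [Set.indicator_of_notMem hx, hρ]
  simp_rw [he]
  exact (((hF.cutLayer ρ k).measurable_snorm ρ).pow_const _).div
    ((hF.measurable_snorm ρ).pow_const _)

lemma Nice.mnorm_cutLayer_le (hF : Nice F) {ρ m : ℝ} (hρ : 1 ≤ ρ) (hm : 1 ≤ m) (hm2 : m ≤ 2)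
    (k : ℤ) : mnorm 2 m (fun t => Strichartz.cutLayer ρ (F t) k)
      ≤ 2 * 2 ^ (k * (1 - ρ / m)) * layerNorm ρ F k := by
  have hmeas : Measurable fun t => snorm ρ (F t) *
      layerMass ρ (fun x => ‖F t x‖ₑ) volume k ^ (1 / 2 : ℝ) :=
    (hF.measurable_snorm ρ).mul ((hF.measurable_layerMass (by linarith) k).pow_const _)
  rw [mnorm, layerNorm, lnorm, lnorm]
  calc _ ≤ (∫⁻ t, (2 * 2 ^ (k * (1 - ρ / m)) * (snorm ρ (F t) *
        layerMass ρ (fun x => ‖F t x‖ₑ) volume k ^ (1 / 2 : ℝ))) ^ (2 : ℝ)) ^ (1 / 2 : ℝ) := by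
        refine ENNReal.rpow_le_rpow (lintegral_mono fun t => ENNReal.rpow_le_rpow
          ((hF.test t).snorm_cutLayer_le hρ hm hm2 k) (by norm_num)) (by norm_num)
    _ = _ := by
        simp_rw [ENNReal.mul_rpow_of_nonneg (2 * 2 ^ (k * (1 - ρ / m)) : ℝ≥0∞) _
          (by norm_num : (0 : ℝ) ≤ 2)]
        rw [lintegral_const_mul _ (hmeas.pow_const _), ENNReal.mul_rpow_of_nonneg _ _ (by norm_num),
          ← ENNReal.rpow_mul]
        norm_num

/-- The square root of the mass, squared, sums over k to at most 1 at each time. Exchanging the sum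
with the L² norm in time is possible because the time exponent is exactly 2, as at the endpoint. -/
lemma Nice.tsum_layerNorm_le (hF : Nice F) {ρ : ℝ} (hρ : 0 < ρ) :
    ∑' k, layerNorm ρ F k ^ (2 : ℝ) ≤ mnorm 2 ρ F ^ (2 : ℝ) := by
  simp_rw [layerNorm, mnorm, lnorm_rpow two_pos]
  have he : ∀ (k : ℤ) (t : ℝ), (snorm ρ (F t) * layerMass ρ (fun x => ‖F t x‖ₑ) volume k ^ (1 / 2 : ℝ))
      ^ (2 : ℝ) = snorm ρ (F t) ^ (2 : ℝ) * layerMass ρ (fun x => ‖F t x‖ₑ) volume k := by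
    intro k t
    rw [ENNReal.mul_rpow_of_nonneg _ _ (by norm_num), ← ENNReal.rpow_mul]
    norm_num
  simp_rw [he]
  have hm : ∀ k : ℤ, Measurable fun t => snorm ρ (F t) ^ (2 : ℝ) *
      layerMass ρ (fun x => ‖F t x‖ₑ) volume k := fun k =>
    ((hF.measurable_snorm ρ).pow_const _).mul (hF.measurable_layerMass hρ k)
  rw [← lintegral_tsum fun k => (hm k).aemeasurable]
  refine lintegral_mono fun t => ?_
  rw [ENNReal.tsum_mul_left]
  exact mul_le_of_le_one_right zero_le (tsum_layerMass_le hρ (hF.test t).measurable.enorm)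

end

/-! ### Level sets of the weight and summation at the endpoint -/

section

variable {d : ℕ} {γ : ℝ} {I : Set ℝ} {w : ℝ → ℝ≥0∞} {A : ℝ≥0} {U : ℝ → L2 d →L[ℂ] L2 d}
  {F G : ℝ → Space d → ℂ} {D : Set ℝ}

/-- The dyadic level sets of the weight. -/
def levelSet (w : ℝ → ℝ≥0∞) (j : ℤ) : Set ℝ := {τ | 2 ^ (j : ℝ) < w τ ∧ w τ ≤ 2 ^ ((j : ℝ) + 1)}

lemma measurableSet_levelSet (hw : Measurable w) (j : ℤ) : MeasurableSet (levelSet w j) :=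
  (measurableSet_lt measurable_const hw).inter (measurableSet_le hw measurable_const)

lemma WeakBound.volume_levelSet_le (h : WeakBound w A) (j : ℤ) :
    volume (levelSet w j) ≤ A * 2 ^ (-(j : ℝ)) := by
  rw [ENNReal.rpow_neg]
  exact (measure_mono fun τ hτ => hτ.1).trans (h.measure_le (two_rpow_ne_zero _) (two_rpow_ne_top _))

lemma disjoint_levelSet (w : ℝ → ℝ≥0∞) : Pairwise (Function.onFun Disjoint (levelSet w)) := by
  have key : ∀ k l : ℤ, k < l → Disjoint (levelSet w k) (levelSet w l) := by
    intro k l hkl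
    refine Set.disjoint_left.2 fun x hx hx' => ?_
    refine absurd (hx'.1.trans_le (hx.2.trans (two_rpow_le ?_))) (lt_irrefl _)
    exact_mod_cast hkl
  intro k l hkl
  rcases lt_or_gt_of_ne hkl with h | h
  · exact key k l h
  · exact (key l k h).symm

lemma exists_mem_levelSet {τ : ℝ} (h0 : w τ ≠ 0) (h1 : w τ ≠ ⊤) : ∃ j, τ ∈ levelSet w j := by
  obtain ⟨j, hj1, hj2⟩ := ENNReal.exists_mem_Ioc_zpow (x := w τ) (y := 2) h0 h1 (by norm_num)
    (by norm_num)
  refine ⟨j, ?_, ?_⟩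
  · rwa [ENNReal.rpow_intCast]
  · have : ((j : ℝ) + 1) = ((j + 1 : ℤ) : ℝ) := by push_cast; ring
    rwa [this, ENNReal.rpow_intCast]

/-- The form is the sum of its restrictions to the level sets of the weight. -/
lemma Dispersive.enorm_bform_le_tsum_levelSet (h : Dispersive γ I w A U) (hγ : 0 < γ)
    (hD : MeasurableSet D) (hF : Nice F) (hG : Nice G) (hFI : ∀ t, t ∉ I → F t = 0)
    (hGI : ∀ t, t ∉ I → G t = 0) :
    ‖bform U D F G‖ₑ ≤ ∑' j, ‖bform U (D ∩ levelSet w j) F G‖ₑ := by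
  have hSm : ∀ j, MeasurableSet {z : ℝ × ℝ | z.2 - z.1 ∈ levelSet w j} := fun j =>
    (measurableSet_levelSet h.measurable_weight j).preimage (measurable_snd.sub measurable_fst)
  set S : Set (ℝ × ℝ) := ⋃ j, {z : ℝ × ℝ | z.2 - z.1 ∈ levelSet w j} with hS
  have hi := h.integrable_kernel hD hF hG
  -- The level sets miss only w = 0 and w = ∞. The latter is null because w is weakly integrable,
  -- and stays null for w(t - s) on the plane by translation invariance.
  have hnull : ∀ᵐ z : ℝ × ℝ, w (z.2 - z.1) ≠ ⊤ := by
    have hms : MeasurableSet {z : ℝ × ℝ | w (z.2 - z.1) ≠ ⊤} :=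
      (h.measurable_weight.comp (measurable_snd.sub measurable_fst)) (measurableSet_singleton ⊤).compl
    rw [Measure.volume_eq_prod, Measure.ae_prod_iff_ae_ae hms]
    refine Filter.Eventually.of_forall fun s => ?_
    have h1 : ∀ᵐ τ : ℝ, w τ ≠ ⊤ := by
      filter_upwards [h.weak.ae_lt_top] with τ hτ using hτ.ne
    exact (measurePreserving_sub_right volume s).quasiMeasurePreserving.ae h1
  have hz : ∀ᵐ z : ℝ × ℝ, z ∉ S → kernel U D F G z = 0 := by
    filter_upwards [hnull] with z hz hzS
    -- Where the weight vanishes, the dispersive estimate with γ > 0 forces the kernel to vanish.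
    have hw0 : w (z.2 - z.1) = 0 := by
      by_contra h0
      obtain ⟨j, hj⟩ := exists_mem_levelSet h0 hz
      exact hzS (Set.mem_iUnion.2 ⟨j, hj⟩)
    have : ‖kernel U D F G z‖ₑ ≤ 0 := by
      by_cases hs : z.1 ∈ I
      swap
      · refine (enorm_kernel_le _).trans ?_
        rw [evo_eq_zero (hFI _ hs)]; simp
      by_cases ht : z.2 ∈ I
      swap
      · refine (enorm_kernel_le _).trans ?_
        rw [evo_eq_zero (hGI _ ht)]; simp
      rw [kernel, enorm_indicator_eq_indicator_enorm]
      refine (Set.indicator_le_self _ _ _).trans ?_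
      refine (h.dispersive _ hs _ ht _ _ (hF.test _) (hG.test _)).trans ?_
      rw [hw0, ENNReal.zero_rpow_of_pos hγ, zero_mul]
    simpa using this
  have h1 : bform U D F G = ∫ z in S, kernel U D F G z :=
    (setIntegral_eq_integral_of_ae_compl_eq_zero hz).symm
  have h2 := hasSum_integral_iUnion (f := kernel U D F G) (μ := volume) hSm (by
    intro i j hij
    exact Set.disjoint_left.2 fun z hz hz' => Set.disjoint_left.1 (disjoint_levelSet w hij) hz hz')
    hi.integrableOn
  have h3 : ∀ j, ∫ z in {z : ℝ × ℝ | z.2 - z.1 ∈ levelSet w j}, kernel U D F G z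
      = bform U (D ∩ levelSet w j) F G := by
    intro j
    rw [← integral_indicator (hSm j), bform]
    congr 1; ext z
    by_cases hz : z.2 - z.1 ∈ levelSet w j
    · rw [Set.indicator_of_mem (by exact hz), kernel, kernel]
      by_cases hzD : z.2 - z.1 ∈ D
      · rw [Set.indicator_of_mem hzD, Set.indicator_of_mem (Set.mem_inter hzD hz)]
      · rw [Set.indicator_of_notMem hzD, Set.indicator_of_notMem fun h => hzD h.1]
    · rw [Set.indicator_of_notMem (by exact hz), kernel, Set.indicator_of_notMem fun h => hz h.2]
  rw [h1, ← h2.tsum_eq]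
  simp_rw [h3]
  exact enorm_tsum_le_tsum_enorm

lemma ENNReal_mul_le_sq_add_sq (a b : ℝ≥0∞) : a * b ≤ a ^ (2 : ℝ) + b ^ (2 : ℝ) := by
  rcases le_total a b with h | h
  · calc a * b ≤ b * b := mul_le_mul_left h _
      _ = b ^ (2 : ℝ) := by rw [← sq, ← ENNReal.rpow_natCast]; norm_num
      _ ≤ _ := le_add_self
  · calc a * b ≤ a * a := mul_le_mul_right h _
      _ = a ^ (2 : ℝ) := by rw [← sq, ← ENNReal.rpow_natCast]; norm_num
      _ ≤ _ := le_self_add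

/-- A square summable family relative to its norm. -/
lemma exists_normalized {ι : Type*} {φ : ι → ℝ≥0∞} {P : ℝ≥0∞} (hP : P ≠ ⊤)
    (h : ∑' k, φ k ^ (2 : ℝ) ≤ P ^ (2 : ℝ)) :
    ∃ c : ι → ℝ≥0∞, ∑' k, c k ^ (2 : ℝ) ≤ 1 ∧ ∀ k, φ k ≤ P * c k := by
  rcases eq_or_ne P 0 with h0 | h0
  · refine ⟨0, by simp, fun k => ?_⟩
    rw [h0] at h ⊢
    have := (ENNReal.le_tsum k).trans h
    simp at this
    simp [this]
  · refine ⟨fun k => φ k / P, ?_, fun k => (ENNReal.mul_div_cancel h0 hP).ge⟩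
    simp_rw [ENNReal.div_rpow_of_nonneg _ _ (by norm_num : (0 : ℝ) ≤ 2), div_eq_mul_inv]
    rw [ENNReal.tsum_mul_right, ← div_eq_mul_inv]
    exact (ENNReal.div_le_div_right h _).trans ENNReal.div_self_le_one

/-- The three estimates for the form on a pair of layers and a level set of the weight. -/
lemma Dispersive.enorm_bform_layers_le {ρ σ : ℝ} {C : ℝ≥0} (hγ : 1 < γ)
    (hρ : 1 / ρ = 1 / 2 + 1 / (2 * γ)) (hσ : 1 / σ = 1 / 2 + 1 / (4 * γ)) (hρ1 : 1 ≤ ρ)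
    (hσ1 : 1 ≤ σ) (hσ2 : σ ≤ 2) (hB : BilinearBound γ σ C) (h : Dispersive γ I w A U)
    (hD : MeasurableSet D) (hF : Nice F) (hG : Nice G) (hFI : ∀ t, t ∉ I → F t = 0)
    (hGI : ∀ t, t ∉ I → G t = 0) {ε : ℝ}
    (hε : ∀ u v : ℝ, (1 / 2 - 1 / (2 * γ)) * u + (1 / 2 - 1 / (2 * γ)) * v ≤ -ε * (|u| + |v|) ∨
      -(1 / (2 * γ) / 2) * u - 1 / (2 * γ) * v ≤ -ε * (|u| + |v|) ∨
      -(1 / (2 * γ)) * u - 1 / (2 * γ) / 2 * v ≤ -ε * (|u| + |v|)) (j k l : ℤ) :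
    ‖bform U (D ∩ levelSet w j) (fun t => cutLayer ρ (F t) k) (fun t => cutLayer ρ (G t) l)‖ₑ
      ≤ 4 * (2 ^ γ + (C : ℝ≥0∞) ^ (1 / 2 : ℝ)) * A *
        (2 ^ (-ε * (|γ * j - ρ * k| + |γ * j - ρ * l|)) * (layerNorm ρ F k * layerNorm ρ G l)) := by
  have hγ0 : 0 < γ := by linarith
  have hρ0 : ρ ≠ 0 := by linarith
  have hσ0 : σ ≠ 0 := by linarith
  have hσ' : timeExp γ σ = 1 / 4 := by rw [timeExp, hσ]; field_simp; ring
  have hA0 : (A : ℝ≥0∞) ≠ 0 := by simpa using h.pos.ne'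
  have hFk := hF.cutLayer ρ k
  have hGl := hG.cutLayer ρ l
  have hFkI : ∀ t, t ∉ I → cutLayer ρ (F t) k = 0 := fun t ht => by
    rw [cutLayer, hFI t ht, Set.indicator_zero']
  have hGlI : ∀ t, t ∉ I → cutLayer ρ (G t) l = 0 := fun t ht => by
    rw [cutLayer, hGI t ht, Set.indicator_zero']
  have hE := hD.inter (measurableSet_levelSet h.measurable_weight j)
  have hv : volume (D ∩ levelSet w j) ≤ A * 2 ^ (-(j : ℝ)) :=
    (measure_mono Set.inter_subset_right).trans (h.weak.volume_levelSet_le j)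
  have hv34 : volume (D ∩ levelSet w j) ^ (3 / 4 : ℝ) ≤ A ^ (3 / 4 : ℝ) * 2 ^ (-(3 / 4) * (j : ℝ)) := by
    refine (ENNReal.rpow_le_rpow hv (by norm_num)).trans (le_of_eq ?_)
    rw [ENNReal.mul_rpow_of_nonneg _ _ (by norm_num), ← ENNReal.rpow_mul]
    ring_nf
  have hA34 : (A : ℝ≥0∞) ^ (1 / 4 : ℝ) * A ^ (3 / 4 : ℝ) = A := by
    rw [← ENNReal.rpow_add _ _ hA0 (by simp)]; norm_num
  have hFm := fun {m : ℝ} (h1 : 1 ≤ m) (h2 : m ≤ 2) => hF.mnorm_cutLayer_le hρ1 h1 h2 k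
  have hGm := fun {m : ℝ} (h1 : 1 ≤ m) (h2 : m ≤ 2) => hG.mnorm_cutLayer_le hρ1 h1 h2 l
  set φ := layerNorm ρ F k
  set ψ := layerNorm ρ G l
  have hy : 1 - ρ / 2 = ρ * (1 / (2 * γ)) := by
    have : ρ * (1 / ρ) = 1 := by field_simp
    rw [hρ] at this; linarith
  have hz : ρ - 1 = ρ * (1 / 2 - 1 / (2 * γ)) := by
    have : ρ * (1 / ρ) = 1 := by field_simp
    rw [hρ] at this; linarith
  have hx : 1 - ρ / σ = ρ * (1 / (2 * γ) / 2) := by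
    have h1 : ρ * (1 / ρ) = 1 := by field_simp
    have h2 : ρ / σ = ρ * (1 / σ) := by ring
    rw [hρ] at h1
    rw [h2, hσ, show 1 / (4 * γ) = 1 / (2 * γ) / 2 by field_simp; norm_num]; linarith
  have hγy : γ * (1 / (2 * γ)) = 1 / 2 := by field_simp
  have hfin : ∀ (B : ℝ≥0∞) (e : ℝ), B ≤ 2 ^ γ + (C : ℝ≥0∞) ^ (1 / 2 : ℝ) →
      e ≤ -ε * (|γ * j - ρ * k| + |γ * j - ρ * l|) →
      4 * B * A * (2 ^ e * (φ * ψ)) ≤ 4 * (2 ^ γ + (C : ℝ≥0∞) ^ (1 / 2 : ℝ)) * A *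
        (2 ^ (-ε * (|γ * j - ρ * k| + |γ * j - ρ * l|)) * (φ * ψ)) := by
    intro B e hB he
    exact mul_le_mul' (mul_le_mul_left (mul_le_mul_right hB _) _)
      (mul_le_mul_left (two_rpow_le he) _)
  -- In u = γj - ρk and v = γj - ρl the three available bounds have precisely the three linear forms
  -- as exponents: the dispersive bound in L¹ × L¹, then the mixed bound with F, and with G, in the
  -- non-endpoint role. The most favourable one is used.
  rcases hε (γ * j - ρ * k) (γ * j - ρ * l) with he | he | he
  · refine le_trans ?_ (hfin (2 ^ γ) _ le_self_add he)
    have h1 := h.enorm_bform_le_of_weight_le hγ0 hE hFk hGl hFkI hGlI (fun τ hτ => hτ.2.2)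
    refine h1.trans ?_
    calc _ ≤ ((2 : ℝ≥0∞) ^ ((j : ℝ) + 1)) ^ γ * (A * 2 ^ (-(j : ℝ))) *
          ((2 * 2 ^ (k * (1 - ρ / 1)) * φ) * (2 * 2 ^ (l * (1 - ρ / 1)) * ψ)) := by
          gcongr
          · exact hFm le_rfl (by norm_num)
          · exact hGm le_rfl (by norm_num)
      _ = 4 * A * (2 ^ (((j : ℝ) + 1) * γ) * 2 ^ (-(j : ℝ)) * 2 ^ (k * (1 - ρ / 1)) *
          2 ^ (l * (1 - ρ / 1)) * (φ * ψ)) := by rw [← ENNReal.rpow_mul]; ring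
      _ = 4 * A * (2 ^ γ * 2 ^ ((1 / 2 - 1 / (2 * γ)) * (γ * j - ρ * k) +
          (1 / 2 - 1 / (2 * γ)) * (γ * j - ρ * l)) * (φ * ψ)) := by
          rw [← two_rpow_add, ← two_rpow_add, ← two_rpow_add, ← two_rpow_add]
          congr 3
          linear_combination (-(k : ℝ) - l) * hz + 2 * (j : ℝ) * hγy
      _ = _ := by ring
  · refine le_trans ?_ (hfin (C ^ (1 / 2 : ℝ)) _ le_add_self he)
    have h1 := hB.enorm_bform_le_mixed (by linarith) hσ' h hE hFk hGl hFkI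
    refine h1.trans ?_
    calc _ ≤ C ^ (1 / 2 : ℝ) * (A : ℝ≥0∞) ^ (1 / 4 : ℝ) * (A ^ (3 / 4 : ℝ) * 2 ^ (-(3 / 4) * (j : ℝ))) *
          ((2 * 2 ^ (k * (1 - ρ / σ)) * φ) * (2 * 2 ^ (l * (1 - ρ / 2)) * ψ)) := by
          gcongr
          · exact hFm hσ1 hσ2
          · exact hGm (by norm_num) le_rfl
      _ = 4 * C ^ (1 / 2 : ℝ) * ((A : ℝ≥0∞) ^ (1 / 4 : ℝ) * A ^ (3 / 4 : ℝ)) *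
          (2 ^ (-(3 / 4) * (j : ℝ)) * 2 ^ (k * (1 - ρ / σ)) * 2 ^ (l * (1 - ρ / 2)) * (φ * ψ)) := by ring
      _ = _ := by
          rw [hA34, ← two_rpow_add, ← two_rpow_add]
          congr 3
          linear_combination (k : ℝ) * hx + (l : ℝ) * hy + 3 / 2 * (j : ℝ) * hγy
  · refine le_trans ?_ (hfin (C ^ (1 / 2 : ℝ)) _ le_add_self he)
    rw [enorm_bform_swap]
    have hvn : volume (Neg.neg ⁻¹' (D ∩ levelSet w j)) = volume (D ∩ levelSet w j) :=
      (Measure.measurePreserving_neg (volume : Measure ℝ)).measure_preimage hE.nullMeasurableSet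
    have h1 := hB.enorm_bform_le_mixed (by linarith) hσ' h (hE.preimage measurable_neg) hGl hFk hGlI
    rw [hvn] at h1
    refine h1.trans ?_
    calc _ ≤ C ^ (1 / 2 : ℝ) * (A : ℝ≥0∞) ^ (1 / 4 : ℝ) * (A ^ (3 / 4 : ℝ) * 2 ^ (-(3 / 4) * (j : ℝ))) *
          ((2 * 2 ^ (l * (1 - ρ / σ)) * ψ) * (2 * 2 ^ (k * (1 - ρ / 2)) * φ)) := by
          gcongr
          · exact hGm hσ1 hσ2
          · exact hFm (by norm_num) le_rfl
      _ = 4 * C ^ (1 / 2 : ℝ) * ((A : ℝ≥0∞) ^ (1 / 4 : ℝ) * A ^ (3 / 4 : ℝ)) *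
          (2 ^ (-(3 / 4) * (j : ℝ)) * 2 ^ (l * (1 - ρ / σ)) * 2 ^ (k * (1 - ρ / 2)) * (φ * ψ)) := by ring
      _ = _ := by
          rw [hA34, ← two_rpow_add, ← two_rpow_add]
          congr 3
          linear_combination (l : ℝ) * hx + (k : ℝ) * hy + 3 / 2 * (j : ℝ) * hγy

/-- The bilinear estimate at the endpoint. -/
lemma exists_bilinearBound_endpoint {γ ρ : ℝ} (hγ : 1 < γ) (hρ0 : 0 < ρ)
    (hθ : timeExp γ ρ = 1 / 2) : ∃ C, BilinearBound γ ρ C := by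
  have hγ0 : 0 < γ := by linarith
  have hρ : 1 / ρ = 1 / 2 + 1 / (2 * γ) := by
    have h1 : 1 / ρ - 1 / 2 = 1 / (2 * γ) := by
      rw [timeExp] at hθ
      rw [eq_div_iff (by positivity)]; linarith
    linarith
  have hγi : 1 / (2 * γ) < 1 / 2 := one_div_lt_one_div_of_lt (by norm_num) (by linarith)
  have hγp : 0 < 1 / (2 * γ) := by positivity
  have hρ1 : 1 ≤ ρ := by
    have : 1 / ρ ≤ 1 := by rw [hρ]; linarith
    rwa [div_le_one hρ0] at this
  -- This exponent lies halfway, in reciprocals, between ρ and 2, so that θ = 1/4 there and the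
  -- non-endpoint estimate applies.
  set σ : ℝ := 1 / (1 / 2 + 1 / (4 * γ)) with hσd
  have hσ : 1 / σ = 1 / 2 + 1 / (4 * γ) := by rw [hσd, one_div_one_div]
  have h4 : 1 / (4 * γ) = 1 / (2 * γ) / 2 := by field_simp; norm_num
  have hσ0 : 0 < σ := by positivity
  have hσ1 : 1 ≤ σ := by
    have : 1 / σ ≤ 1 := by rw [hσ, h4]; linarith
    rwa [div_le_one hσ0] at this
  have hσ2 : σ < 2 := by
    rw [hσd, div_lt_iff₀ (by positivity), h4]; linarith
  obtain ⟨C, hB⟩ := exists_bilinearBound_of_lt hγ0 hσ1 hσ2 (by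
    rw [timeExp, hσ, h4, show γ * (1 / 2 + 1 / (2 * γ) / 2 - 1 / 2) = 1 / 4 by field_simp; norm_num]
    norm_num)
  obtain ⟨ε, hε0, hε⟩ := exists_neg_le_of_linear_forms (y := 1 / (2 * γ)) (z := 1 / 2 - 1 / (2 * γ))
    hγp (by linarith)
  obtain ⟨C₁, hC₁⟩ := exists_tsum_two_rpow_mul_le hε0 hγ0
  obtain ⟨C₂, hC₂⟩ := exists_tsum_two_rpow_mul_le hε0 hρ0
  set K : ℝ≥0 := 4 * (2 ^ γ + C ^ (1 / 2 : ℝ)) with hK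
  have hKc : (K : ℝ≥0∞) = 4 * (2 ^ γ + (C : ℝ≥0∞) ^ (1 / 2 : ℝ)) := by
    rw [hK, ENNReal.coe_mul, ENNReal.coe_add, ENNReal.coe_rpow_of_nonneg _ hγ0.le,
      ENNReal.coe_rpow_of_nonneg _ (by norm_num)]
    norm_num
  refine ⟨K * (2 * (C₁ * C₂)), fun d I w A U h D hD F G hF hG hFI hGI => ?_⟩
  rw [hθ, show (1 : ℝ) / (1 - 1 / 2) = 2 by norm_num, show (2 : ℝ) * (1 / 2) = 1 by norm_num,
    ENNReal.rpow_one]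
  set P := mnorm 2 ρ F
  set Q := mnorm 2 ρ G
  obtain ⟨c, hc1, hc⟩ := exists_normalized (hF.mnorm_ne_top two_pos hρ0) (hF.tsum_layerNorm_le hρ0)
  obtain ⟨e, he1, he⟩ := exists_normalized (hG.mnorm_ne_top two_pos hρ0) (hG.tsum_layerNorm_le hρ0)
  -- Summing over the level j first leaves a matrix in k and l. For its row sums the order is
  -- reversed: l is summed at fixed j, centred at γj, and then j, centred at ρk. Both sums are
  -- bounded independently of their centres.
  set r : ℤ → ℤ → ℝ≥0∞ := fun k l =>
    ∑' j : ℤ, (2 : ℝ≥0∞) ^ (-ε * (|γ * j - ρ * k| + |γ * j - ρ * l|)) with hr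
  have hr1 : ∀ k, ∑' l, r k l ≤ C₁ * C₂ := by
    intro k
    simp only [hr]
    rw [ENNReal.tsum_comm]
    calc _ = ∑' j : ℤ, (2 : ℝ≥0∞) ^ (-ε * |γ * j - ρ * k|) *
          ∑' l : ℤ, (2 : ℝ≥0∞) ^ (-ε * |ρ * l - γ * j|) := by
          congr 1; ext j
          rw [← ENNReal.tsum_mul_left]
          congr 1; ext l
          rw [← two_rpow_add, abs_sub_comm (ρ * (l : ℝ))]
          congr 1; ring
      _ ≤ ∑' j : ℤ, (2 : ℝ≥0∞) ^ (-ε * |γ * j - ρ * k|) * C₂ :=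
          ENNReal.tsum_le_tsum fun j => mul_le_mul_right (hC₂ _) _
      _ ≤ _ := by
          rw [ENNReal.tsum_mul_right]
          exact mul_le_mul_left (hC₁ _) _
  have hr2 : ∀ l, ∑' k, r k l ≤ C₁ * C₂ := by
    intro l
    refine le_trans (le_of_eq ?_) (hr1 l)
    congr 1; ext k
    simp only [hr, add_comm]
  calc ‖bform U D F G‖ₑ ≤ ∑' j, ‖bform U (D ∩ levelSet w j) F G‖ₑ :=
        h.enorm_bform_le_tsum_levelSet hγ0 hD hF hG hFI hGI
    _ ≤ ∑' j : ℤ, ∑' k : ℤ, ∑' l : ℤ, K * A * (P * Q) *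
          (2 ^ (-ε * (|γ * j - ρ * k| + |γ * j - ρ * l|)) * (c k ^ (2 : ℝ) + e l ^ (2 : ℝ))) := by
        refine ENNReal.tsum_le_tsum fun j => ?_
        refine (h.enorm_bform_le_tsum (hD.inter (measurableSet_levelSet h.measurable_weight j))
          hF hG hρ0).trans (ENNReal.tsum_le_tsum fun k => ENNReal.tsum_le_tsum fun l => ?_)
        refine (h.enorm_bform_layers_le hγ hρ hσ hρ1 hσ1 hσ2.le hB hD hF hG hFI hGI hε j k l).trans ?_
        rw [hKc]
        calc _ ≤ 4 * (2 ^ γ + (C : ℝ≥0∞) ^ (1 / 2 : ℝ)) * A *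
              (2 ^ (-ε * (|γ * j - ρ * k| + |γ * j - ρ * l|)) * ((P * c k) * (Q * e l))) :=
              mul_le_mul_right (mul_le_mul_right (mul_le_mul' (hc k) (he l)) _) _
          _ = 4 * (2 ^ γ + (C : ℝ≥0∞) ^ (1 / 2 : ℝ)) * A * (P * Q) *
              (2 ^ (-ε * (|γ * j - ρ * k| + |γ * j - ρ * l|)) * (c k * e l)) := by ring
          _ ≤ _ := mul_le_mul_right (mul_le_mul_right (ENNReal_mul_le_sq_add_sq _ _) _) _
    _ = K * A * (P * Q) * ∑' k : ℤ, ∑' l : ℤ, r k l * (c k ^ (2 : ℝ) + e l ^ (2 : ℝ)) := by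
        simp_rw [ENNReal.tsum_mul_left]
        congr 1
        rw [ENNReal.tsum_comm]
        congr 1; ext k
        rw [ENNReal.tsum_comm]
        congr 1; ext l
        rw [ENNReal.tsum_mul_right]
    _ ≤ K * A * (P * Q) * (2 * (C₁ * C₂)) :=
        mul_le_mul_right (tsum_tsum_mul_add_le hr1 hr2 hc1 he1) _
    _ = _ := by push_cast; ring

/-- The bilinear estimate for all admissible exponents. -/
lemma exists_bilinearBound {γ ρ : ℝ} (hγ : 0 < γ) (h1 : 1 ≤ ρ) (h2 : ρ ≤ 2)
    (hθ : timeExp γ ρ ≤ 1 / 2) (hne : ¬(timeExp γ ρ = 1 / 2 ∧ ρ = 1)) :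
    ∃ C, BilinearBound γ ρ C := by
  rcases eq_or_lt_of_le h2 with rfl | h2
  · exact ⟨1, bilinearBound_two γ⟩
  rcases eq_or_lt_of_le hθ with hθ | hθ
  · refine exists_bilinearBound_endpoint ?_ (by linarith) hθ
    -- With ρ = 1 excluded, 1 / ρ - 1 / 2 < 1 / 2, so θ = 1/2 forces γ > 1.
    have h3 : 1 < ρ := lt_of_le_of_ne h1 fun h => hne ⟨hθ, h.symm⟩
    have h4 : 1 / ρ < 1 := by rwa [div_lt_one (by linarith)]
    rw [timeExp] at hθ
    nlinarith
  · exact exists_bilinearBound_of_lt hγ h1 h2 hθ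

end

section

variable {d : ℕ}

/-! ### Duality in Lebesgue spaces -/

/-- The extremal function `|z|^{q - 2} z` for the Hölder inequality. -/
def dualPow (q : ℝ) (z : ℂ) : ℂ := ((‖z‖ ^ (q - 2) : ℝ) : ℂ) * z

lemma measurable_dualPow (q : ℝ) : Measurable (dualPow q) :=
  (Complex.measurable_ofReal.comp (measurable_norm.pow_const _)).mul measurable_id

lemma norm_dualPow {q : ℝ} (hq : 1 < q) (z : ℂ) : ‖dualPow q z‖ = ‖z‖ ^ (q - 1) := by
  rw [dualPow, norm_mul, Complex.norm_real, Real.norm_of_nonneg (by positivity)]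
  rcases eq_or_ne z 0 with rfl | hz
  · simp [Real.zero_rpow (by linarith : q - 1 ≠ 0)]
  · rw [show q - 1 = (q - 2) + 1 by ring, Real.rpow_add_one (by simpa using hz)]

lemma enorm_dualPow {q : ℝ} (hq : 1 < q) (z : ℂ) : ‖dualPow q z‖ₑ = ‖z‖ₑ ^ (q - 1) := by
  rw [← ofReal_norm, norm_dualPow hq, ← ENNReal.ofReal_rpow_of_nonneg (norm_nonneg _) (by linarith),
    ofReal_norm]

lemma inner_dualPow {q : ℝ} (hq : 1 < q) (z : ℂ) :
    inner ℂ (dualPow q z) z = ((‖z‖ ^ q : ℝ) : ℂ) := by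
  rw [RCLike.inner_apply, dualPow, map_mul, Complex.conj_ofReal, mul_left_comm, RCLike.mul_conj]
  rcases eq_or_ne z 0 with rfl | hz
  · simp [Real.zero_rpow (by linarith : q ≠ 0)]
  · simp only [Complex.coe_algebraMap]
    rw [← Complex.ofReal_pow, ← Complex.ofReal_mul, ← Real.rpow_natCast,
      ← Real.rpow_add (by simpa using hz)]
    congr 2; push_cast; ring

/-- This is the absorption step of the converse Hölder inequality. Dividing by S ^ (1 / p) needs S
finite, which is the reason for the truncations in its applications. -/
lemma rpow_le_of_le_mul_rpow {p q : ℝ} (hpq : p.HolderConjugate q) {S M : ℝ≥0∞} (hS : S ≠ ⊤)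
    (h : S ≤ M * S ^ (1 / p)) : S ^ (1 / q) ≤ M := by
  rcases eq_or_ne S 0 with rfl | h0
  · rw [ENNReal.zero_rpow_of_pos (one_div_pos.2 hpq.symm.pos)]; exact zero_le
  have h1 : S ^ (1 / q) = S * (S ^ (1 / p))⁻¹ := by
    rw [← ENNReal.rpow_neg]
    nth_rw 2 [← ENNReal.rpow_one S]
    rw [← ENNReal.rpow_add _ _ h0 hS]
    congr 1
    have := hpq.inv_add_inv_eq_one
    rw [one_div, one_div]; linarith
  rw [h1, ← div_eq_mul_inv]
  exact ENNReal.div_le_of_le_mul h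

lemma enorm_integral_ofReal {X : Type*} [MeasurableSpace X] {μ : Measure X} {f : X → ℝ}
    (hf : Integrable f μ) (h0 : ∀ x, 0 ≤ f x) :
    ‖∫ x, ((f x : ℝ) : ℂ) ∂μ‖ₑ = ∫⁻ x, ENNReal.ofReal (f x) ∂μ := by
  have h : ∫ x, ((f x : ℝ) : ℂ) ∂μ = ((∫ x, f x ∂μ : ℝ) : ℂ) := integral_ofReal
  rw [h, ← ofReal_integral_eq_lintegral_ofReal hf (Filter.Eventually.of_forall h0), ← ofReal_norm,
    Complex.norm_real, Real.norm_of_nonneg (integral_nonneg h0)]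

lemma inner_toL2 {g : Space d → ℂ} (hg : MemLp g 2 volume) (u : L2 d) :
    inner ℂ (toL2 g) u = ∫ x, inner ℂ (g x) (u x) := by
  rw [L2.inner_def]
  refine integral_congr_ae ?_
  rw [toL2_of_memLp hg]
  filter_upwards [MemLp.coeFn_toLp hg] with x hx
  rw [hx]

/-- Sets on which a function is bounded, inside a ball. -/
def truncSet {X : Type*} [NormedAddCommGroup X] (u : X → ℂ) (n : ℕ) : Set X :=
  {x | ‖x‖ ≤ n ∧ ‖u x‖ ≤ n}

lemma measurableSet_truncSet {X : Type*} [NormedAddCommGroup X] [MeasurableSpace X] [BorelSpace X]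
    {u : X → ℂ} (hu : Measurable u) (n : ℕ) : MeasurableSet (truncSet u n) :=
  (measurableSet_le measurable_norm measurable_const).inter
    (measurableSet_le hu.norm measurable_const)

lemma monotone_truncSet {X : Type*} [NormedAddCommGroup X] (u : X → ℂ) : Monotone (truncSet u) :=
  fun n m h x hx => ⟨hx.1.trans (by exact_mod_cast h), hx.2.trans (by exact_mod_cast h)⟩

lemma exists_mem_truncSet {X : Type*} [NormedAddCommGroup X] (u : X → ℂ) (x : X) :
    ∃ n, x ∈ truncSet u n := by
  obtain ⟨n, hn⟩ := exists_nat_ge (max ‖x‖ ‖u x‖)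
  exact ⟨n, (le_max_left _ _).trans hn, (le_max_right _ _).trans hn⟩

lemma iUnion_truncSet {X : Type*} [NormedAddCommGroup X] (u : X → ℂ) : ⋃ n, truncSet u n = Set.univ :=
  Set.eq_univ_of_forall fun x => Set.mem_iUnion.2 (exists_mem_truncSet u x)

lemma test_indicator_truncSet {u φ : Space d → ℂ} (hu : Measurable u) (hφ : Measurable φ) {n : ℕ}
    {K : ℝ} (hK : ∀ x ∈ truncSet u n, ‖φ x‖ ≤ K) : Test ((truncSet u n).indicator φ) := by
  refine ⟨hφ.indicator (measurableSet_truncSet hu n), ⟨max K 0, fun x => ?_⟩, ⟨n, fun x hx => ?_⟩⟩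
  · by_cases hx : x ∈ truncSet u n
    · rw [Set.indicator_of_mem hx]; exact (hK x hx).trans (le_max_left _ _)
    · rw [Set.indicator_of_notMem hx]; simp
  · by_contra h
    exact hx (Set.indicator_of_notMem (fun h' => h h'.1) _)

/-- The converse of Hölder's inequality, tested on bounded functions of bounded support. -/
lemma eLpNorm_le_of_test_of_lt {ρ r : ℝ} (hr : ρ.HolderConjugate r) (u : L2 d)
    {M : ℝ≥0∞} (h : ∀ g : Space d → ℂ, Test g → ‖inner ℂ (toL2 g) u‖ₑ ≤ M * snorm ρ g) :
    eLpNorm u (ENNReal.ofReal r) volume ≤ M := by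
  have hr1 : 1 < r := hr.symm.lt
  have hr0 : 0 < r := hr.symm.pos
  have hum : Measurable u := (Lp.stronglyMeasurable u).measurable
  rw [eLpNorm_eq_lintegral_rpow_enorm_toReal (by simpa using hr0) (by simp),
    ENNReal.toReal_ofReal hr0.le]
  -- On the truncated set the extremal function of Hölder's inequality is an admissible test
  -- function and the integral is finite. The bound does not depend on n, so monotone convergence
  -- finishes.
  have key : ∀ n, (∫⁻ x in truncSet u n, ‖u x‖ₑ ^ r) ^ (1 / r) ≤ M := by
    intro n
    have hE := measurableSet_truncSet hum n
    set g : Space d → ℂ := (truncSet u n).indicator fun x => dualPow r (u x) with hg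
    set f : Space d → ℂ := (truncSet u n).indicator fun x => ((‖u x‖ ^ r : ℝ) : ℂ) with hf
    have hgT : Test g := by
      refine test_indicator_truncSet hum ((measurable_dualPow r).comp hum) (K := (n : ℝ) ^ (r - 1)) ?_
      intro x hx
      rw [Function.comp_apply, norm_dualPow hr1]
      exact Real.rpow_le_rpow (norm_nonneg _) hx.2 (by linarith)
    have hfT : Test f := by
      refine test_indicator_truncSet hum
        (Complex.measurable_ofReal.comp (hum.norm.pow_const _)) (K := (n : ℝ) ^ r) ?_
      intro x hx
      rw [Function.comp_apply, Complex.norm_real, Real.norm_of_nonneg (by positivity)]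
      exact Real.rpow_le_rpow (norm_nonneg _) hx.2 (by linarith)
    have hS : ∫⁻ x in truncSet u n, ‖u x‖ₑ ^ r = ∫⁻ x, ‖f x‖ₑ := by
      rw [← lintegral_indicator hE]
      congr 1; ext x
      by_cases hx : x ∈ truncSet u n
      · rw [hf, Set.indicator_of_mem hx, Set.indicator_of_mem hx, ← ofReal_norm, ← ofReal_norm,
          ENNReal.ofReal_rpow_of_nonneg (norm_nonneg _) hr0.le, Complex.norm_real,
          Real.norm_of_nonneg (by positivity)]
      · rw [hf, Set.indicator_of_notMem hx, Set.indicator_of_notMem hx, enorm_zero]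
    have hfin : ∫⁻ x in truncSet u n, ‖u x‖ₑ ^ r ≠ ⊤ := by
      rw [hS]
      exact ((memLp_one_iff_integrable.1 (hfT.memLp 1)).2).ne
    refine rpow_le_of_le_mul_rpow hr hfin ?_
    have h1 := h g hgT
    have h2 : ‖inner ℂ (toL2 g) u‖ₑ = ∫⁻ x in truncSet u n, ‖u x‖ₑ ^ r := by
      rw [inner_toL2 (hgT.memLp 2), hS]
      have h3 : ∀ x, inner ℂ (g x) (u x) = ((‖f x‖ : ℝ) : ℂ) := by
        intro x
        by_cases hx : x ∈ truncSet u n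
        · rw [hg, hf, Set.indicator_of_mem hx, Set.indicator_of_mem hx, inner_dualPow hr1,
            Complex.norm_real, Real.norm_of_nonneg (by positivity)]
        · rw [hg, hf, Set.indicator_of_notMem hx, Set.indicator_of_notMem hx]; simp
      simp_rw [h3]
      rw [enorm_integral_ofReal (memLp_one_iff_integrable.1 (hfT.memLp 1)).norm
        fun x => norm_nonneg _]
      simp_rw [ofReal_norm]
    have h4 : snorm ρ g = (∫⁻ x in truncSet u n, ‖u x‖ₑ ^ r) ^ (1 / ρ) := by
      rw [snorm, lnorm, ← lintegral_indicator hE]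
      congr 2; ext x
      by_cases hx : x ∈ truncSet u n
      · rw [hg, Set.indicator_of_mem hx, Set.indicator_of_mem hx, enorm_dualPow hr1,
          ← ENNReal.rpow_mul, hr.symm.sub_one_mul_conj]
      · rw [hg, Set.indicator_of_notMem hx, Set.indicator_of_notMem hx, enorm_zero,
          ENNReal.zero_rpow_of_pos hr.pos]
    rwa [h2, h4] at h1
  have hsup : ∫⁻ x, ‖u x‖ₑ ^ r = ⨆ n, ∫⁻ x in truncSet u n, ‖u x‖ₑ ^ r := by
    rw [← setLIntegral_iUnion_of_directed _ (monotone_truncSet u).directed_le, iUnion_truncSet,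
      Measure.restrict_univ]
  have hM : ∀ n, ∫⁻ x in truncSet u n, ‖u x‖ₑ ^ r ≤ M ^ r := fun n => by
    have := ENNReal.rpow_le_rpow (key n) hr0.le
    rwa [← ENNReal.rpow_mul, one_div_mul_cancel hr0.ne', ENNReal.rpow_one] at this
  calc _ ≤ (M ^ r) ^ (1 / r) := ENNReal.rpow_le_rpow (hsup.trans_le (iSup_le hM)) (by positivity)
    _ = M := by rw [← ENNReal.rpow_mul, mul_one_div_cancel hr0.ne', ENNReal.rpow_one]

/-- If |u| > M on a set of positive measure, testing against the phase of u on a bounded piece of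
that set, where u is bounded, gives a contradiction. -/
lemma eLpNorm_top_le_of_test (u : L2 d) {M : ℝ≥0∞}
    (h : ∀ g : Space d → ℂ, Test g → ‖inner ℂ (toL2 g) u‖ₑ ≤ M * snorm 1 g) :
    eLpNorm u ⊤ volume ≤ M := by
  have hum : Measurable u := (Lp.stronglyMeasurable u).measurable
  rw [eLpNorm_exponent_top]
  refine eLpNormEssSup_le_of_ae_enorm_bound ?_
  rcases eq_or_ne M ⊤ with rfl | hM
  · simp
  have hB : MeasurableSet {x | M < ‖u x‖ₑ} := measurableSet_lt measurable_const hum.enorm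
  suffices hz : ∀ n, volume ({x | M < ‖u x‖ₑ} ∩ truncSet u n) = 0 by
    have : {x | ¬ ‖u x‖ₑ ≤ M} = ⋃ n, ({x | M < ‖u x‖ₑ} ∩ truncSet u n) := by
      rw [← Set.inter_iUnion, iUnion_truncSet, Set.inter_univ]
      simp only [not_le]
    rw [ae_iff, this]
    exact measure_iUnion_null hz
  intro n
  by_contra h0
  set E := {x | M < ‖u x‖ₑ} ∩ truncSet u n with hE
  have hEm : MeasurableSet E := hB.inter (measurableSet_truncSet hum n)
  set g : Space d → ℂ := E.indicator fun x => dualPow 1 (u x) with hg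
  have hne : ∀ x ∈ E, u x ≠ 0 := fun x hx h => by
    have := hx.1
    simp only [Set.mem_ofPred_eq, h, enorm_zero, not_lt_zero] at this
  have hn1 : ∀ z : ℂ, z ≠ 0 → ‖dualPow 1 z‖ = 1 := by
    intro z hz
    rw [dualPow, norm_mul, Complex.norm_real, Real.norm_of_nonneg (by positivity),
      show (1 : ℝ) - 2 = -1 by norm_num, Real.rpow_neg_one, inv_mul_cancel₀ (by simpa using hz)]
  have hb : volume E ≠ ⊤ := by
    refine ne_top_of_le_ne_top (measure_closedBall_lt_top (x := (0 : Space d)) (r := n)).ne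
      (measure_mono fun x hx => ?_)
    simpa using hx.2.1
  have hgT : Test g := by
    refine ⟨((measurable_dualPow 1).comp hum).indicator hEm, ⟨1, fun x => ?_⟩, ⟨n, fun x hx => ?_⟩⟩
    · by_cases hx : x ∈ E
      · rw [hg, Set.indicator_of_mem hx, hn1 _ (hne x hx)]
      · rw [hg, Set.indicator_of_notMem hx]; simp
    · by_contra h
      exact hx (Set.indicator_of_notMem (fun h' => h h'.2.1) _)
  have h1 := h g hgT
  have h2 : snorm 1 g = volume E := by
    have : ∀ x, ‖g x‖ₑ ^ (1 : ℝ) = E.indicator 1 x := by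
      intro x
      by_cases hx : x ∈ E
      · rw [hg, Set.indicator_of_mem hx, Set.indicator_of_mem hx, ENNReal.rpow_one, ← ofReal_norm,
          hn1 _ (hne x hx)]; simp
      · rw [hg, Set.indicator_of_notMem hx, Set.indicator_of_notMem hx]; simp
    rw [snorm, lnorm]
    simp_rw [this]
    rw [lintegral_indicator_one hEm]; simp
  have hi : IntegrableOn (fun x => ‖u x‖) E := by
    refine Measure.integrableOn_of_bounded (M := n) hb hum.norm.aestronglyMeasurable ?_
    rw [ae_restrict_iff' hEm]
    exact Filter.Eventually.of_forall fun x hx => by simpa using hx.2.2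
  have h3 : ‖inner ℂ (toL2 g) u‖ₑ = ∫⁻ x in E, ‖u x‖ₑ := by
    rw [inner_toL2 (hgT.memLp 2)]
    have h4 : ∀ x, inner ℂ (g x) (u x) = ((E.indicator (fun x => ‖u x‖) x : ℝ) : ℂ) := by
      intro x
      by_cases hx : x ∈ E
      · have hz : ‖u x‖ ≠ 0 := by simpa using hne x hx
        rw [hg, Set.indicator_of_mem hx, Set.indicator_of_mem hx, RCLike.inner_apply, dualPow,
          map_mul, Complex.conj_ofReal, mul_left_comm, RCLike.mul_conj]
        simp only [Complex.coe_algebraMap]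
        rw [← Complex.ofReal_pow, ← Complex.ofReal_mul, show (1 : ℝ) - 2 = -1 by norm_num,
          Real.rpow_neg_one]
        congr 1; field_simp
      · rw [hg, Set.indicator_of_notMem hx, Set.indicator_of_notMem hx]; simp
    simp_rw [h4]
    rw [enorm_integral_ofReal (hi.integrable_indicator hEm)
      (Set.indicator_nonneg fun x _ => norm_nonneg _), ← lintegral_indicator hEm]
    congr 1; ext x
    by_cases hx : x ∈ E
    · rw [Set.indicator_of_mem hx, Set.indicator_of_mem hx, ofReal_norm]
    · rw [Set.indicator_of_notMem hx, Set.indicator_of_notMem hx, ENNReal.ofReal_zero]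
  rw [h2, h3] at h1
  have h5 := setLIntegral_strict_mono (μ := volume) hEm h0 (f := fun _ => M) hum.enorm (by
    rw [setLIntegral_const]; exact ENNReal.mul_ne_top hM hb)
    (Filter.Eventually.of_forall fun x hx => hx.1)
  rw [setLIntegral_const] at h5
  exact absurd h1 (not_le.2 h5)

lemma holderConjugate_cases {ρ : ℝ} (hρ : 1 ≤ ρ) {r : ℝ≥0∞} (hr : (ENNReal.ofReal ρ).HolderConjugate r) :
    (ρ = 1 ∧ r = ⊤) ∨ ∃ r' : ℝ, r = ENNReal.ofReal r' ∧ ρ.HolderConjugate r' := by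
  rcases eq_or_lt_of_le hρ with rfl | hρ
  · left
    refine ⟨rfl, ?_⟩
    rw [ENNReal.ofReal_one] at hr
    exact (ENNReal.HolderConjugate.unique 1 r ⊤)
  · right
    have hρ' : 1 < (ENNReal.ofReal ρ).toReal := by rwa [ENNReal.toReal_ofReal (by linarith)]
    have h1 := ENNReal.HolderConjugate.toReal (q := r) hρ'
    rw [ENNReal.toReal_ofReal (by linarith)] at h1
    refine ⟨r.toReal, (ENNReal.ofReal_toReal ?_).symm, h1⟩
    rintro rfl
    have := h1.symm.pos
    simp at this

lemma eLpNorm_le_of_test {ρ : ℝ} (hρ : 1 ≤ ρ) {r : ℝ≥0∞} (hr : (ENNReal.ofReal ρ).HolderConjugate r)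
    (u : L2 d) {M : ℝ≥0∞}
    (h : ∀ g : Space d → ℂ, Test g → ‖inner ℂ (toL2 g) u‖ₑ ≤ M * snorm ρ g) :
    eLpNorm u r volume ≤ M := by
  rcases holderConjugate_cases hρ hr with ⟨rfl, rfl⟩ | ⟨r', rfl, hr'⟩
  · exact eLpNorm_top_le_of_test u h
  · exact eLpNorm_le_of_test_of_lt hr' u h

lemma lintegral_enorm_inner_le {ρ : ℝ} (hρ : 0 < ρ) {r : ℝ≥0∞}
    (hr : (ENNReal.ofReal ρ).HolderConjugate r) {g u : Space d → ℂ}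
    (hg : AEStronglyMeasurable g volume) (hu : AEStronglyMeasurable u volume) :
    ∫⁻ x, ‖inner ℂ (g x) (u x)‖ₑ ≤ snorm ρ g * eLpNorm u r volume := by
  have := eLpNorm_le_eLpNorm_mul_eLpNorm'_of_norm (μ := volume) (r := 1) hg hu
    (fun x y => inner ℂ x y) 1 (Filter.Eventually.of_forall fun x => by
      simpa using norm_inner_le_norm (𝕜 := ℂ) (g x) (u x)) (hpqr := hr)
  rwa [eLpNorm_one_eq_lintegral_enorm, ENNReal.coe_one, one_mul, ← snorm_eq_eLpNorm hρ] at this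

lemma Test.enorm_inner_toL2_le {ρ : ℝ} (hρ : 0 < ρ) {r : ℝ≥0∞}
    (hr : (ENNReal.ofReal ρ).HolderConjugate r) {g : Space d → ℂ} (hg : Test g) (u : L2 d) :
    ‖inner ℂ (toL2 g) u‖ₑ ≤ snorm ρ g * eLpNorm u r volume := by
  rw [inner_toL2 (hg.memLp 2)]
  exact (enorm_integral_le_lintegral_enorm _).trans (lintegral_enorm_inner_le hρ hr
    hg.measurable.aestronglyMeasurable (Lp.aestronglyMeasurable u))

lemma Test.toL2_eq_zero {ρ : ℝ} (hρ : 0 < ρ) {g : Space d → ℂ} (hg : Test g) (h : snorm ρ g = 0) :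
    toL2 g = 0 := by
  rw [snorm_eq_eLpNorm hρ, eLpNorm_eq_zero_iff hg.measurable.aestronglyMeasurable
    (by simpa using hρ)] at h
  rw [← enorm_eq_zero, hg.enorm_toL2, snorm_two, eLpNorm_congr_ae h]
  exact eLpNorm_zero

lemma Test.smul {g : Space d → ℂ} (hg : Test g) (c : ℂ) : Test (c • g) := by
  obtain ⟨M, hM⟩ := hg.bounded
  obtain ⟨R, hR⟩ := hg.support
  refine ⟨hg.measurable.const_smul c, ⟨‖c‖ * M, fun x => ?_⟩, ⟨R, fun x hx => hR x fun h => hx ?_⟩⟩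
  · rw [Pi.smul_apply, norm_smul]; exact mul_le_mul_of_nonneg_left (hM x) (norm_nonneg _)
  · simp [h]

lemma Test.toL2_smul {g : Space d → ℂ} (hg : Test g) (c : ℂ) : toL2 (c • g) = c • toL2 g := by
  rw [toL2_of_memLp (hg.memLp 2), toL2_of_memLp ((hg.smul c).memLp 2)]
  exact MemLp.toLp_const_smul _ _

lemma snorm_smul {ρ : ℝ} (hρ : 0 < ρ) (c : ℂ) (g : Space d → ℂ) :
    snorm ρ (c • g) = ‖c‖ₑ * snorm ρ g := by
  rw [snorm_eq_eLpNorm hρ, snorm_eq_eLpNorm hρ, eLpNorm_const_smul]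

/-- The `L^r` norm of a square integrable function is the supremum of countably many functionals. -/
lemma exists_norming_seq (d : ℕ) {ρ : ℝ} (hρ : 1 ≤ ρ) {r : ℝ≥0∞}
    (hr : (ENNReal.ofReal ρ).HolderConjugate r) :
    ∃ g : ℕ → Space d → ℂ, (∀ n, Test (g n)) ∧ (∀ n, snorm ρ (g n) ≤ 1) ∧
      ∀ u : L2 d, eLpNorm u r volume = ⨆ n, ‖inner ℂ (toL2 (g n)) u‖ₑ := by
  have hρ0 : 0 < ρ := by linarith
  -- As a subset of the separable space L², the set of admissible test functions has a countable
  -- subset dense for the L² norm. This suffices because the pairing with u ∈ L² is L²-continuous,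
  -- although the constraint is on the L^ρ norm.
  set K : Set (L2 d) := toL2 '' {g | Test g ∧ snorm ρ g ≤ 1} with hK
  have : Nonempty K := by
    refine ⟨⟨toL2 0, 0, ⟨test_zero, ?_⟩, rfl⟩⟩
    rw [snorm_eq_eLpNorm hρ0, eLpNorm_zero]; exact zero_le
  have hex : ∀ n, ∃ g, (Test g ∧ snorm ρ g ≤ 1) ∧ toL2 g = (TopologicalSpace.denseSeq K n : L2 d) :=
    fun n => (TopologicalSpace.denseSeq K n).2
  choose g hg hgK using hex
  refine ⟨g, fun n => (hg n).1, fun n => (hg n).2, fun u => le_antisymm ?_ ?_⟩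
  · refine eLpNorm_le_of_test hρ hr u fun f hf => ?_
    rcases eq_or_ne (snorm ρ f) 0 with h0 | h0
    · rw [hf.toL2_eq_zero hρ0 h0]; simp
    have ht := hf.snorm_ne_top hρ0
    set s : ℝ := (snorm ρ f).toReal with hs
    have hs0 : 0 < s := ENNReal.toReal_pos h0 ht
    have hsn : snorm ρ f = ENNReal.ofReal s := (ENNReal.ofReal_toReal ht).symm
    have hc : ‖((s⁻¹ : ℝ) : ℂ)‖ₑ = (snorm ρ f)⁻¹ := by
      rw [← ofReal_norm, Complex.norm_real, Real.norm_of_nonneg (by positivity),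
        ENNReal.ofReal_inv_of_pos hs0, hsn]
    have hmem : toL2 (((s⁻¹ : ℝ) : ℂ) • f) ∈ K := by
      refine ⟨_, ⟨hf.smul _, ?_⟩, rfl⟩
      rw [snorm_smul hρ0, hc, ENNReal.inv_mul_cancel h0 ht]
    have hle : ∀ k : K, ‖inner ℂ (k : L2 d) u‖ₑ ≤ ⨆ n, ‖inner ℂ (toL2 (g n)) u‖ₑ := by
      intro k
      refine (TopologicalSpace.denseRange_denseSeq K).induction_on
        (p := fun k : K => ‖inner ℂ (k : L2 d) u‖ₑ ≤ ⨆ n, ‖inner ℂ (toL2 (g n)) u‖ₑ) k ?_ ?_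
      · exact isClosed_le (by fun_prop) continuous_const
      · intro n
        rw [← hgK n]
        exact le_iSup (fun n => ‖inner ℂ (toL2 (g n)) u‖ₑ) n
    have h1 := hle ⟨_, hmem⟩
    simp only at h1
    rw [hf.toL2_smul, inner_smul_left, enorm_mul, RCLike.enorm_conj, hc] at h1
    rwa [mul_comm, ← div_eq_mul_inv, ENNReal.div_le_iff h0 ht] at h1
  · refine iSup_le fun n => ((hg n).1.enorm_inner_toL2_le hρ0 hr u).trans ?_
    calc _ ≤ 1 * eLpNorm u r volume := mul_le_mul_left (hg n).2 _
      _ = _ := one_mul _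

end

section

variable {d : ℕ}

/-! ### Duality in mixed norms -/

/-- A supremum of countably many measurable functions is the increasing limit of measurable
selections from them. -/
lemma exists_measurable_selection {α : Type*} [MeasurableSpace α] {ζ : ℕ → α → ℝ≥0∞}
    (hζ : ∀ n, Measurable (ζ n)) :
    ∃ k : ℕ → α → ℕ, (∀ N, Measurable (k N)) ∧ (∀ N, Measurable fun t => ζ (k N t) t) ∧ (∀ t, Monotone fun N => ζ (k N t) t) ∧
      ∀ t, ⨆ N, ζ (k N t) t = ⨆ n, ζ n t := by
  have hsel : ∀ k : α → ℕ, Measurable k → Measurable fun t => ζ (k t) t := fun k hk => by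
    have : Measurable fun z : ℕ × α => ζ z.1 z.2 := measurable_from_prod_countable_right hζ
    exact this.comp (hk.prodMk measurable_id)
  set k : ℕ → α → ℕ := fun N => Nat.rec (fun _ => 0)
    (fun N k t => if ζ (k t) t < ζ (N + 1) t then N + 1 else k t) N with hk
  have hk1 : ∀ N t, k (N + 1) t = if ζ (k N t) t < ζ (N + 1) t then N + 1 else k N t :=
    fun N t => rfl
  have hkm : ∀ N, Measurable (k N) := by
    intro N
    induction N with
    | zero => exact measurable_const
    | succ N ih => exact Measurable.ite (measurableSet_lt (hsel _ ih) (hζ _)) measurable_const ih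
  have hmono : ∀ t, Monotone fun N => ζ (k N t) t := fun t => monotone_nat_of_le_succ fun N => by
    rw [hk1]
    split_ifs with h
    · exact h.le
    · exact le_rfl
  refine ⟨k, hkm, fun N => hsel _ (hkm N), hmono, fun t => le_antisymm (iSup_le fun N => le_iSup (fun n => ζ n t) _)
    (iSup_le fun n => le_iSup_of_le n ?_)⟩
  cases n with
  | zero => exact le_rfl
  | succ N =>
    rw [hk1]
    split_ifs with h
    · exact le_rfl
    · exact not_lt.1 h

lemma measurable_inner_apply {u : ℝ → L2 d} (hu : StronglyMeasurable u) (v : L2 d) :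
    Measurable fun t => inner ℂ v (u t) :=
  (StronglyMeasurable.inner (𝕜 := ℂ) (stronglyMeasurable_const (b := v)) hu).measurable

lemma measurable_eLpNorm_apply {ρ : ℝ} (hρ : 1 ≤ ρ) {r : ℝ≥0∞}
    (hr : (ENNReal.ofReal ρ).HolderConjugate r) {u : ℝ → L2 d} (hu : StronglyMeasurable u) :
    Measurable fun t => eLpNorm (u t) r volume := by
  obtain ⟨g, -, -, hg⟩ := exists_norming_seq d hρ hr
  simp_rw [hg]
  exact Measurable.iSup fun n => (measurable_inner_apply hu (toL2 (g n))).enorm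

/-- The function `t ↦ ‖u(t)‖_r` is in `L^q(I)` if `u` is bounded as a functional on the dual mixed
norm. -/
lemma lnorm_selection_le {p q ρ : ℝ} (hpq : p.HolderConjugate q) (hρ : 0 < ρ) {u : ℝ → L2 d}
    (hu : StronglyMeasurable u) {I : Set ℝ} (hI : MeasurableSet I) {M : ℝ≥0∞}
    (h : ∀ G : ℝ → Space d → ℂ, Nice G → (∀ t, t ∉ I → G t = 0) →
      ‖∫ t, inner ℂ (toL2 (G t)) (u t)‖ₑ ≤ M * mnorm p ρ G)
    {g : ℕ → Space d → ℂ} (hg : ∀ n, Test (g n)) (hg1 : ∀ n, snorm ρ (g n) ≤ 1) {k : ℝ → ℕ}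
    (hk : Measurable k) :
    (∫⁻ t in I, ‖inner ℂ (toL2 (g (k t))) (u t)‖ₑ ^ q) ^ (1 / q) ≤ M := by
  have hq1 : 1 < q := hpq.symm.lt
  have hq0 : 0 < q := hpq.symm.pos
  set z : ℝ → ℂ := fun t => inner ℂ (toL2 (g (k t))) (u t) with hz
  have hzm : Measurable z := by
    have : Measurable fun y : ℕ × ℝ => inner ℂ (toL2 (g y.1)) (u y.2) :=
      measurable_from_prod_countable_right fun n => measurable_inner_apply hu (toL2 (g n))
    exact this.comp (hk.prodMk measurable_id)
  -- Bounding the index k t as well leaves only finitely many test functions g i, so that the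
  -- extremal G below has a common bound and a common support.
  set J : ℕ → Set ℝ := fun n => truncSet z n ∩ {t | k t ≤ n} with hJ
  have hJm : ∀ n, MeasurableSet (J n) := fun n =>
    (measurableSet_truncSet hzm n).inter (measurableSet_le hk measurable_const)
  have hJmono : Monotone J := fun n m hnm =>
    Set.inter_subset_inter (monotone_truncSet z hnm) fun t ht => le_trans ht hnm
  have hJU : ⋃ n, J n = Set.univ := Set.eq_univ_of_forall fun t => by
    obtain ⟨n, hn⟩ := exists_mem_truncSet z t
    exact Set.mem_iUnion.2 ⟨max n (k t), monotone_truncSet z (le_max_left _ _) hn, le_max_right n (k t)⟩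
  have key : ∀ n, (∫⁻ t in I ∩ J n, ‖z t‖ₑ ^ q) ^ (1 / q) ≤ M := by
    intro n
    have hE : MeasurableSet (I ∩ J n) := hI.inter (hJm n)
    set G : ℝ → Space d → ℂ := (I ∩ J n).indicator fun t => dualPow q (z t) • g (k t) with hG
    have hGe : ∀ t, t ∈ I ∩ J n → G t = dualPow q (z t) • g (k t) := fun t ht => Set.indicator_of_mem ht _
    have hG0 : ∀ t, t ∉ I ∩ J n → G t = 0 := fun t ht => Set.indicator_of_notMem ht _
    choose B hB using fun n => (hg n).bounded
    choose R hR using fun n => (hg n).support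
    have hsum : ∀ (f : ℕ → ℝ) (m : ℕ), m ≤ n → f m ≤ ∑ i ∈ Finset.range (n + 1), |f i| := by
      intro f m hm
      exact (le_abs_self _).trans (Finset.single_le_sum (f := fun i => |f i|)
        (fun i _ => abs_nonneg _) (Finset.mem_range.2 (by omega)))
    have hGN : Nice G := by
      refine ⟨?_, ⟨(n : ℝ) ^ (q - 1) * ∑ i ∈ Finset.range (n + 1), |B i|, fun t x => ?_⟩,
        ⟨max n (∑ i ∈ Finset.range (n + 1), |R i|), fun t x hx => ?_⟩⟩
      · have h1 : Function.uncurry G = (Prod.fst ⁻¹' (I ∩ J n)).indicator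
            fun y : ℝ × Space d => dualPow q (z y.1) * g (k y.1) y.2 := by
          ext ⟨t, x⟩
          by_cases ht : t ∈ I ∩ J n
          · rw [Set.indicator_of_mem (by exact ht), Function.uncurry_apply_pair, hGe t ht]; rfl
          · rw [Set.indicator_of_notMem (by exact ht), Function.uncurry_apply_pair, hG0 t ht]; rfl
        rw [h1]
        refine Measurable.indicator ?_ (hE.preimage measurable_fst)
        have h2 : Measurable fun y : ℕ × Space d => g y.1 y.2 :=
          measurable_from_prod_countable_right fun n => (hg n).measurable
        exact ((measurable_dualPow q).comp (hzm.comp measurable_fst)).mul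
          (h2.comp ((hk.comp measurable_fst).prodMk measurable_snd))
      · by_cases ht : t ∈ I ∩ J n
        · rw [hGe t ht, Pi.smul_apply, norm_smul, norm_dualPow hq1]
          refine mul_le_mul (Real.rpow_le_rpow (norm_nonneg _) ht.2.1.2 (by linarith))
            ((hB _ x).trans (hsum B _ ht.2.2)) (norm_nonneg _) (by positivity)
        · rw [hG0 t ht, Pi.zero_apply, norm_zero]; positivity
      · by_cases ht : t ∈ I ∩ J n
        · rw [hGe t ht] at hx
          have hx' : g (k t) x ≠ 0 := fun h0 => hx (by rw [Pi.smul_apply, h0, smul_zero])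
          exact ⟨(ht.2.1.1).trans (le_max_left _ _),
            ((hR _ x hx').trans (hsum R _ ht.2.2)).trans (le_max_right _ _)⟩
        · exact absurd (by rw [hG0 t ht]; rfl) hx
    have hGI : ∀ t, t ∉ I → G t = 0 := fun t ht => hG0 t fun h' => ht h'.1
    set f : ℝ → ℝ := (I ∩ J n).indicator fun t => ‖z t‖ ^ q with hf
    have hf0 : ∀ t, 0 ≤ f t := Set.indicator_nonneg fun t _ => by positivity
    have hvE : volume (I ∩ J n) ≠ ⊤ := by
      refine ne_top_of_le_ne_top (measure_closedBall_lt_top (x := (0 : ℝ)) (r := n)).ne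
        (measure_mono fun x hx => ?_)
      simpa using hx.2.1.1
    have hfi : Integrable f := by
      refine (Measure.integrableOn_of_bounded (M := (n : ℝ) ^ q) hvE
        (hzm.norm.pow_const _).aestronglyMeasurable ?_).integrable_indicator hE
      rw [ae_restrict_iff' hE]
      refine Filter.Eventually.of_forall fun t ht => ?_
      rw [Real.norm_of_nonneg (by positivity)]
      exact Real.rpow_le_rpow (norm_nonneg _) ht.2.1.2 hq0.le
    have hS : ∫⁻ t in I ∩ J n, ‖z t‖ₑ ^ q = ∫⁻ t, ENNReal.ofReal (f t) := by
      rw [← lintegral_indicator hE]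
      congr 1; ext t
      by_cases ht : t ∈ I ∩ J n
      · rw [hf, Set.indicator_of_mem ht, Set.indicator_of_mem ht, ← ofReal_norm,
          ENNReal.ofReal_rpow_of_nonneg (norm_nonneg _) hq0.le]
      · rw [hf, Set.indicator_of_notMem ht, Set.indicator_of_notMem ht, ENNReal.ofReal_zero]
    have hfin : ∫⁻ t in I ∩ J n, ‖z t‖ₑ ^ q ≠ ⊤ := by
      rw [hS]
      have := hfi.2.ne
      refine ne_top_of_le_ne_top this (lintegral_mono fun t => ?_)
      rw [← ofReal_norm]
      exact ENNReal.ofReal_le_ofReal (le_abs_self _)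
    refine rpow_le_of_le_mul_rpow hpq hfin ?_
    have h1 := h G hGN hGI
    have h2 : ‖∫ t, inner ℂ (toL2 (G t)) (u t)‖ₑ = ∫⁻ t in I ∩ J n, ‖z t‖ₑ ^ q := by
      rw [hS, ← enorm_integral_ofReal hfi hf0]
      congr 2; ext t
      by_cases ht : t ∈ I ∩ J n
      · rw [hGe t ht, (hg _).toL2_smul, inner_smul_left, hf, Set.indicator_of_mem ht,
          ← inner_dualPow hq1, RCLike.inner_apply, mul_comm]
      · rw [hG0 t ht, toL2_zero, inner_zero_left, hf, Set.indicator_of_notMem ht, Complex.ofReal_zero]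
    have h4 : mnorm p ρ G ≤ (∫⁻ t in I ∩ J n, ‖z t‖ₑ ^ q) ^ (1 / p) := by
      rw [mnorm, lnorm, ← lintegral_indicator hE]
      refine ENNReal.rpow_le_rpow (lintegral_mono fun t => ?_) (one_div_nonneg.2 hpq.nonneg)
      by_cases ht : t ∈ I ∩ J n
      · rw [Set.indicator_of_mem ht, hGe t ht, snorm_smul hρ, enorm_dualPow hq1]
        calc _ ≤ (‖z t‖ₑ ^ (q - 1) * 1) ^ p :=
              ENNReal.rpow_le_rpow (mul_le_mul_right (hg1 _) _) hpq.nonneg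
          _ = _ := by rw [mul_one, ← ENNReal.rpow_mul, hpq.symm.sub_one_mul_conj]
      · rw [hG0 t ht, snorm_eq_eLpNorm hρ, eLpNorm_zero, ENNReal.zero_rpow_of_pos hpq.pos]
        exact zero_le
    rw [h2] at h1
    exact h1.trans (mul_le_mul_right h4 _)
  have hM : ∀ n, ∫⁻ t in I ∩ J n, ‖z t‖ₑ ^ q ≤ M ^ q := fun n => by
    have := ENNReal.rpow_le_rpow (key n) hq0.le
    rwa [← ENNReal.rpow_mul, one_div_mul_cancel hq0.ne', ENNReal.rpow_one] at this
  have hsup : ∫⁻ t in I, ‖z t‖ₑ ^ q = ⨆ n, ∫⁻ t in I ∩ J n, ‖z t‖ₑ ^ q := by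
    rw [← setLIntegral_iUnion_of_directed _ (Monotone.directed_le fun n m hnm =>
      Set.inter_subset_inter_right I (hJmono hnm)), ← Set.inter_iUnion, hJU, Set.inter_univ]
  calc _ ≤ (M ^ q) ^ (1 / q) := ENNReal.rpow_le_rpow (hsup.trans_le (iSup_le hM)) (by positivity)
    _ = M := by rw [← ENNReal.rpow_mul, mul_one_div_cancel hq0.ne', ENNReal.rpow_one]

/-- The norm ‖u(t)‖_r is an increasing limit of pairings with test functions chosen measurably in t.
Each selection satisfies the bound by duality in time alone, and monotone convergence passes to the
limit. -/
lemma lintegral_eLpNorm_rpow_le_of_duality {p q ρ : ℝ} (hpq : p.HolderConjugate q) (hρ : 1 ≤ ρ)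
    {r : ℝ≥0∞} (hr : (ENNReal.ofReal ρ).HolderConjugate r) {u : ℝ → L2 d}
    (hu : StronglyMeasurable u) {I : Set ℝ} (hI : MeasurableSet I) {M : ℝ≥0∞}
    (h : ∀ G : ℝ → Space d → ℂ, Nice G → (∀ t, t ∉ I → G t = 0) →
      ‖∫ t, inner ℂ (toL2 (G t)) (u t)‖ₑ ≤ M * mnorm p ρ G) :
    (∫⁻ t in I, eLpNorm (u t) r volume ^ q) ^ (1 / q) ≤ M := by
  have hq0 : 0 < q := hpq.symm.pos
  obtain ⟨g, hg, hg1, hgu⟩ := exists_norming_seq d hρ hr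
  have hζ : ∀ n, Measurable fun t => ‖inner ℂ (toL2 (g n)) (u t)‖ₑ := fun n =>
    (measurable_inner_apply hu (toL2 (g n))).enorm
  obtain ⟨k, hk, hkm, hmono, hsup⟩ := exists_measurable_selection hζ
  have h1 : ∀ t, eLpNorm (u t) r volume ^ q = ⨆ N, ‖inner ℂ (toL2 (g (k N t))) (u t)‖ₑ ^ q := by
    intro t
    rw [hgu, ← hsup t]
    exact (ENNReal.orderIsoRpow q hq0).map_iSup _
  simp_rw [h1]
  rw [lintegral_iSup (fun N => (hkm N).pow_const q) fun N N' hN t =>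
    ENNReal.rpow_le_rpow (hmono t hN) hq0.le]
  have hM : ∀ N, ∫⁻ t in I, ‖inner ℂ (toL2 (g (k N t))) (u t)‖ₑ ^ q ≤ M ^ q := fun N => by
    have := ENNReal.rpow_le_rpow (lnorm_selection_le hpq (by linarith) hu hI h hg hg1 (hk N)) hq0.le
    rwa [← ENNReal.rpow_mul, one_div_mul_cancel hq0.ne', ENNReal.rpow_one] at this
  calc _ ≤ (M ^ q) ^ (1 / q) := ENNReal.rpow_le_rpow (iSup_le hM) (by positivity)
    _ = M := by rw [← ENNReal.rpow_mul, mul_one_div_cancel hq0.ne', ENNReal.rpow_one]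

end

section

variable {d : ℕ} {γ : ℝ} {I : Set ℝ} {U : ℝ → L2 d →L[ℂ] L2 d} {F G : ℝ → Space d → ℂ} {D : Set ℝ}
  {ρ θ : ℝ} {r : ℝ≥0∞} {K : ℝ≥0∞}

/-! ### Hölder's inequality in time -/

lemma holderConjugate_one_div (h0 : 0 < θ) (h1 : θ < 1) :
    (1 / (1 - θ)).HolderConjugate (1 / θ) :=
  Real.holderConjugate_one_div (by linarith) h0 (by ring)

lemma eLpNorm_inv_ofReal {α : Type*} [MeasurableSpace α] (μ : Measure α) (h0 : 0 < θ) (b : α → ℝ≥0∞) :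
    eLpNorm b (ENNReal.ofReal θ)⁻¹ μ = (∫⁻ t, b t ^ (1 / θ) ∂μ) ^ θ := by
  rw [eLpNorm_eq_lintegral_rpow_enorm_toReal (by simp) (by simpa using h0),
    ← ENNReal.ofReal_inv_of_pos h0, ENNReal.toReal_ofReal (by positivity)]
  simp

/-- Writing the time exponent as the inverse of θ keeps q = ∞ in the same formula, as θ = 0. -/
lemma lintegral_mul_le_lnorm_mul_eLpNorm {α : Type*} [MeasurableSpace α] {μ : Measure α} (h0 : 0 ≤ θ)
    (h1 : θ < 1) {a b : α → ℝ≥0∞} (ha : Measurable a) (hb : Measurable b) :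
    ∫⁻ t, a t * b t ∂μ ≤ lnorm (1 / (1 - θ)) a μ * eLpNorm b (ENNReal.ofReal θ)⁻¹ μ := by
  rcases eq_or_lt_of_le h0 with rfl | h0
  · have hle : ∀ᵐ t ∂μ, b t ≤ eLpNormEssSup b μ := ae_le_eLpNormEssSup
    calc ∫⁻ t, a t * b t ∂μ ≤ ∫⁻ t, a t * eLpNormEssSup b μ ∂μ := by
          refine lintegral_mono_ae ?_
          filter_upwards [hle] with t ht using mul_le_mul_right ht _
      _ = _ := by
          rw [lintegral_mul_const _ ha, ENNReal.ofReal_zero, ENNReal.inv_zero,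
            eLpNorm_exponent_top]
          simp [lnorm]
  · have := ENNReal.lintegral_mul_le_Lp_mul_Lq μ (holderConjugate_one_div h0 h1) ha.aemeasurable
      hb.aemeasurable
    rw [eLpNorm_inv_ofReal μ h0, lnorm]
    rwa [one_div_one_div θ] at this

lemma mixedNorm_top_two_le (I : Set ℝ) {u : ℝ → L2 d} {M : ℝ≥0∞} (h : ∀ t, ‖u t‖ₑ ≤ M) :
    mixedNorm ⊤ 2 I (fun t => u t) ≤ M := by
  rw [mixedNorm, eLpNorm_exponent_top]
  refine eLpNormEssSup_le_of_ae_enorm_bound (Filter.Eventually.of_forall fun t => ?_)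
  rw [enorm_eq_self, ← Lp.enorm_def]
  exact h t

/-! ### Space exponents -/

lemma inv_eq_ofReal (hρ : 0 < ρ) (hr : (ENNReal.ofReal ρ).HolderConjugate r) :
    r⁻¹ = ENNReal.ofReal (1 - 1 / ρ) := by
  have h1 := (ENNReal.holderConjugate_iff.1 hr)
  rw [← ENNReal.ofReal_inv_of_pos hρ] at h1
  rw [ENNReal.ofReal_sub _ (by positivity), ENNReal.ofReal_one, one_div, ← h1,
    ENNReal.add_sub_cancel_left (by simp)]

lemma eq_two_of_holderConjugate (hr : (ENNReal.ofReal 2).HolderConjugate r) : r = 2 := by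
  have h : r⁻¹ = (2 : ℝ≥0∞)⁻¹ := by
    rw [inv_eq_ofReal two_pos hr, show (1 : ℝ) - 1 / 2 = 2⁻¹ by norm_num,
      ENNReal.ofReal_inv_of_pos two_pos]
    simp
  exact inv_inj.1 h

/-- Interpolation of Lebesgue norms between `L²` and `L^{r'}`. -/
lemma eLpNorm_le_rpow_mul_rpow {ρ' : ℝ} {r' : ℝ≥0∞} (hρ : 1 ≤ ρ) (hρ' : 1 ≤ ρ')
    (hr : (ENNReal.ofReal ρ).HolderConjugate r) (hr' : (ENNReal.ofReal ρ').HolderConjugate r')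
    {τ : ℝ} (h0 : 0 < τ) (h1 : τ ≤ 1) (h : 1 / ρ - 1 / 2 = τ * (1 / ρ' - 1 / 2)) (u : L2 d) :
    eLpNorm u r volume ≤ ‖u‖ₑ ^ (1 - τ) * eLpNorm u r' volume ^ τ := by
  have hi := inv_eq_ofReal (by linarith) hr
  have hi' := inv_eq_ofReal (by linarith) hr'
  have hle' : 1 / ρ' ≤ 1 := by rw [div_le_one (by linarith)]; exact hρ'
  rcases eq_or_lt_of_le h1 with rfl | h1
  · have : r = r' := by
      rw [← inv_inj, hi, hi']; congr 1; linarith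
    rw [this]; simp
  have hum := Lp.aestronglyMeasurable u
  have ht : ENNReal.ofReal τ ≠ 0 := by simpa using h0
  have ht' : ENNReal.ofReal (1 - τ) ≠ 0 := by simpa using h1
  -- Hölder's inequality is applied to |u| = |u| ^ τ |u| ^ (1 - τ), the factors being in L^{r'/τ}
  -- and L^{2/(1-τ)}; r' may be infinite.
  have htriple : ENNReal.HolderTriple (2 / ENNReal.ofReal (1 - τ)) (r' / ENNReal.ofReal τ) r := by
    constructor
    rw [ENNReal.inv_div (by simp) (by simp [ht']), ENNReal.inv_div (by simp) (by simp [ht]),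
      div_eq_mul_inv, div_eq_mul_inv, hi, hi',
      show (2 : ℝ≥0∞)⁻¹ = ENNReal.ofReal (1 / 2) by
        rw [one_div, ENNReal.ofReal_inv_of_pos two_pos]; simp,
      ← ENNReal.ofReal_mul (by linarith), ← ENNReal.ofReal_mul h0.le,
      ← ENNReal.ofReal_add (by linarith) (mul_nonneg h0.le (by linarith))]
    congr 1; linarith
  have hm : ∀ e : ℝ, AEStronglyMeasurable (fun x => ‖u x‖ ^ e) (volume : Measure (Space d)) :=
    fun e => (((Lp.stronglyMeasurable u).measurable.norm).pow_const e).aestronglyMeasurable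
  have h2 := eLpNorm_smul_le_mul_eLpNorm (μ := volume) (hm τ) (hm (1 - τ)) (hpqr := htriple)
  rw [eLpNorm_norm_rpow _ h0, eLpNorm_norm_rpow _ (by linarith : 0 < 1 - τ),
    ENNReal.div_mul_cancel ht (by simp), ENNReal.div_mul_cancel ht' (by simp), ← Lp.enorm_def] at h2
  refine le_trans (le_of_eq ?_) h2
  refine eLpNorm_congr_norm_ae (Filter.Eventually.of_forall fun x => ?_)
  rw [Pi.smul_apply', smul_eq_mul, norm_mul, Real.norm_of_nonneg (by positivity),
    Real.norm_of_nonneg (by positivity)]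
  rcases eq_or_ne (u x) 0 with hx | hx
  · rw [hx, norm_zero, Real.zero_rpow h0.ne', mul_zero]
  · rw [← Real.rpow_add (by simpa using hx)]; norm_num

/-! ### Estimates for the retarded integral of test functions -/

lemma Contractive.stronglyMeasurable_apply (h : Contractive U) {u : ℝ → L2 d}
    (hu : StronglyMeasurable u) : StronglyMeasurable fun t => U t (u t) := by
  refine stronglyMeasurable_of_inner fun v => ?_
  simp_rw [← ContinuousLinearMap.adjoint_inner_left]
  exact (StronglyMeasurable.inner (𝕜 := ℂ)
    (h.stronglyMeasurable_adjoint (stronglyMeasurable_const (b := v))) hu).measurable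

/-- The function `∫_{t - s ∈ D} U(s)^* F(s) ds`. -/
def retard (U : ℝ → L2 d →L[ℂ] L2 d) (D : Set ℝ) (F : ℝ → Space d → ℂ) (t : ℝ) : L2 d :=
  ∫ s in (fun s => t - s) ⁻¹' D, evo U F s

lemma Contractive.stronglyMeasurable_retard (h : Contractive U) (hD : MeasurableSet D) (hF : Nice F) :
    StronglyMeasurable (retard U D F) := by
  have h1 : StronglyMeasurable fun z : ℝ × ℝ =>
      ({z : ℝ × ℝ | z.1 - z.2 ∈ D}.indicator (fun z => evo U F z.2)) z :=
    ((h.stronglyMeasurable_evo hF).comp_measurable measurable_snd).indicator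
      (hD.preimage (measurable_fst.sub measurable_snd))
  convert h1.integral_prod_right' (ν := (volume : Measure ℝ)) using 1
  ext1 t
  rw [retard, ← integral_indicator (hD.preimage (by fun_prop))]
  rfl

/-- Bounds for the form are thereby dual bounds for t ↦ U(t) ∫_{t-s∈D} U(s)^* F(s) ds. -/
lemma Contractive.enorm_integral_inner_retard (h : Contractive U) (hD : MeasurableSet D) (hF : Nice F)
    (hG : Nice G) :
    ‖∫ t, inner ℂ (toL2 (G t)) (U t (retard U D F t))‖ₑ = ‖bform U D F G‖ₑ := by
  rw [h.bform_eq_integral hD hF hG, ← RCLike.enorm_conj, ← integral_conj]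
  congr 2; ext t
  rw [inner_conj_symm, evo, ContinuousLinearMap.adjoint_inner_right]
  rfl

/-- The bilinear `L^p_t L^ρ_x` estimate for a fixed family of operators. -/
structure FormBound (γ : ℝ) (I : Set ℝ) (U : ℝ → L2 d →L[ℂ] L2 d) (ρ : ℝ) (K : ℝ≥0∞) : Prop where
  one_le : 1 ≤ ρ
  le_two : ρ ≤ 2
  timeExp_le : timeExp γ ρ ≤ 1 / 2
  ne_top : K ≠ ⊤
  one_le_const : timeExp γ ρ = 0 → 1 ≤ K
  enorm_bform_le : ∀ D : Set ℝ, MeasurableSet D → ∀ F G : ℝ → Space d → ℂ, Nice F → Nice G →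
      (∀ t, t ∉ I → F t = 0) → (∀ t, t ∉ I → G t = 0) →
      ‖bform U D F G‖ₑ ≤ K ^ (2 : ℝ) *
        (mnorm (1 / (1 - timeExp γ ρ)) ρ F * mnorm (1 / (1 - timeExp γ ρ)) ρ G)

lemma FormBound.pos (hB : FormBound γ I U ρ K) : 0 < ρ := by linarith [hB.one_le]

lemma FormBound.timeExp_nonneg (hB : FormBound γ I U ρ K) (hγ : 0 < γ) : 0 ≤ timeExp γ ρ := by
  refine mul_nonneg hγ.le ?_
  rw [sub_nonneg]
  exact one_div_le_one_div_of_le hB.pos hB.le_two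

lemma timeExp_eq_zero (hγ : 0 < γ) (h : timeExp γ ρ = 0) : ρ = 2 := by
  rw [timeExp, mul_eq_zero, or_iff_right hγ.ne', sub_eq_zero, one_div, one_div,
    inv_inj] at h
  exact h

/-- The form with F = G and D = ℝ is the square of the left side; this is why the constant of the
form is written as K². -/
lemma FormBound.enorm_integral_evo_le (hB : FormBound γ I U ρ K) (h : Contractive U) (hF : Nice F)
    (hFI : ∀ t, t ∉ I → F t = 0) :
    ‖∫ t, evo U F t‖ₑ ≤ K * mnorm (1 / (1 - timeExp γ ρ)) ρ F := by
  have h1 := hB.enorm_bform_le Set.univ MeasurableSet.univ F F hF hF hFI hFI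
  have h2 : ‖inner ℂ (∫ t, evo U F t) (∫ t, evo U F t)‖ₑ = ‖∫ t, evo U F t‖ₑ ^ (2 : ℝ) := by
    rw [inner_self_eq_norm_sq_to_K, ← ofReal_norm, ← ofReal_norm,
      ENNReal.ofReal_rpow_of_nonneg (norm_nonneg _) (by norm_num)]
    simp
  rw [h.bform_univ hF hF, h2] at h1
  refine (ENNReal.rpow_le_rpow_iff two_pos).1 (h1.trans (le_of_eq ?_))
  rw [ENNReal.mul_rpow_of_nonneg _ _ two_pos.le]
  congr 1
  rw [← sq, ← ENNReal.rpow_natCast]; norm_num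

lemma FormBound.enorm_setIntegral_evo_le (hB : FormBound γ I U ρ K) (h : Contractive U) (hF : Nice F)
    (hFI : ∀ t, t ∉ I → F t = 0) {S : Set ℝ} (hS : MeasurableSet S) :
    ‖∫ t in S, evo U F t‖ₑ ≤ K * mnorm (1 / (1 - timeExp γ ρ)) ρ F := by
  have hp : 0 < 1 - timeExp γ ρ := by linarith [hB.timeExp_le]
  rw [← integral_evo_indicator hS]
  refine (hB.enorm_integral_evo_le h (hF.indicator hS) fun t ht => ?_).trans ?_
  · by_cases hs : t ∈ S
    · rw [Set.indicator_of_mem hs, hFI t ht]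
    · rw [Set.indicator_of_notMem hs]
  · refine mul_le_mul_right (ENNReal.rpow_le_rpow (lintegral_mono fun t =>
      ENNReal.rpow_le_rpow ?_ (by positivity)) (by positivity)) _
    by_cases hs : t ∈ S
    · rw [Set.indicator_of_mem hs]
    · rw [Set.indicator_of_notMem hs, snorm_eq_eLpNorm hB.pos, eLpNorm_zero]; exact zero_le

lemma FormBound.mixedNorm_le_of_duality (hB : FormBound γ I U ρ K)
    (hr : (ENNReal.ofReal ρ).HolderConjugate r) (hI : MeasurableSet I) (h0 : 0 < timeExp γ ρ)
    {u : ℝ → L2 d} (hu : StronglyMeasurable u) {M : ℝ≥0∞}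
    (h : ∀ G : ℝ → Space d → ℂ, Nice G → (∀ t, t ∉ I → G t = 0) →
      ‖∫ t, inner ℂ (toL2 (G t)) (u t)‖ₑ ≤ M * mnorm (1 / (1 - timeExp γ ρ)) ρ G) :
    mixedNorm (ENNReal.ofReal (timeExp γ ρ))⁻¹ r I (fun t => u t) ≤ M := by
  have h1 := lintegral_eLpNorm_rpow_le_of_duality
    (holderConjugate_one_div h0 (by linarith [hB.timeExp_le])) hB.one_le hr hu hI h
  rw [one_div_one_div] at h1
  rwa [mixedNorm, eLpNorm_inv_ofReal _ h0]

/-- The homogeneous estimate. -/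
lemma FormBound.mixedNorm_apply_le (hB : FormBound γ I U ρ K) (h : Contractive U) (hγ : 0 < γ)
    (hr : (ENNReal.ofReal ρ).HolderConjugate r) (hI : MeasurableSet I) (φ : L2 d) :
    mixedNorm (ENNReal.ofReal (timeExp γ ρ))⁻¹ r I (fun t => U t φ) ≤ K * ‖φ‖ₑ := by
  -- For θ = 0 the pair is (∞, 2), outside the range of the duality lemma. Contractivity gives
  -- constant 1, and K ≥ 1 is part of the hypotheses in this case.
  rcases eq_or_lt_of_le (hB.timeExp_nonneg hγ) with h0 | h0
  · have hρ := timeExp_eq_zero hγ h0.symm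
    rw [hρ] at hr
    rw [← h0, eq_two_of_holderConjugate hr, ENNReal.ofReal_zero, ENNReal.inv_zero]
    refine mixedNorm_top_two_le I (u := fun t => U t φ) fun t => ?_
    refine (enorm_le_iff_norm_le.2 (h.norm_apply_le t φ)).trans ?_
    calc ‖φ‖ₑ = 1 * ‖φ‖ₑ := (one_mul _).symm
      _ ≤ _ := mul_le_mul_left (hB.one_le_const h0.symm) _
  · refine hB.mixedNorm_le_of_duality hr hI h0 (h.continuous_apply φ).stronglyMeasurable
      fun G hG hGI => ?_
    have h1 : ∫ t, inner ℂ (toL2 (G t)) (U t φ) = inner ℂ (∫ t, evo U G t) φ := by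
      rw [← inner_conj_symm, ← integral_inner (h.integrable_evo hG), ← integral_conj]
      congr 1; ext t
      rw [inner_conj_symm, evo, ContinuousLinearMap.adjoint_inner_left]
    rw [h1]
    refine (enorm_inner_le _ _).trans ?_
    calc _ ≤ K * mnorm (1 / (1 - timeExp γ ρ)) ρ G * ‖φ‖ₑ :=
          mul_le_mul_left (hB.enorm_integral_evo_le h hG hGI) _
      _ = _ := by ring

end

/-! ### Retarded estimates with different exponents on the two sides -/

section

variable {d : ℕ} {γ : ℝ} {I : Set ℝ} {U : ℝ → L2 d →L[ℂ] L2 d} {F G : ℝ → Space d → ℂ} {D : Set ℝ}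
  {ρ ρ' θ : ℝ} {r r' : ℝ≥0∞} {K K' L : ℝ≥0∞}

lemma measurableSet_sub_preimage (hD : MeasurableSet D) (t : ℝ) :
    MeasurableSet ((fun s => t - s) ⁻¹' D) := hD.preimage (by fun_prop)

lemma FormBound.enorm_apply_retard_le (hB : FormBound γ I U ρ K) (h : Contractive U)
    (hD : MeasurableSet D) (hF : Nice F) (hFI : ∀ t, t ∉ I → F t = 0) (t : ℝ) :
    ‖U t (retard U D F t)‖ₑ ≤ K * mnorm (1 / (1 - timeExp γ ρ)) ρ F :=
  (enorm_le_iff_norm_le.2 (h.norm_apply_le t _)).trans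
    (hB.enorm_setIntegral_evo_le h hF hFI (measurableSet_sub_preimage hD t))

lemma timeExp_div (hγ : γ ≠ 0) : timeExp γ ρ' / timeExp γ ρ = (1 / ρ' - 1 / 2) / (1 / ρ - 1 / 2) := by
  rw [timeExp, timeExp, mul_div_mul_left _ _ hγ]

/-- The retarded estimate when the left side has the larger time exponent. -/
lemma FormBound.mixedNorm_retard_le_of_le (hB : FormBound γ I U ρ K) (h : Contractive U) (hγ : 0 < γ)
    (hr : (ENNReal.ofReal ρ).HolderConjugate r) (hρ' : 1 ≤ ρ')
    (hr' : (ENNReal.ofReal ρ').HolderConjugate r') (h0 : 0 ≤ timeExp γ ρ')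
    (hle : timeExp γ ρ' ≤ timeExp γ ρ) (hI : MeasurableSet I) (hD : MeasurableSet D) (hF : Nice F)
    (hFI : ∀ t, t ∉ I → F t = 0) :
    mixedNorm (ENNReal.ofReal (timeExp γ ρ'))⁻¹ r' I (fun t => U t (retard U D F t))
      ≤ K ^ (1 + timeExp γ ρ' / timeExp γ ρ) * mnorm (1 / (1 - timeExp γ ρ)) ρ F := by
  have hL2 := hB.enorm_apply_retard_le h hD hF hFI
  rcases eq_or_lt_of_le h0 with h0 | h0
  · rw [timeExp_eq_zero hγ h0.symm] at hr'
    rw [← h0, eq_two_of_holderConjugate hr', ENNReal.ofReal_zero, ENNReal.inv_zero, zero_div,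
      add_zero, ENNReal.rpow_one]
    exact mixedNorm_top_two_le I (u := fun t => U t (retard U D F t)) hL2
  set N := mnorm (1 / (1 - timeExp γ ρ)) ρ F
  set τ := timeExp γ ρ' / timeExp γ ρ with hτ
  have h0' : 0 < timeExp γ ρ := h0.trans_le hle
  have hτ0 : 0 < τ := div_pos h0 h0'
  have hτ1 : τ ≤ 1 := (div_le_one h0').2 hle
  have hu : StronglyMeasurable fun t => U t (retard U D F t) :=
    h.stronglyMeasurable_apply (h.stronglyMeasurable_retard hD hF)
  -- One end of the interpolation: the diagonal estimate with constant K². The other end, `hL2`, is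
  -- the bound in L² uniform in t with constant K. With parameter τ the constant is K ^ (2τ + 1 - τ)
  -- = K ^ (1 + τ).
  have hdiag : mixedNorm (ENNReal.ofReal (timeExp γ ρ))⁻¹ r I (fun t => U t (retard U D F t))
      ≤ K ^ (2 : ℝ) * N := by
    refine hB.mixedNorm_le_of_duality hr hI h0' hu fun G hG hGI => ?_
    rw [h.enorm_integral_inner_retard hD hF hG]
    exact (hB.enorm_bform_le D hD F G hF hG hFI hGI).trans (by rw [mul_assoc])
  have hpt : ∀ t, eLpNorm (U t (retard U D F t)) r' volume ≤
      (K * N) ^ (1 - τ) * eLpNorm (U t (retard U D F t)) r volume ^ τ := fun t => by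
    refine (eLpNorm_le_rpow_mul_rpow hρ' hB.one_le hr' hr hτ0 hτ1 ?_ _).trans
      (mul_le_mul_left (ENNReal.rpow_le_rpow (hL2 t) (by linarith)) _)
    have hne : 1 / ρ - 1 / 2 ≠ 0 := fun h => h0'.ne' (by rw [timeExp, h, mul_zero])
    rw [hτ, timeExp_div hγ.ne', div_mul_cancel₀ _ hne]
  rw [mixedNorm, eLpNorm_inv_ofReal _ h0]
  rw [mixedNorm, eLpNorm_inv_ofReal _ h0'] at hdiag
  set a := K * N with ha
  set m : ℝ → ℝ≥0∞ := fun t => eLpNorm (U t (retard U D F t)) r volume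
  calc _ ≤ (∫⁻ t in I, (a ^ (1 - τ)) ^ (1 / timeExp γ ρ') * m t ^ (1 / timeExp γ ρ)) ^ timeExp γ ρ' := by
        refine ENNReal.rpow_le_rpow (lintegral_mono fun t => ?_) h0.le
        refine (ENNReal.rpow_le_rpow (hpt t) (by positivity)).trans (le_of_eq ?_)
        rw [ENNReal.mul_rpow_of_nonneg _ _ (by positivity), ← ENNReal.rpow_mul _ τ]
        congr 2
        rw [hτ]; field_simp
    _ = a ^ (1 - τ) * ((∫⁻ t in I, m t ^ (1 / timeExp γ ρ)) ^ timeExp γ ρ) ^ τ := by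
        rw [lintegral_const_mul _ ((measurable_eLpNorm_apply hB.one_le hr hu).pow_const _),
          ENNReal.mul_rpow_of_nonneg _ _ h0.le, ← ENNReal.rpow_mul _ (1 / timeExp γ ρ'),
          one_div_mul_cancel h0.ne', ENNReal.rpow_one, ← ENNReal.rpow_mul _ (timeExp γ ρ), hτ,
          mul_div_cancel₀ _ h0'.ne']
    _ ≤ a ^ (1 - τ) * (K * a) ^ τ := by
        refine mul_le_mul_right (ENNReal.rpow_le_rpow (hdiag.trans (le_of_eq ?_)) hτ0.le) _
        rw [ha, ← mul_assoc, ← sq, ← ENNReal.rpow_natCast]; norm_num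
    _ = a * K ^ τ := by
        rw [ENNReal.mul_rpow_of_nonneg _ _ hτ0.le, mul_left_comm,
          ← ENNReal.rpow_add_of_nonneg _ _ (by linarith) hτ0.le, mul_comm]
        norm_num
    _ = _ := by
        rw [ENNReal.rpow_add_of_nonneg _ _ zero_le_one hτ0.le, ENNReal.rpow_one, ha]; ring

/-- Hölder's inequality in space-time for the pairing with a test function. -/
lemma enorm_integral_inner_le_mnorm_mul (hρ : 1 ≤ ρ) (hr : (ENNReal.ofReal ρ).HolderConjugate r)
    (h0 : 0 ≤ θ) (h1 : θ < 1) (hG : Nice G) (hGI : ∀ t, t ∉ I → G t = 0) {u : ℝ → L2 d}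
    (hu : StronglyMeasurable u) :
    ‖∫ t, inner ℂ (toL2 (G t)) (u t)‖ₑ ≤
      mnorm (1 / (1 - θ)) ρ G * mixedNorm (ENNReal.ofReal θ)⁻¹ r I (fun t => u t) := by
  have hρ0 : 0 < ρ := by linarith
  have h2 : ∫ t, inner ℂ (toL2 (G t)) (u t) = ∫ t in I, inner ℂ (toL2 (G t)) (u t) :=
    (setIntegral_eq_integral_of_forall_compl_eq_zero fun t ht => by
      rw [hGI t ht, toL2_zero, inner_zero_left]).symm
  rw [h2]
  calc _ ≤ ∫⁻ t in I, ‖inner ℂ (toL2 (G t)) (u t)‖ₑ := enorm_integral_le_lintegral_enorm _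
    _ ≤ ∫⁻ t in I, snorm ρ (G t) * eLpNorm (u t) r volume :=
        lintegral_mono fun t => (hG.test t).enorm_inner_toL2_le hρ0 hr (u t)
    _ ≤ lnorm (1 / (1 - θ)) (fun t => snorm ρ (G t)) (volume.restrict I) *
          eLpNorm (fun t => eLpNorm (u t) r volume) (ENNReal.ofReal θ)⁻¹ (volume.restrict I) :=
        lintegral_mul_le_lnorm_mul_eLpNorm h0 h1 (hG.measurable_snorm ρ)
          (measurable_eLpNorm_apply hρ hr hu)
    _ ≤ _ := by
        refine mul_le_mul_left (ENNReal.rpow_le_rpow ?_ ?_) _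
        · exact lintegral_mono' Measure.restrict_le_self le_rfl
        · rw [one_div_one_div]; linarith

/-- Returning to the form makes the one-sided estimate symmetric: transposing it covers the opposite
order of the time exponents. -/
lemma FormBound.enorm_bform_le_of_le (hB : FormBound γ I U ρ K) (h : Contractive U) (hγ : 0 < γ)
    (hr : (ENNReal.ofReal ρ).HolderConjugate r) (hρ' : 1 ≤ ρ')
    (hr' : (ENNReal.ofReal ρ').HolderConjugate r') (h0 : 0 ≤ timeExp γ ρ')
    (hle : timeExp γ ρ' ≤ timeExp γ ρ) (hI : MeasurableSet I) (hD : MeasurableSet D) (hF : Nice F)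
    (hFI : ∀ t, t ∉ I → F t = 0) (hG : Nice G) (hGI : ∀ t, t ∉ I → G t = 0) :
    ‖bform U D F G‖ₑ ≤ K ^ (1 + timeExp γ ρ' / timeExp γ ρ) *
      (mnorm (1 / (1 - timeExp γ ρ)) ρ F * mnorm (1 / (1 - timeExp γ ρ')) ρ' G) := by
  have hu : StronglyMeasurable fun t => U t (retard U D F t) :=
    h.stronglyMeasurable_apply (h.stronglyMeasurable_retard hD hF)
  rw [← h.enorm_integral_inner_retard hD hF hG]
  refine (enorm_integral_inner_le_mnorm_mul hρ' hr' h0 (by linarith [hB.timeExp_le]) hG hGI hu).trans ?_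
  refine (mul_le_mul_right (hB.mixedNorm_retard_le_of_le h hγ hr hρ' hr' h0 hle hI hD hF hFI) _).trans
    (le_of_eq (by ring))

/-- The retarded estimate for test functions. -/
lemma FormBound.mixedNorm_retard_le (hB : FormBound γ I U ρ K) (hB' : FormBound γ I U ρ' K')
    (h : Contractive U) (hγ : 0 < γ) (hr : (ENNReal.ofReal ρ).HolderConjugate r)
    (hr' : (ENNReal.ofReal ρ').HolderConjugate r')
    (hL : timeExp γ ρ' ≤ timeExp γ ρ → K ^ (1 + timeExp γ ρ' / timeExp γ ρ) ≤ L)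
    (hL' : timeExp γ ρ ≤ timeExp γ ρ' → K' ^ (1 + timeExp γ ρ / timeExp γ ρ') ≤ L)
    (hI : MeasurableSet I) (hD : MeasurableSet D) (hF : Nice F) (hFI : ∀ t, t ∉ I → F t = 0) :
    mixedNorm (ENNReal.ofReal (timeExp γ ρ'))⁻¹ r' I (fun t => U t (retard U D F t))
      ≤ L * mnorm (1 / (1 - timeExp γ ρ)) ρ F := by
  rcases le_total (timeExp γ ρ') (timeExp γ ρ) with hle | hle
  · exact (hB.mixedNorm_retard_le_of_le h hγ hr hB'.one_le hr' (hB'.timeExp_nonneg hγ) hle hI hD hF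
      hFI).trans (mul_le_mul_left (hL hle) _)
  rcases eq_or_lt_of_le (hB'.timeExp_nonneg hγ) with h0 | h0
  · have hle' : timeExp γ ρ' ≤ timeExp γ ρ := by rw [← h0]; exact hB.timeExp_nonneg hγ
    exact (hB.mixedNorm_retard_le_of_le h hγ hr hB'.one_le hr' (hB'.timeExp_nonneg hγ) hle' hI hD hF
      hFI).trans (mul_le_mul_left (hL hle') _)
  -- Here F carries the smaller θ. The form is transposed, so that G takes the place of the
  -- inhomogeneity and D is reflected.
  · refine hB'.mixedNorm_le_of_duality hr' hI h0
      (h.stronglyMeasurable_apply (h.stronglyMeasurable_retard hD hF)) fun G hG hGI => ?_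
    rw [h.enorm_integral_inner_retard hD hF hG, enorm_bform_swap]
    refine (hB'.enorm_bform_le_of_le h hγ hr' hB.one_le hr (hB.timeExp_nonneg hγ) hle hI
      (hD.preimage measurable_neg) hG hGI hF hFI).trans ?_
    refine (mul_le_mul_left (hL' hle) _).trans (le_of_eq (by ring))

end

section

variable {d : ℕ} {γ : ℝ} {I : Set ℝ} {U : ℝ → L2 d →L[ℂ] L2 d} {F G : ℝ → Space d → ℂ} {D S : Set ℝ}
  {ρ ρ' θ p : ℝ} {r r' : ℝ≥0∞} {K K' L : ℝ≥0∞}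

/-! ### Truncation -/

lemma snorm_mono (hρ : 0 ≤ ρ) {φ ψ : Space d → ℂ} (h : ∀ x, ‖φ x‖ ≤ ‖ψ x‖) : snorm ρ φ ≤ snorm ρ ψ :=
  ENNReal.rpow_le_rpow (lintegral_mono fun x => ENNReal.rpow_le_rpow
    (enorm_le_iff_norm_le.2 (h x)) hρ) (by positivity)

lemma mnorm_mono (hp : 0 ≤ p) (hρ : 0 ≤ ρ) (h : ∀ t x, ‖F t x‖ ≤ ‖G t x‖) :
    mnorm p ρ F ≤ mnorm p ρ G :=
  ENNReal.rpow_le_rpow (lintegral_mono fun t => ENNReal.rpow_le_rpow (snorm_mono hρ (h t)) hp)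
    (by positivity)

/-- The region where `|t|`, `‖x‖` and `‖F(t, x)‖` are at most `n`. -/
def truncRegion (F : ℝ → Space d → ℂ) (n : ℕ) : Set (ℝ × Space d) :=
  {z | |z.1| ≤ n ∧ ‖z.2‖ ≤ n ∧ ‖F z.1 z.2‖ ≤ n}

/-- The truncations of a function on space-time. -/
def trunc (F : ℝ → Space d → ℂ) (n : ℕ) (t : ℝ) (x : Space d) : ℂ :=
  (truncRegion F n).indicator (Function.uncurry F) (t, x)

lemma monotone_truncRegion (F : ℝ → Space d → ℂ) : Monotone (truncRegion F) := fun n m h z hz =>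
  ⟨hz.1.trans (by exact_mod_cast h), hz.2.1.trans (by exact_mod_cast h),
    hz.2.2.trans (by exact_mod_cast h)⟩

lemma norm_trunc_le (F : ℝ → Space d → ℂ) (n : ℕ) (t : ℝ) (x : Space d) : ‖trunc F n t x‖ ≤ ‖F t x‖ :=
  norm_indicator_le_norm_self (Function.uncurry F) (t, x)

lemma trunc_of_eq_zero {t : ℝ} (h : F t = 0) (n : ℕ) : trunc F n t = 0 := by
  ext x
  have := norm_trunc_le F n t x
  rw [h] at this
  simpa using this

lemma nice_trunc (hF : Measurable (Function.uncurry F)) (n : ℕ) : Nice (trunc F n) := by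
  have hm : MeasurableSet (truncRegion F n) :=
    (measurableSet_le (continuous_abs.measurable.comp measurable_fst) measurable_const).inter
      ((measurableSet_le measurable_snd.norm measurable_const).inter
        (measurableSet_le hF.norm measurable_const))
  refine ⟨hF.indicator hm, ⟨n, fun t x => ?_⟩, ⟨n, fun t x hx => ?_⟩⟩
  · by_cases h : (t, x) ∈ truncRegion F n
    · rw [trunc, Set.indicator_of_mem h]; exact h.2.2
    · rw [trunc, Set.indicator_of_notMem h]; simp
  · by_contra hn
    exact hx (Set.indicator_of_notMem (fun h => hn ⟨h.1, h.2.1⟩) _)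

lemma eventually_trunc_eq (F : ℝ → Space d → ℂ) (t : ℝ) (x : Space d) :
    ∀ᶠ n in Filter.atTop, trunc F n t x = F t x := by
  obtain ⟨n, hn⟩ := exists_nat_ge (max |t| (max ‖x‖ ‖F t x‖))
  filter_upwards [Filter.eventually_ge_atTop n] with m hm
  have hmem : (t, x) ∈ truncRegion F n := ⟨(le_max_left _ _).trans hn,
    ((le_max_left _ _).trans (le_max_right _ _)).trans hn,
    ((le_max_right _ _).trans (le_max_right _ _)).trans hn⟩
  exact Set.indicator_of_mem (monotone_truncRegion F hm hmem) _

lemma norm_sub_trunc_le (F : ℝ → Space d → ℂ) (n : ℕ) (t : ℝ) (x : Space d) :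
    ‖F t x - trunc F n t x‖ ≤ ‖F t x‖ := by
  by_cases h : (t, x) ∈ truncRegion F n
  · rw [trunc, Set.indicator_of_mem h]; simp
  · rw [trunc, Set.indicator_of_notMem h]; simp

/-- The truncation regions increase, so the difference of two truncations is dominated by the tail
of the coarser one. This makes the truncated integrals a Cauchy sequence. -/
lemma norm_trunc_sub_trunc_le (F : ℝ → Space d → ℂ) {n m : ℕ} (hnm : n ≤ m) (t : ℝ) (x : Space d) :
    ‖trunc F m t x - trunc F n t x‖ ≤ ‖F t x - trunc F n t x‖ := by
  by_cases h : (t, x) ∈ truncRegion F n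
  · have h' := monotone_truncRegion F hnm h
    rw [trunc, trunc, Set.indicator_of_mem h, Set.indicator_of_mem h']; simp
  · have h2 : trunc F n t x = 0 := Set.indicator_of_notMem h _
    rw [h2, sub_zero, sub_zero]
    exact norm_trunc_le F m t x

lemma ae_snorm_ne_top (hF : Measurable (Function.uncurry F)) (hp : 0 < p) (h : mnorm p ρ F ≠ ⊤) :
    ∀ᵐ t, snorm ρ (F t) ≠ ⊤ := by
  have h1 : ∫⁻ t, snorm ρ (F t) ^ p ≠ ⊤ := by
    rw [← lnorm_rpow hp]; exact ENNReal.rpow_ne_top_of_nonneg hp.le h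
  filter_upwards [ae_lt_top ((measurable_snorm_of_measurable hF ρ).pow_const p) h1] with t ht hn
  rw [hn, ENNReal.top_rpow_of_pos hp] at ht
  exact lt_irrefl _ ht

/-- Dominated convergence is applied in x for almost every t, and then in t. It is available because
both dual exponents are finite. -/
lemma tendsto_mnorm_sub_trunc (hF : Measurable (Function.uncurry F)) (hp : 0 < p) (hρ : 0 < ρ)
    (h : mnorm p ρ F ≠ ⊤) :
    Filter.Tendsto (fun n => mnorm p ρ fun t x => F t x - trunc F n t x) Filter.atTop (nhds 0) := by
  have hm : ∀ n, Measurable (Function.uncurry fun t x => F t x - trunc F n t x) := fun n =>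
    hF.sub (nice_trunc hF n).measurable
  have h0 : ∀ {e : ℝ}, 0 < e → Filter.Tendsto (fun a : ℝ≥0∞ => a ^ e) (nhds 0) (nhds 0) := by
    intro e he
    have := (ENNReal.continuous_rpow_const (y := e)).tendsto 0
    rwa [ENNReal.zero_rpow_of_pos he] at this
  refine (h0 (one_div_pos.2 hp)).comp ?_
  have h1 : ∫⁻ t, snorm ρ (F t) ^ p ≠ ⊤ := by
    rw [← lnorm_rpow hp]; exact ENNReal.rpow_ne_top_of_nonneg hp.le h
  have hz : (0 : ℝ≥0∞) = ∫⁻ _ : ℝ, 0 := by simp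
  rw [hz]
  refine tendsto_lintegral_of_dominated_convergence (fun t => snorm ρ (F t) ^ p)
    (fun n => (measurable_snorm_of_measurable (hm n) ρ).pow_const p)
    (fun n => Filter.Eventually.of_forall fun t => ENNReal.rpow_le_rpow
      (snorm_mono hρ.le (norm_sub_trunc_le F n t)) hp.le) h1 ?_
  filter_upwards [ae_snorm_ne_top hF hp h] with t ht
  refine (h0 hp).comp ((h0 (one_div_pos.2 hρ)).comp ?_)
  have h2 : ∫⁻ x, ‖F t x‖ₑ ^ ρ ≠ ⊤ := by
    rw [← lnorm_rpow hρ]; exact ENNReal.rpow_ne_top_of_nonneg hρ.le ht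
  have hz : (0 : ℝ≥0∞) = ∫⁻ _ : Space d, 0 := by simp
  rw [hz]
  refine tendsto_lintegral_of_dominated_convergence (fun x => ‖F t x‖ₑ ^ ρ)
    (fun n => ((hm n).comp measurable_prodMk_left).enorm.pow_const ρ)
    (fun n => Filter.Eventually.of_forall fun x => ENNReal.rpow_le_rpow
      (enorm_le_iff_norm_le.2 (norm_sub_trunc_le F n t x)) hρ.le) h2
    (Filter.Eventually.of_forall fun x => ?_)
  refine tendsto_const_nhds.congr' ?_
  filter_upwards [eventually_trunc_eq F t x] with n hn
  rw [hn, sub_self, enorm_zero, ENNReal.zero_rpow_of_pos hρ]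

/-! ### The weak integral for functions in the dual mixed norm -/

/-- The integral `∫_S U(s)^* F(s) ds`, as a limit of integrals of truncations. -/
def adjointIntegral (U : ℝ → L2 d →L[ℂ] L2 d) (S : Set ℝ) (F : ℝ → Space d → ℂ) : L2 d :=
  Filter.limUnder Filter.atTop fun n => ∫ s in S, evo U (trunc F n) s

lemma evo_sub (hF : Nice F) (hG : Nice G) (t : ℝ) :
    evo U (fun t x => F t x - G t x) t = evo U F t - evo U G t := by
  have h : (fun x => F t x - G t x) = F t + (-1 : ℂ) • G t := by
    ext x; simp [sub_eq_add_neg]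
  rw [evo, h, (hF.test t).toL2_add ((hG.test t).smul _), (hG.test t).toL2_smul, map_add, map_smul,
    evo, evo]
  simp [sub_eq_add_neg]

lemma Nice.sub (hF : Nice F) (hG : Nice G) : Nice fun t x => F t x - G t x := by
  obtain ⟨M, hM⟩ := hF.bounded
  obtain ⟨R, hR⟩ := hF.support
  obtain ⟨M', hM'⟩ := hG.bounded
  obtain ⟨R', hR'⟩ := hG.support
  refine ⟨hF.measurable.sub hG.measurable, ⟨M + M', fun t x => (norm_sub_le _ _).trans
    (add_le_add (hM t x) (hM' t x))⟩, ⟨max R R', fun t x hx => ?_⟩⟩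
  by_cases h : F t x = 0
  · have := hR' t x fun h' => hx (by rw [h, h', sub_zero])
    exact ⟨this.1.trans (le_max_right _ _), this.2.trans (le_max_right _ _)⟩
  · have := hR t x h
    exact ⟨this.1.trans (le_max_left _ _), this.2.trans (le_max_left _ _)⟩

/-- The dual estimate bounds differences of truncated integrals by K times the mixed norm of a tail,
which tends to 0. Completeness of L² then makes the limit in the definition a genuine one. -/
lemma FormBound.tendsto_adjointIntegral (hB : FormBound γ I U ρ K) (h : Contractive U)
    (hF : Measurable (Function.uncurry F)) (hFI : ∀ t, t ∉ I → F t = 0)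
    (hFn : mnorm (1 / (1 - timeExp γ ρ)) ρ F ≠ ⊤) (hS : MeasurableSet S) :
    Filter.Tendsto (fun n => ∫ s in S, evo U (trunc F n) s) Filter.atTop
      (nhds (adjointIntegral U S F)) := by
  have hp : 0 < 1 / (1 - timeExp γ ρ) := one_div_pos.2 (by linarith [hB.timeExp_le])
  have hlim := ENNReal.Tendsto.const_mul (a := K) (tendsto_mnorm_sub_trunc hF hp hB.pos hFn)
    (Or.inr hB.ne_top)
  rw [mul_zero] at hlim
  have hc : CauchySeq fun n => ∫ s in S, evo U (trunc F n) s := by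
    rw [EMetric.cauchySeq_iff']
    intro ε hε
    obtain ⟨N, hN⟩ := (hlim.eventually_lt_const hε).exists
    refine ⟨N, fun n hn => lt_of_le_of_lt ?_ hN⟩
    have hn' := nice_trunc hF n
    have hN' := nice_trunc hF N
    rw [edist_eq_enorm_sub, ← integral_sub (h.integrable_evo hn').integrableOn
      (h.integrable_evo hN').integrableOn]
    simp_rw [← evo_sub hn' hN']
    refine (hB.enorm_setIntegral_evo_le h (hn'.sub hN') (fun t ht => ?_) hS).trans
      (mul_le_mul_right (mnorm_mono hp.le hB.pos.le (norm_trunc_sub_trunc_le F hn)) _)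
    ext x
    rw [trunc_of_eq_zero (hFI t ht), trunc_of_eq_zero (hFI t ht)]; simp
  obtain ⟨v, hv⟩ := cauchySeq_tendsto_of_complete hc
  rw [adjointIntegral, Filter.Tendsto.limUnder_eq hv]
  exact hv

lemma FormBound.enorm_adjointIntegral_le (hB : FormBound γ I U ρ K) (h : Contractive U)
    (hF : Measurable (Function.uncurry F)) (hFI : ∀ t, t ∉ I → F t = 0)
    (hFn : mnorm (1 / (1 - timeExp γ ρ)) ρ F ≠ ⊤) (hS : MeasurableSet S) :
    ‖adjointIntegral U S F‖ₑ ≤ K * mnorm (1 / (1 - timeExp γ ρ)) ρ F := by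
  have hp : 0 < 1 / (1 - timeExp γ ρ) := one_div_pos.2 (by linarith [hB.timeExp_le])
  refine le_of_tendsto' (hB.tendsto_adjointIntegral h hF hFI hFn hS).enorm fun n => ?_
  exact (hB.enorm_setIntegral_evo_le h (nice_trunc hF n) (fun t ht => trunc_of_eq_zero (hFI t ht) n)
    hS).trans (mul_le_mul_right (mnorm_mono hp.le hB.pos.le (norm_trunc_le F n)) _)

/-- The weak integral exists for every function in the dual mixed norm. -/
lemma FormBound.isAdjointIntegral (hB : FormBound γ I U ρ K) (h : Contractive U) (hγ : 0 < γ)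
    (hr : (ENNReal.ofReal ρ).HolderConjugate r) (hI : MeasurableSet I)
    (hF : Measurable (Function.uncurry F)) (hFI : ∀ t, t ∉ I → F t = 0)
    (hFn : mnorm (1 / (1 - timeExp γ ρ)) ρ F ≠ ⊤) (hS : MeasurableSet S) :
    IsAdjointIntegral U S F (adjointIntegral U S F) := by
  have hθ1 : timeExp γ ρ < 1 := by linarith [hB.timeExp_le]
  -- This majorant comes from Hölder in x. It is integrable in s by Hölder in t and the homogeneous
  -- estimate, and it dominates the pairings of F and of all its truncations at once.
  set b : L2 d → ℝ → ℝ≥0∞ := fun φ s => snorm ρ (F s) * eLpNorm (U s φ) r volume with hb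
  have hsm := measurable_snorm_of_measurable hF ρ
  have hUm : ∀ φ, Measurable fun s => eLpNorm (U s φ) r volume := fun φ =>
    measurable_eLpNorm_apply hB.one_le hr (h.continuous_apply φ).stronglyMeasurable
  have hbm : ∀ φ, Measurable (b φ) := fun φ => hsm.mul (hUm φ)
  have hbi : ∀ φ, ∫⁻ s, b φ s ≠ ⊤ := by
    intro φ
    have h1 : ∫⁻ s, b φ s = ∫⁻ s in I, b φ s := by
      rw [← lintegral_indicator hI]
      congr 1; ext s
      by_cases hs : s ∈ I
      · rw [Set.indicator_of_mem hs]
      · rw [Set.indicator_of_notMem hs, hb]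
        simp only
        rw [hFI s hs, snorm_eq_eLpNorm hB.pos, eLpNorm_zero, zero_mul]
    rw [h1]
    refine ne_top_of_le_ne_top (ENNReal.mul_ne_top hFn (ENNReal.mul_ne_top hB.ne_top
      (enorm_ne_top (x := φ)))) ((lintegral_mul_le_lnorm_mul_eLpNorm (hB.timeExp_nonneg hγ) hθ1 hsm
      (hUm φ)).trans (mul_le_mul' (ENNReal.rpow_le_rpow (lintegral_mono' Measure.restrict_le_self
        le_rfl) ?_) (hB.mixedNorm_apply_le h hγ hr hI φ)))
    rw [one_div_one_div]; linarith
  have hbf : ∀ φ, ∀ᵐ s, b φ s < ⊤ := fun φ => ae_lt_top (hbm φ) (hbi φ)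
  have hFs : ∀ s, Measurable (F s) := fun s => hF.comp measurable_prodMk_left
  have hle : ∀ φ s, ∫⁻ x, ‖inner ℂ (F s x) (U s φ x)‖ₑ ≤ b φ s := fun φ s =>
    lintegral_enorm_inner_le hB.pos hr (hFs s).aestronglyMeasurable (Lp.aestronglyMeasurable _)
  have hpi : ∀ φ, ∀ᵐ s, Integrable fun x => inner ℂ (F s x) (U s φ x) := by
    intro φ
    filter_upwards [hbf φ] with s hs
    exact ⟨(hFs s).aestronglyMeasurable.inner (Lp.aestronglyMeasurable _), (hle φ s).trans_lt hs⟩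
  set Φ : L2 d → ℝ → ℂ := fun φ s => ∫ x, inner ℂ (F s x) (U s φ x) with hΦ
  set Ψ : L2 d → ℕ → ℝ → ℂ := fun φ n s => inner ℂ (toL2 (trunc F n s)) (U s φ) with hΨ
  have hlim : ∀ φ, ∀ᵐ s, Filter.Tendsto (fun n => Ψ φ n s) Filter.atTop (nhds (Φ φ s)) := by
    intro φ
    filter_upwards [hpi φ] with s hs
    simp only [hΨ, hΦ]
    simp_rw [fun n => inner_toL2 (((nice_trunc hF n).test s).memLp 2) (U s φ)]
    refine tendsto_integral_of_dominated_convergence (fun x => ‖inner ℂ (F s x) (U s φ x)‖)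
      (fun n => ((nice_trunc hF n).test s).measurable.aestronglyMeasurable.inner
        (Lp.aestronglyMeasurable _)) hs.norm
      (fun n => Filter.Eventually.of_forall fun x => ?_) (Filter.Eventually.of_forall fun x => ?_)
    · by_cases hx : (s, x) ∈ truncRegion F n
      · rw [trunc, Set.indicator_of_mem hx]; exact le_rfl
      · rw [trunc, Set.indicator_of_notMem hx, inner_zero_left, norm_zero]; exact norm_nonneg _
    · refine tendsto_const_nhds.congr' ?_
      filter_upwards [eventually_trunc_eq F s x] with n hn
      rw [hn]
  have hΨm : ∀ φ n, StronglyMeasurable (Ψ φ n) := fun φ n =>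
    StronglyMeasurable.inner (𝕜 := ℂ) (stronglyMeasurable_toL2 (nice_trunc hF n).measurable
      fun t => ((nice_trunc hF n).test t).memLp 2) (h.continuous_apply φ).stronglyMeasurable
  have hΨle : ∀ φ n s, ‖Ψ φ n s‖ₑ ≤ b φ s := fun φ n s =>
    (((nice_trunc hF n).test s).enorm_inner_toL2_le hB.pos hr _).trans
      (mul_le_mul_left (snorm_mono hB.pos.le (norm_trunc_le F n s)) _)
  have hΦm : ∀ φ, AEStronglyMeasurable (Φ φ) volume := fun φ =>
    aestronglyMeasurable_of_tendsto_ae Filter.atTop (fun n => (hΨm φ n).aestronglyMeasurable) (hlim φ)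
  refine ⟨fun φ => ae_restrict_of_ae (hpi φ), fun φ => ?_, fun φ => ?_⟩
  · refine Integrable.integrableOn ⟨hΦm φ, ?_⟩
    exact (lintegral_mono fun s => (enorm_integral_le_lintegral_enorm _).trans (hle φ s)).trans_lt
      (hbi φ).lt_top
  -- The identity holds for truncations, where the integral is a Bochner integral. The left side
  -- converges by the L² limit, and the right side by dominated convergence.
  · have h1 := (hB.tendsto_adjointIntegral h hF hFI hFn hS).inner (tendsto_const_nhds (x := φ)) (𝕜 := ℂ)
    refine tendsto_nhds_unique h1 ?_
    have h2 : ∀ n, inner ℂ (∫ s in S, evo U (trunc F n) s) φ = ∫ s in S, Ψ φ n s := by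
      intro n
      rw [← inner_conj_symm, ← integral_inner (h.integrable_evo (nice_trunc hF n)).integrableOn,
        ← integral_conj]
      refine integral_congr_ae (Filter.Eventually.of_forall fun s => ?_)
      simp only [hΨ]
      rw [inner_conj_symm, evo, ContinuousLinearMap.adjoint_inner_left]
    simp_rw [h2]
    refine tendsto_integral_of_dominated_convergence (fun s => (b φ s).toReal)
      (fun n => (hΨm φ n).aestronglyMeasurable)
      (integrable_toReal_of_lintegral_ne_top (hbm φ).aemeasurable (hbi φ)).integrableOn
      (fun n => ae_restrict_of_ae ?_) (ae_restrict_of_ae (hlim φ))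
    filter_upwards [hbf φ] with s hs
    rw [← toReal_enorm]
    exact ENNReal.toReal_mono hs.ne (hΨle φ n s)

/-! ### The retarded estimate -/

/-- The L^r norm is a supremum of functionals continuous on L², hence lower semicontinuous for L²
convergence. -/
lemma eLpNorm_rpow_le_liminf {q : ℝ} (hq : 0 < q) (hρ : 1 ≤ ρ)
    (hr : (ENNReal.ofReal ρ).HolderConjugate r) {u : ℕ → L2 d} {v : L2 d}
    (h : Filter.Tendsto u Filter.atTop (nhds v)) :
    eLpNorm v r volume ^ q ≤ Filter.liminf (fun n => eLpNorm (u n) r volume ^ q) Filter.atTop := by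
  obtain ⟨g, -, -, hg⟩ := exists_norming_seq d hρ hr
  have h1 : eLpNorm v r volume ^ q = ⨆ k, ‖inner ℂ (toL2 (g k)) v‖ₑ ^ q := by
    rw [hg]; exact (ENNReal.orderIsoRpow q hq).map_iSup _
  rw [h1]
  refine iSup_le fun k => ?_
  have h2 : Filter.Tendsto (fun n => ‖inner ℂ (toL2 (g k)) (u n)‖ₑ ^ q) Filter.atTop
      (nhds (‖inner ℂ (toL2 (g k)) v‖ₑ ^ q)) :=
    ((ENNReal.continuous_rpow_const (y := q)).tendsto _).comp
      ((Filter.Tendsto.inner (𝕜 := ℂ) (tendsto_const_nhds (x := toL2 (g k))) h).enorm)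
  rw [← h2.liminf_eq]
  refine Filter.liminf_le_liminf (Filter.Eventually.of_forall fun n => ?_)
  refine ENNReal.rpow_le_rpow ?_ hq.le
  rw [hg]
  exact le_iSup (fun k => ‖inner ℂ (toL2 (g k)) (u n)‖ₑ) k

/-- The estimate for truncations with D = (0, ∞) is uniform. At each t the truncated retarded
integrals converge in L², so lower semicontinuity in x and Fatou's lemma in t preserve the bound.
For q = ∞ the L² bound of the integral is used directly. -/
lemma FormBound.mixedNorm_adjointIntegral_le (hB : FormBound γ I U ρ K) (hB' : FormBound γ I U ρ' K')
    (h : Contractive U) (hγ : 0 < γ) (hr : (ENNReal.ofReal ρ).HolderConjugate r)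
    (hr' : (ENNReal.ofReal ρ').HolderConjugate r')
    (hL : timeExp γ ρ' ≤ timeExp γ ρ → K ^ (1 + timeExp γ ρ' / timeExp γ ρ) ≤ L)
    (hL' : timeExp γ ρ ≤ timeExp γ ρ' → K' ^ (1 + timeExp γ ρ / timeExp γ ρ') ≤ L)
    (hI : MeasurableSet I) (hF : Measurable (Function.uncurry F)) (hFI : ∀ t, t ∉ I → F t = 0)
    (hFn : mnorm (1 / (1 - timeExp γ ρ)) ρ F ≠ ⊤) :
    mixedNorm (ENNReal.ofReal (timeExp γ ρ'))⁻¹ r' I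
      (fun t => U t (adjointIntegral U (Set.Iio t) F))
      ≤ L * mnorm (1 / (1 - timeExp γ ρ)) ρ F := by
  have hp : 0 < 1 / (1 - timeExp γ ρ) := one_div_pos.2 (by linarith [hB.timeExp_le])
  have hIio : ∀ t : ℝ, (fun s => t - s) ⁻¹' Set.Ioi 0 = Set.Iio t := fun t => by
    ext s; simp
  have hlim : ∀ t, Filter.Tendsto (fun n => U t (retard U (Set.Ioi 0) (trunc F n) t)) Filter.atTop
      (nhds (U t (adjointIntegral U (Set.Iio t) F))) := fun t => by
    refine ((U t).continuous.tendsto _).comp ?_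
    simp only [retard, hIio]
    exact hB.tendsto_adjointIntegral h hF hFI hFn measurableSet_Iio
  rcases eq_or_lt_of_le (hB'.timeExp_nonneg hγ) with h0 | h0
  · rw [timeExp_eq_zero hγ h0.symm] at hr'
    have hL1 : K ≤ L := by
      have := hL (by rw [← h0]; exact hB.timeExp_nonneg hγ)
      rwa [← h0, zero_div, add_zero, ENNReal.rpow_one] at this
    rw [← h0, eq_two_of_holderConjugate hr', ENNReal.ofReal_zero, ENNReal.inv_zero]
    refine mixedNorm_top_two_le I (u := fun t => U t (adjointIntegral U (Set.Iio t) F)) fun t => ?_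
    exact (enorm_le_iff_norm_le.2 (h.norm_apply_le t _)).trans
      ((hB.enorm_adjointIntegral_le h hF hFI hFn measurableSet_Iio).trans (mul_le_mul_left hL1 _))
  · set q := 1 / timeExp γ ρ' with hq
    have hq0 : 0 < q := one_div_pos.2 h0
    set N := mnorm (1 / (1 - timeExp γ ρ)) ρ F
    have hn : ∀ n, ∫⁻ t in I, eLpNorm (U t (retard U (Set.Ioi 0) (trunc F n) t)) r' volume ^ q
        ≤ (L * N) ^ q := by
      intro n
      have h1 := (hB.mixedNorm_retard_le hB' h hγ hr hr' hL hL' hI (measurableSet_Ioi (a := (0 : ℝ)))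
        (nice_trunc hF n) fun t ht => trunc_of_eq_zero (hFI t ht) n).trans
        (mul_le_mul_right (mnorm_mono hp.le hB.pos.le (norm_trunc_le F n)) _)
      rw [mixedNorm, eLpNorm_inv_ofReal _ h0] at h1
      have h2 := ENNReal.rpow_le_rpow h1 hq0.le
      rwa [← ENNReal.rpow_mul, hq, mul_one_div_cancel h0.ne', ENNReal.rpow_one] at h2
    rw [mixedNorm, eLpNorm_inv_ofReal _ h0]
    calc _ ≤ ((L * N) ^ q) ^ timeExp γ ρ' := by
          refine ENNReal.rpow_le_rpow ?_ h0.le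
          refine (lintegral_mono fun t => eLpNorm_rpow_le_liminf hq0 hB'.one_le hr' (hlim t)).trans ?_
          refine (lintegral_liminf_le fun n => (measurable_eLpNorm_apply hB'.one_le hr'
            (h.stronglyMeasurable_apply (h.stronglyMeasurable_retard measurableSet_Ioi
              (nice_trunc hF n)))).pow_const q).trans ?_
          exact (Filter.liminf_le_liminf (Filter.Eventually.of_forall hn)).trans
            (by rw [Filter.liminf_const])
      _ = L * N := by
          rw [← ENNReal.rpow_mul, hq, one_div_mul_cancel h0.ne', ENNReal.rpow_one]

end

section

variable {d : ℕ} {γ : ℝ} {I : Set ℝ} {U : ℝ → L2 d →L[ℂ] L2 d} {F F' : ℝ → Space d → ℂ} {S : Set ℝ}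
  {ρ ρ' θ p : ℝ} {q r : ℝ≥0∞} {K K' L : ℝ≥0∞} {w : ℝ → ℝ≥0∞} {b f g c : Fin d → ℝ → ℝ}

/-! ### From the dispersive estimate for the evolution operator to the bilinear estimate -/

lemma measurableSet_symmInterval (T : ℝ≥0∞) : MeasurableSet (symmInterval T) :=
  measurableSet_lt measurable_enorm measurable_const

lemma sub_mem_symmInterval {T : ℝ≥0∞} {s t : ℝ} (hs : s ∈ symmInterval T) (ht : t ∈ symmInterval T) :
    t - s ∈ symmInterval (2 * T) := by
  have h : ‖t - s‖ₑ < 2 * T := by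
    rw [two_mul]
    exact enorm_sub_le.trans_lt (ENNReal.add_lt_add ht hs)
  exact h

/-- The dispersive estimate is assumed for every pair of times, so a measurable version of w must
dominate it everywhere and not just almost everywhere. The value ∞ on a null set achieves this
without affecting the weak norm. -/
lemma exists_measurable_ge (hw : AEMeasurable w) : ∃ w', Measurable w' ∧ w ≤ w' ∧ w' =ᵐ[volume] w := by
  classical
  set N := toMeasurable volume {t | w t ≠ hw.mk w t}
  have hN : volume N = 0 := by rw [measure_toMeasurable]; exact hw.ae_eq_mk
  refine ⟨fun t => if t ∈ N then ⊤ else hw.mk w t,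
    Measurable.ite (measurableSet_toMeasurable _ _) measurable_const hw.measurable_mk, fun t => ?_, ?_⟩
  · by_cases ht : t ∈ N
    · simp [ht]
    · have : w t = hw.mk w t := by
        by_contra h
        exact ht (subset_toMeasurable _ _ h)
      simp [ht, this]
  · filter_upwards [measure_eq_zero_iff_ae_notMem.1 hN, hw.ae_eq_mk] with t ht ht'
    simp [ht, ht']

lemma weakL1Norm_indicator_le (S : Set ℝ) (w : ℝ → ℝ≥0∞) : weakL1Norm (S.indicator w) ≤ weakL1Norm w :=
  iSup_mono fun _ => mul_le_mul_right (measure_mono fun _ ht =>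
    lt_of_lt_of_le ht (Set.indicator_le_self S w _)) _

lemma Setting.contractive (h : Setting γ b f g c U w) : Contractive U :=
  ⟨fun t φ => (h.norm_apply t φ).le, h.continuous_apply⟩

/-- Times in (-T, T) have differences in (-2T, 2T), so the weight may be cut off there; this
localises the constant. The L¹ to L^∞ bound becomes a bound for the form by pairing with the second
test function. -/
lemma Setting.exists_dispersive (h : Setting γ b f g c U w) (hγ : 0 < γ) (T : ℝ≥0∞) {A : ℝ≥0}
    (hA : 0 < A) (hwA : weakL1Norm ((symmInterval (2 * T)).indicator w) ≤ A) :
    ∃ w', Dispersive γ (symmInterval T) w' A U := by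
  obtain ⟨w', hm, hle, hae⟩ := exists_measurable_ge h.memWeakL1.1
  refine ⟨(symmInterval (2 * T)).indicator w', h.contractive,
    hm.indicator (measurableSet_symmInterval _), hA, fun a => ?_, fun s hs t ht f g hf hg => ?_⟩
  · refine le_trans (le_of_eq ?_) ((le_iSup (fun a : ℝ≥0 => (a : ℝ≥0∞) *
      volume {τ : ℝ | (a : ℝ≥0∞) < (symmInterval (2 * T)).indicator w τ}) a).trans hwA)
    congr 1
    refine measure_congr ?_
    filter_upwards [hae] with τ hτ
    have : (symmInterval (2 * T)).indicator w' τ = (symmInterval (2 * T)).indicator w τ := by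
      by_cases h : τ ∈ symmInterval (2 * T)
      · rw [Set.indicator_of_mem h, Set.indicator_of_mem h, hτ]
      · rw [Set.indicator_of_notMem h, Set.indicator_of_notMem h]
    exact congrArg ((a : ℝ≥0∞) < ·) this
  · rw [Set.indicator_of_mem (sub_mem_symmInterval hs ht), ContinuousLinearMap.adjoint_inner_right,
      ← RCLike.enorm_conj, inner_conj_symm]
    have hr : (ENNReal.ofReal 1).HolderConjugate ⊤ := by
      rw [ENNReal.ofReal_one]; infer_instance
    refine (hg.enorm_inner_toL2_le one_pos hr _).trans ?_
    have h1 := h.dispersive t s (toL2 f) ((memLp_congr_ae hf.coeFn_toL2).2 (hf.memLp 1))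
    rw [eLpNorm_congr_ae hf.coeFn_toL2, ← snorm_one] at h1
    calc _ ≤ snorm 1 g * (w (t - s) ^ γ * snorm 1 f) := mul_le_mul_right h1 _
      _ ≤ snorm 1 g * (w' (t - s) ^ γ * snorm 1 f) :=
          mul_le_mul_right (mul_le_mul_left (ENNReal.rpow_le_rpow (hle _) hγ.le) _) _
      _ = _ := by ring

/-- The weak norm may vanish whereas `Dispersive` requires a positive constant; the bound is
obtained with the norm plus ε and a limit is taken. The factor 1 + C is at least 1, as needed when θ
= 0, and its square dominates C. -/
lemma Setting.formBound (h : Setting γ b f g c U w) (hγ : 0 < γ) (h1 : 1 ≤ ρ) (h2 : ρ ≤ 2)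
    (hθ : timeExp γ ρ ≤ 1 / 2) {C : ℝ≥0} (hC : BilinearBound γ ρ C) (T : ℝ≥0∞) :
    FormBound γ (symmInterval T) U ρ (((1 + C : ℝ≥0) : ℝ≥0∞) *
      weakL1Norm ((symmInterval (2 * T)).indicator w) ^ timeExp γ ρ) := by
  set W := weakL1Norm ((symmInterval (2 * T)).indicator w)
  have hW : W ≠ ⊤ := ((weakL1Norm_indicator_le _ w).trans_lt h.memWeakL1.2).ne
  have hρ0 : 0 < ρ := by linarith
  have hθ0 : 0 ≤ timeExp γ ρ := by
    refine mul_nonneg hγ.le ?_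
    rw [sub_nonneg]
    exact one_div_le_one_div_of_le hρ0 h2
  refine ⟨h1, h2, hθ, ENNReal.mul_ne_top ENNReal.coe_ne_top (ENNReal.rpow_ne_top_of_nonneg hθ0 hW),
    fun h0 => ?_, fun D hD F G hF hG hFI hGI => ?_⟩
  · rw [h0, ENNReal.rpow_zero, mul_one]
    exact_mod_cast le_self_add
  · have hp : 0 < 1 / (1 - timeExp γ ρ) := one_div_pos.2 (by linarith)
    have hlim : ‖bform U D F G‖ₑ ≤ C * W ^ (2 * timeExp γ ρ) *
        (mnorm (1 / (1 - timeExp γ ρ)) ρ F * mnorm (1 / (1 - timeExp γ ρ)) ρ G) := by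
      refine le_mul_rpow_of_forall_pos ENNReal.coe_ne_top (ENNReal.mul_ne_top
        (hF.mnorm_ne_top hp hρ0) (hG.mnorm_ne_top hp hρ0)) fun ε hε => ?_
      have hWε : ((W.toNNReal + ε : ℝ≥0) : ℝ≥0∞) = W + ε := by
        rw [ENNReal.coe_add, ENNReal.coe_toNNReal hW]
      obtain ⟨w', hw'⟩ := h.exists_dispersive hγ T (A := W.toNNReal + ε) (by positivity)
        (by rw [hWε]; exact le_self_add)
      rw [← hWε]
      exact hC d _ w' _ U hw' D hD F G hF hG hFI hGI
    refine hlim.trans (mul_le_mul_left ?_ _)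
    rw [ENNReal.mul_rpow_of_nonneg _ _ two_pos.le, ← ENNReal.rpow_mul, mul_comm (timeExp γ ρ)]
    refine mul_le_mul_left ?_ _
    rw [← ENNReal.coe_rpow_of_nonneg _ two_pos.le, ENNReal.coe_le_coe]
    have : (1 + C) ^ (2 : ℝ) = (1 + C) ^ 2 := by rw [← NNReal.rpow_natCast]; norm_num
    rw [this]
    nlinarith [zero_le (a := C), zero_le (a := C ^ 2)]

/-! ### Admissible exponents -/

/-- Admissible pairs are parametrised by ρ = r'. Admissibility says that 1 / q = θ, the condition q
≥ 2 says θ ≤ 1/2, and the excluded triple (2, ∞, 1) is exactly θ = 1/2 with ρ = 1. -/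
lemma SharpAdmissible.exists_exponents (hγ : 0 < γ) (h : SharpAdmissible γ q r) :
    ∃ ρ : ℝ, 1 ≤ ρ ∧ ρ ≤ 2 ∧ 0 ≤ timeExp γ ρ ∧ timeExp γ ρ ≤ 1 / 2 ∧ ¬(timeExp γ ρ = 1 / 2 ∧ ρ = 1) ∧
      (ENNReal.ofReal ρ).HolderConjugate r ∧ q = (ENNReal.ofReal (timeExp γ ρ))⁻¹ ∧
      r.conjExponent = ENNReal.ofReal ρ ∧
      q.conjExponent = ENNReal.ofReal (1 / (1 - timeExp γ ρ)) := by
  obtain ⟨hq, hr, hne, heq⟩ := h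
  have hrc : r.HolderConjugate r.conjExponent :=
    ENNReal.HolderConjugate.conjExponent (le_trans (by norm_num) hr)
  have hqc : q.HolderConjugate q.conjExponent :=
    ENNReal.HolderConjugate.conjExponent (le_trans (by norm_num) hq)
  have h1 := ENNReal.holderConjugate_iff.1 hrc
  have hr2 : r⁻¹ ≤ 2⁻¹ := ENNReal.inv_le_inv.2 hr
  have hle2 : r.conjExponent ≤ 2 := by
    rw [← ENNReal.inv_le_inv]
    by_contra hlt
    rw [not_le] at hlt
    have := ENNReal.add_lt_add_of_le_of_lt (ne_top_of_le_ne_top (by simp) hr2) hr2 hlt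
    rw [h1, ENNReal.inv_two_add_inv_two] at this
    exact lt_irrefl _ this
  have hge1 : 1 ≤ r.conjExponent := by
    rw [← ENNReal.inv_le_inv, inv_one, ← h1]; exact le_add_self
  have htop : r.conjExponent ≠ ⊤ := ne_top_of_le_ne_top (by simp) hle2
  set ρ := r.conjExponent.toReal with hρ
  have hρr : r.conjExponent = ENNReal.ofReal ρ := (ENNReal.ofReal_toReal htop).symm
  have hρ1 : 1 ≤ ρ := by
    rw [hρ, ← ENNReal.toReal_one]; exact ENNReal.toReal_mono htop hge1
  have hρ2 : ρ ≤ 2 := by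
    have := ENNReal.toReal_mono (by simp) hle2
    simpa using this
  have hρ0 : 0 < ρ := by linarith
  have hconj : (ENNReal.ofReal ρ).HolderConjugate r := by rw [← hρr]; exact hrc.symm
  have hθ0 : 0 ≤ timeExp γ ρ := by
    refine mul_nonneg hγ.le ?_
    rw [sub_nonneg]
    exact one_div_le_one_div_of_le hρ0 hρ2
  have hri := inv_eq_ofReal hρ0 hconj
  have hqi : q⁻¹ = ENNReal.ofReal (timeExp γ ρ) := by
    rw [hri, ← ENNReal.ofReal_mul hγ.le, div_eq_mul_inv (ENNReal.ofReal γ),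
      show (2 : ℝ≥0∞)⁻¹ = ENNReal.ofReal 2⁻¹ by rw [ENNReal.ofReal_inv_of_pos two_pos]; simp,
      ← ENNReal.ofReal_mul hγ.le] at heq
    rw [ENNReal.eq_sub_of_add_eq (by simp) heq, ← ENNReal.ofReal_sub _ (mul_nonneg hγ.le (by
      rw [sub_nonneg, div_le_one hρ0]; exact hρ1)), timeExp]
    congr 1; ring
  have hθ : timeExp γ ρ ≤ 1 / 2 := by
    have h2 : q⁻¹ ≤ 2⁻¹ := ENNReal.inv_le_inv.2 hq
    rw [hqi, show (2 : ℝ≥0∞)⁻¹ = ENNReal.ofReal (1 / 2) by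
      rw [one_div, ENNReal.ofReal_inv_of_pos two_pos]; simp] at h2
    exact (ENNReal.ofReal_le_ofReal_iff (by norm_num)).1 h2
  have hqθ : q = (ENNReal.ofReal (timeExp γ ρ))⁻¹ := by rw [← hqi, inv_inv]
  refine ⟨ρ, hρ1, hρ2, hθ0, hθ, fun ⟨he, hρe⟩ => hne ⟨?_, ?_, ?_⟩, hconj, hqθ, hρr, ?_⟩
  · rw [hqθ, he, one_div, ENNReal.ofReal_inv_of_pos two_pos, inv_inv]; simp
  · rw [hρe] at hri
    simpa using hri
  · rw [hρe, timeExp] at he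
    linarith
  · have hpq : q.HolderConjugate (ENNReal.ofReal (1 / (1 - timeExp γ ρ))) := by
      rw [ENNReal.holderConjugate_iff, hqi, one_div, ENNReal.ofReal_inv_of_pos (by linarith), inv_inv,
        ← ENNReal.ofReal_add hθ0 (by linarith)]
      simp
    exact ENNReal.HolderConjugate.unique q _ _

lemma mixedNorm_ofReal (hp : 0 < p) (hρ : 0 < ρ) (hI : MeasurableSet I) (hFI : ∀ t, t ∉ I → F t = 0) :
    mixedNorm (ENNReal.ofReal p) (ENNReal.ofReal ρ) I F = mnorm p ρ F := by
  rw [mixedNorm, eLpNorm_eq_lintegral_rpow_enorm_toReal (by simpa using hp) (by simp),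
    ENNReal.toReal_ofReal hp.le, mnorm, lnorm, ← lintegral_indicator hI]
  congr 2; ext t
  by_cases ht : t ∈ I
  · rw [Set.indicator_of_mem ht, enorm_eq_self, snorm_eq_eLpNorm hρ]
  · rw [Set.indicator_of_notMem ht, hFI t ht, snorm_eq_eLpNorm hρ, eLpNorm_zero,
      ENNReal.zero_rpow_of_pos hp]

/-! ### Measurable representatives -/

/-- By Fubini, an almost everywhere equal measurable version agrees with F on almost every slice.
This leaves both the mixed norm and the weak integrals unchanged, so F may be assumed measurable and
zero outside I. -/
lemma MemMixed.exists_measurable (hI : MeasurableSet I) (h : MemMixed q r I F) :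
    ∃ F' : ℝ → Space d → ℂ, Measurable (Function.uncurry F') ∧ (∀ t, t ∉ I → F' t = 0) ∧
      (∀ᵐ t ∂volume.restrict I, F' t =ᵐ[volume] F t) ∧ mixedNorm q r I F' = mixedNorm q r I F := by
  set m := h.1.mk (Function.uncurry F)
  set F' : ℝ → Space d → ℂ := I.indicator fun t x => m (t, x) with hF'
  have hae : ∀ᵐ t ∂volume.restrict I, F' t =ᵐ[volume] F t := by
    filter_upwards [Measure.ae_ae_of_ae_prod h.1.ae_eq_mk, ae_restrict_mem hI] with t ht htI
    filter_upwards [ht] with x hx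
    rw [hF', Set.indicator_of_mem htI]
    exact hx.symm
  refine ⟨F', ?_, fun t ht => Set.indicator_of_notMem ht _, hae, ?_⟩
  · have he : Function.uncurry F' = (Prod.fst ⁻¹' I).indicator m := by
      ext ⟨t, x⟩
      by_cases ht : t ∈ I
      · rw [Set.indicator_of_mem (by exact ht), Function.uncurry_apply_pair, hF',
          Set.indicator_of_mem ht]
      · rw [Set.indicator_of_notMem (by exact ht), Function.uncurry_apply_pair, hF',
          Set.indicator_of_notMem ht, Pi.zero_apply]
    rw [he]
    exact h.1.stronglyMeasurable_mk.measurable.indicator (hI.preimage measurable_fst)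
  · refine eLpNorm_congr_ae ?_
    filter_upwards [hae] with t ht using eLpNorm_congr_ae ht

lemma IsAdjointIntegral.congr {v : L2 d} (h : IsAdjointIntegral U S F' v)
    (hae : ∀ᵐ t ∂volume.restrict S, F' t =ᵐ[volume] F t) : IsAdjointIntegral U S F v := by
  have h1 : ∀ φ : L2 d, ∀ᵐ s ∂volume.restrict S,
      (fun x => inner ℂ (F' s x) (U s φ x)) =ᵐ[volume] fun x => inner ℂ (F s x) (U s φ x) := by
    intro φ
    filter_upwards [hae] with s hs
    filter_upwards [hs] with x hx
    rw [hx]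
  have h2 : ∀ φ : L2 d, (fun s => ∫ x, inner ℂ (F' s x) (U s φ x)) =ᵐ[volume.restrict S]
      fun s => ∫ x, inner ℂ (F s x) (U s φ x) := fun φ => by
    filter_upwards [h1 φ] with s hs using integral_congr_ae hs
  refine ⟨fun φ => ?_, fun φ => (h.integrable φ).congr (h2 φ), fun φ =>
    (h.inner_eq φ).trans (integral_congr_ae (h2 φ))⟩
  filter_upwards [h.integrable_pairing φ, h1 φ] with s hs hs' using hs.congr hs'

/-- For functions vanishing outside I, the integral over s < t with s ∈ I is the integral over all s
< t, which is the form produced by D = (0, ∞). -/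
lemma adjointIntegral_inter (hS : MeasurableSet S) (hFI : ∀ t, t ∉ I → F t = 0) :
    adjointIntegral U (I ∩ S) F = adjointIntegral U S F := by
  rw [adjointIntegral, adjointIntegral]
  congr 1; ext1 n
  refine (setIntegral_eq_of_subset_of_forall_sdiff_eq_zero hS Set.inter_subset_right
    fun t ht => ?_).symm
  exact evo_eq_zero (trunc_of_eq_zero (hFI t fun h => ht.2 ⟨h, ht.1⟩) n)

end

/-! ### Constants and assembly of the three estimates -/

section

/-- Off-diagonal constants come as K ^ (1 + β / α) with K = C W ^ α, which yields W ^ (α + β). If α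
= 0, then β = 0 as well, and both powers of W have exponent 0. -/
lemma mul_rpow_rpow_le {α β : ℝ} (hα : 0 ≤ α) (hβ : 0 ≤ β) (h : β ≤ α) {C : ℝ≥0} {W : ℝ≥0∞} :
    ((C : ℝ≥0∞) * W ^ α) ^ (1 + β / α) ≤ (C ^ (1 + β / α) : ℝ≥0) * W ^ (β + α) := by
  have he : 0 ≤ 1 + β / α := by positivity
  rw [ENNReal.mul_rpow_of_nonneg _ _ he, ← ENNReal.coe_rpow_of_nonneg _ he, ← ENNReal.rpow_mul]
  refine mul_le_mul_right (le_of_eq ?_) _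
  congr 1
  rcases eq_or_lt_of_le hα with rfl | hα
  · have : β = 0 := le_antisymm h hβ
    simp [this]
  · field_simp; ring

end

end Strichartz

end

theorem lemma5 (d : ℕ) (γ : ℝ) (hγ : 0 < γ) :
    -- homogeneous estimate
    (∀ q r : ℝ≥0∞, Strichartz.SharpAdmissible γ q r → ∃ C : ℝ≥0,
      ∀ (b f g c : Fin d → ℝ → ℝ) (U : ℝ → Strichartz.L2 d →L[ℂ] Strichartz.L2 d)
        (w : ℝ → ℝ≥0∞), Strichartz.Setting γ b f g c U w →
      ∀ (T : ℝ≥0∞) (φ : Strichartz.L2 d),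
        Strichartz.mixedNorm q r (Strichartz.symmInterval T) (fun t => U t φ)
          ≤ C * Strichartz.weakL1Norm ((Strichartz.symmInterval (2 * T)).indicator w)
              ^ (q⁻¹).toReal * ‖φ‖ₑ) ∧
    -- dual estimate
    (∀ q r : ℝ≥0∞, Strichartz.SharpAdmissible γ q r → ∃ C : ℝ≥0,
      ∀ (b f g c : Fin d → ℝ → ℝ) (U : ℝ → Strichartz.L2 d →L[ℂ] Strichartz.L2 d)
        (w : ℝ → ℝ≥0∞), Strichartz.Setting γ b f g c U w →
      ∀ (T : ℝ≥0∞) (F : ℝ → Strichartz.Space d → ℂ),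
        Strichartz.MemMixed q.conjExponent r.conjExponent (Strichartz.symmInterval T) F →
        ∃ v : Strichartz.L2 d,
          Strichartz.IsAdjointIntegral U (Strichartz.symmInterval T) F v ∧
          ‖v‖ₑ ≤ C * Strichartz.weakL1Norm ((Strichartz.symmInterval (2 * T)).indicator w)
              ^ (q⁻¹).toReal *
            Strichartz.mixedNorm q.conjExponent r.conjExponent (Strichartz.symmInterval T) F) ∧
    -- inhomogeneous (retarded) estimate
    (∀ q r q' r' : ℝ≥0∞, Strichartz.SharpAdmissible γ q r → Strichartz.SharpAdmissible γ q' r' →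
      ∃ C : ℝ≥0,
      ∀ (b f g c : Fin d → ℝ → ℝ) (U : ℝ → Strichartz.L2 d →L[ℂ] Strichartz.L2 d)
        (w : ℝ → ℝ≥0∞), Strichartz.Setting γ b f g c U w →
      ∀ (T : ℝ≥0∞) (F : ℝ → Strichartz.Space d → ℂ),
        Strichartz.MemMixed q'.conjExponent r'.conjExponent (Strichartz.symmInterval T) F →
        ∃ V : ℝ → Strichartz.L2 d,
          (∀ t ∈ Strichartz.symmInterval T, Strichartz.IsAdjointIntegral U
            (Strichartz.symmInterval T ∩ Set.Iio t) F (V t)) ∧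
          Strichartz.mixedNorm q r (Strichartz.symmInterval T) (fun t => U t (V t))
            ≤ C * Strichartz.weakL1Norm ((Strichartz.symmInterval (2 * T)).indicator w)
                ^ ((q⁻¹).toReal + (q'⁻¹).toReal) *
              Strichartz.mixedNorm q'.conjExponent r'.conjExponent
                (Strichartz.symmInterval T) F) := by
  refine ⟨fun q r hqr => ?_, fun q r hqr => ?_, fun q r q' r' hqr hqr' => ?_⟩
  · obtain ⟨ρ, h1, h2, h0, hθ, hne, hr, rfl, -, -⟩ := hqr.exists_exponents hγ
    obtain ⟨C, hC⟩ := Strichartz.exists_bilinearBound hγ h1 h2 hθ hne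
    refine ⟨1 + C, fun b f g c U w h T φ => ?_⟩
    rw [inv_inv, ENNReal.toReal_ofReal h0]
    exact (h.formBound hγ h1 h2 hθ hC T).mixedNorm_apply_le h.contractive hγ hr
      (Strichartz.measurableSet_symmInterval T) φ
  · obtain ⟨ρ, h1, h2, h0, hθ, hne, hr, hqθ, hrc, hqc⟩ := hqr.exists_exponents hγ
    obtain ⟨C, hC⟩ := Strichartz.exists_bilinearBound hγ h1 h2 hθ hne
    refine ⟨1 + C, fun b f g c U w h T F hF => ?_⟩
    have hI := Strichartz.measurableSet_symmInterval T
    have hB := h.formBound hγ h1 h2 hθ hC T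
    obtain ⟨F', hm, hFI, hae, hnorm⟩ := hF.exists_measurable hI
    have hfin := hF.2
    rw [← hnorm, hqc, hrc, Strichartz.mixedNorm_ofReal (one_div_pos.2 (by linarith)) hB.pos hI hFI]
      at hfin
    refine ⟨_, (hB.isAdjointIntegral h.contractive hγ hr hI hm hFI hfin.ne hI).congr hae, ?_⟩
    rw [← hnorm, hqc, hrc, Strichartz.mixedNorm_ofReal (one_div_pos.2 (by linarith)) hB.pos hI hFI,
      hqθ, inv_inv, ENNReal.toReal_ofReal h0]
    exact hB.enorm_adjointIntegral_le h.contractive hm hFI hfin.ne hI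
  · obtain ⟨σ, k1, k2, k0, kθ, kne, ks, rfl, -, -⟩ := hqr.exists_exponents hγ
    obtain ⟨ρ, h1, h2, h0, hθ, hne, hr, hqθ, hrc, hqc⟩ := hqr'.exists_exponents hγ
    obtain ⟨C, hC⟩ := Strichartz.exists_bilinearBound hγ h1 h2 hθ hne
    obtain ⟨C', hC'⟩ := Strichartz.exists_bilinearBound hγ k1 k2 kθ kne
    -- One summand serves each order of the two time exponents, since the off-diagonal constant is
    -- built from the pair with the larger θ. Here ρ belongs to the pair of F and σ to the pair on
    -- the left side.
    refine ⟨(1 + C) ^ (1 + Strichartz.timeExp γ σ / Strichartz.timeExp γ ρ) +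
      (1 + C') ^ (1 + Strichartz.timeExp γ ρ / Strichartz.timeExp γ σ),
      fun b f g c U w h T F hF => ?_⟩
    have hI := Strichartz.measurableSet_symmInterval T
    have hB := h.formBound hγ h1 h2 hθ hC T
    have hB' := h.formBound hγ k1 k2 kθ hC' T
    obtain ⟨F', hm, hFI, hae, hnorm⟩ := hF.exists_measurable hI
    have hfin := hF.2
    rw [← hnorm, hqc, hrc, Strichartz.mixedNorm_ofReal (one_div_pos.2 (by linarith)) hB.pos hI hFI]
      at hfin
    refine ⟨fun t => Strichartz.adjointIntegral U (Set.Iio t) F', fun t _ => ?_, ?_⟩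
    · beta_reduce
      rw [← Strichartz.adjointIntegral_inter measurableSet_Iio hFI]
      exact (hB.isAdjointIntegral h.contractive hγ hr hI hm hFI hfin.ne
        (hI.inter measurableSet_Iio)).congr
        (ae_restrict_of_ae_restrict_of_subset Set.inter_subset_left hae)
    · rw [← hnorm, hqc, hrc, Strichartz.mixedNorm_ofReal (one_div_pos.2 (by linarith)) hB.pos hI hFI,
        hqθ, inv_inv, inv_inv, ENNReal.toReal_ofReal h0, ENNReal.toReal_ofReal k0, ENNReal.coe_add]
      refine hB.mixedNorm_adjointIntegral_le hB' h.contractive hγ hr ks (fun hle => ?_) (fun hle => ?_)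
        hI hm hFI hfin.ne
      · exact (Strichartz.mul_rpow_rpow_le h0 k0 hle).trans (mul_le_mul_left le_self_add _)
      · rw [add_comm (Strichartz.timeExp γ σ)]
        exact (Strichartz.mul_rpow_rpow_le k0 h0 hle).trans (mul_le_mul_left le_add_self _)
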